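/- **Theorem 1.1.** Let $n\ge 1$ and let $\mathrm{Herm}(n)$ be the space of $n\times n$ complex Hermitian matrices with Lebesgue measure $dA=\prod_{j} dA_{jj}\prod_{j<k} d\,\mathrm{Re}A_{jk}\,d\,\mathrm{Im}A_{jk}$. Let $dU$ be normalized Haar measure on $\mathrm{U}(n)$ and $\Delta_n(x)=\prod_{j<k}(x_k-x_j)$. For $s\in\mathbb R^n$ put $S=\mathrm{diag}(s_1,\dots,s_n)$ and $$\varphi_s(A)=\int_{\mathrm{U}(n)}e^{i\,\mathrm{Tr}(SUAU^*)}\,dU ,$$ the bounded spherical functions of the Gelfand pair $(\mathrm{U}(n)\ltimes\mathrm{Herm}(n),\mathrm{U}(n))$. For a unitarily invariant probability density $f$ on $\mathrm{Herm}(n)$ (that is, $f(UAU^*)=f(A)\ge 0$ for all $U$, $A$ and $\int f(A)\,dA=1$) let $$\widehat f(s)=\int_{\mathrm{Herm}(n)} f(A)\,\varphi_s(-A)\,dA$$ be its spherical transform, and write $f(x)=f(\mathrm{diag}(x_1,\dots,x_n))$ for $x\in\mathbb R^n$. Let $X$ and $Y$ be independent unitarily invariant random Hermitian matrices with unitarily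 invariant probability densities $f_X$ and $f_Y$. Then $X+Y$ has a unitarily invariant probability density; let $f_{X+Y}$ be any such density. 1. For each $f\in\{f_X,f_Y,f_{X+Y}\}$ the function $\widehat f$ is continuous on $\mathbb R^n$, and for every $s$ with distinct entries $$\widehat f(s)=\frac{(\pi i)^{n(n-1)/2}}{n!\,\Delta_n(s)}\int_{\mathbb R^n}f(x)\,\det\left[e^{-is_jx_k}\right]_{j,k=1}^n\,\Delta_n(x)\,dx,$$ where the integral converges absolutely. (At other $s$ the right-hand side is understood as a limit.) 2. $\widehat f_{X+Y}(s)=\widehat f_X(s)\,\widehat f_Y(s)$ for all $s\in\mathbb R^n$. 3. For almost every $x\in\mathbb R^n$, and for every $x$ with distinct entries such that $f_{X+Y}$ is continuous at $\mathrm{diag}(x)$, $$f_{X+Y}(x)=\frac{(\pi i)^{-n(n-1)/2}}{(2\pi)^n\,n!\,\Delta_n(x)}\int_{\mathbb R^n}\widehat f_X(s)\,\widehat f_Y(s)\,\det\left[e^{is_jx_k}\right]_{j,k=1}^n\,\Delta_n(s)\,ds .$$ Here the integral is the Lebesgue integral if it converges absolutely; in every case the formula holds with the integral understood as the limit, as $\varepsilon\downarrow0$,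 of the absolutely convergent integrals with the additional factor $e^{-\varepsilon(s_1^2+\cdots+s_n^2)}$ in the integrand. -/

import Mathlib

open MeasureTheory ProbabilityTheory Filter Topology

noncomputable section

/-- The space `Herm(n)` of `n × n` complex Hermitian matrices. -/
abbrev Herm (n : ℕ) : Type := selfAdjoint (Matrix (Fin n) (Fin n) ℂ)

/-- `Herm(n)` carries its Borel σ-algebra (for the usual topology of matrix entries). -/
instance Herm.instMeasurableSpace (n : ℕ) : MeasurableSpace (Herm n) := borel _

instance Herm.instBorelSpace (n : ℕ) : BorelSpace (Herm n) := ⟨rfl⟩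

/-- The unitary group `U(n)`. -/
abbrev UGroup (n : ℕ) : Type := Matrix.unitaryGroup (Fin n) ℂ

instance UGroup.instMeasurableSpace (n : ℕ) : MeasurableSpace (UGroup n) := borel _

instance UGroup.instBorelSpace (n : ℕ) : BorelSpace (UGroup n) := ⟨rfl⟩

theorem UGroup.isCompact_carrier (n : ℕ) :
    IsCompact ((Matrix.unitaryGroup (Fin n) ℂ : Set (Matrix (Fin n) (Fin n) ℂ))) := by
  have hc : IsCompact (Set.pi Set.univ fun _ : Fin n =>
      Set.pi Set.univ fun _ : Fin n => Metric.closedBall (0 : ℂ) 1) :=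
    isCompact_univ_pi fun _ => isCompact_univ_pi fun _ => isCompact_closedBall _ _
  refine IsCompact.of_isClosed_subset hc ?_ ?_
  · have : (Matrix.unitaryGroup (Fin n) ℂ : Set (Matrix (Fin n) (Fin n) ℂ)) =
        {A | A * star A = 1} := by
      ext A
      exact Matrix.mem_unitaryGroup_iff
    rw [this]
    exact isClosed_eq (by fun_prop) continuous_const
  · intro A hA i _ j _
    simpa using entry_norm_bound_of_unitary hA i j

instance UGroup.instCompactSpace (n : ℕ) : CompactSpace (UGroup n) :=
  isCompact_iff_compactSpace.mp (UGroup.isCompact_carrier n)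

/-- The normalized Haar measure `dU` on `U(n)`: the left-invariant measure of total mass one. -/
def haarU (n : ℕ) : Measure (UGroup n) :=
  Measure.haarMeasure (⊤ : TopologicalSpace.PositiveCompacts (UGroup n))

/-- The Hermitian matrix with real diagonal entries `p.1` and with entries `p.2` strictly
above the diagonal. -/
def hermOfCoords (n : ℕ) (p : (Fin n → ℝ) × ({q : Fin n × Fin n // q.1 < q.2} → ℂ)) :
    Herm n :=
  ⟨Matrix.of fun j k =>
      if h : j < k then p.2 ⟨(j, k), h⟩
      else if h : k < j then star (p.2 ⟨(k, j), h⟩)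
      else (p.1 j : ℂ), by
    rw [selfAdjoint.mem_iff]
    ext j k
    rw [Matrix.star_apply]
    simp only [Matrix.of_apply]
    rcases lt_trichotomy j k with h | h | h
    · simp [h, not_lt_of_gt h]
    · subst h
      simp
    · simp [h, not_lt_of_gt h]⟩

theorem measurable_hermOfCoords (n : ℕ) : Measurable (hermOfCoords n) := by
  refine Continuous.measurable ?_
  refine Continuous.subtype_mk ?_ _
  refine continuous_matrix fun j k => ?_
  simp only [Matrix.of_apply]
  split_ifs <;> fun_prop

/-- The flat Lebesgue measure `dA = ∏ⱼ dAⱼⱼ ∏_{j<k} dRe Aⱼₖ dIm Aⱼₖ` on `Herm(n)`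
(the measure `volume` on `ℂ` is `dRe dIm`). -/
def lebHerm (n : ℕ) : Measure (Herm n) := Measure.map (hermOfCoords n) volume

/-- Conjugation `A ↦ U A U*`. -/
def conjHerm {n : ℕ} (U : UGroup n) (A : Herm n) : Herm n :=
  ⟨(U : Matrix (Fin n) (Fin n) ℂ) * (A : Matrix (Fin n) (Fin n) ℂ) *
      star (U : Matrix (Fin n) (Fin n) ℂ), A.2.conjugate _⟩

/-- The diagonal matrix `diag(x₁, …, xₙ)`. For a unitarily invariant function `f` on `Herm(n)`
the value `f(x₁, …, xₙ)` is `f (diagHerm x)`. -/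
def diagHerm {n : ℕ} (x : Fin n → ℝ) : Herm n :=
  ⟨Matrix.diagonal fun j => (x j : ℂ), by
    rw [selfAdjoint.mem_iff, Matrix.star_eq_conjTranspose, Matrix.diagonal_conjTranspose]
    congr 1
    ext j
    simp⟩

/-- `f` is a unitarily invariant probability density function, with respect to Lebesgue measure,
of the law `ρ` on `Herm(n)`. -/
structure IsInvariantDensity {n : ℕ} (f : Herm n → ℝ) (ρ : Measure (Herm n)) : Prop where
  measurable : Measurable f
  nonneg : ∀ A, 0 ≤ f A
  invariant : ∀ (U : UGroup n) (A : Herm n), f (conjHerm U A) = f A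
  law_eq : ρ = (lebHerm n).withDensity fun A => ENNReal.ofReal (f A)

/-- The bounded spherical function `φ_s(A) = ∫_{U(n)} exp(i Tr(S U A U*)) dU`,
`S = diag(s₁, …, sₙ)`, of the Gelfand pair `(U(n) ⋉ Herm(n), U(n))`. -/
def sphericalFun {n : ℕ} (s : Fin n → ℝ) (A : Herm n) : ℂ :=
  ∫ U : UGroup n, Complex.exp (Complex.I * Matrix.trace
    ((diagHerm s : Matrix (Fin n) (Fin n) ℂ) *
      (conjHerm U A : Matrix (Fin n) (Fin n) ℂ))) ∂(haarU n)

/-- The spherical transform `f̂(s) = ∫ f(A) φ_s(-A) dA`. -/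
def sphericalTransform {n : ℕ} (f : Herm n → ℝ) (s : Fin n → ℝ) : ℂ :=
  ∫ A : Herm n, (f A : ℂ) * sphericalFun s (-A) ∂(lebHerm n)

/-- The Vandermonde determinant `Δₙ(x) = ∏_{j<k} (x_k - x_j)`. -/
def vdm {n : ℕ} (x : Fin n → ℝ) : ℝ := ∏ j : Fin n, ∏ k ∈ Finset.Ioi j, (x k - x j)

/-- The determinant `det[exp(i s_j x_k)]`. -/
def expDet {n : ℕ} (s x : Fin n → ℝ) : ℂ :=
  Matrix.det (Matrix.of fun j k : Fin n => Complex.exp (Complex.I * (s j : ℂ) * (x k : ℂ)))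

/-- The constant `(π i)^{n(n-1)/2}`. -/
def piI (n : ℕ) : ℂ := ((Real.pi : ℂ) * Complex.I) ^ (n * (n - 1) / 2)

/-- The integrand `f(x) det[exp(-i s_j x_k)] Δₙ(x)` of the eigenvalue form of the spherical
transform (note `det[exp(-i s_j x_k)] = expDet (-s) x`). -/
def eigenIntegrand {n : ℕ} (f : Herm n → ℝ) (s x : Fin n → ℝ) : ℂ :=
  (f (diagHerm x) : ℂ) * expDet (-s) x * (vdm x : ℂ)

/-- The spherical transform of `f` is continuous on `ℝⁿ` and is given, at all `s` with distinct
entries, by the absolutely convergent integral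
`(π i)^{n(n-1)/2} / (n! Δₙ(s)) ∫ f(x) det[exp(-i s_j x_k)] Δₙ(x) dx`.
By continuity, it is the limit of this expression at the other points `s`. -/
def HasEigenvalueForm {n : ℕ} (f : Herm n → ℝ) : Prop :=
  Continuous (sphericalTransform f) ∧
  ∀ s : Fin n → ℝ, Function.Injective s →
    Integrable (eigenIntegrand f s) ∧
    sphericalTransform f s =
      piI n / ((n.factorial : ℂ) * (vdm s : ℂ)) * ∫ x : Fin n → ℝ, eigenIntegrand f s x

/-- The integrand `F(s) det[exp(i s_j x_k)] Δₙ(s)` of the inversion formula. -/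
def inversionIntegrand {n : ℕ} (F : (Fin n → ℝ) → ℂ) (x s : Fin n → ℝ) : ℂ :=
  F s * expDet s x * (vdm s : ℂ)

/-- The factor `(π i)^{-n(n-1)/2} / ((2π)ⁿ n! Δₙ(x))` of the inversion formula. -/
def inversionFactor {n : ℕ} (x : Fin n → ℝ) : ℂ :=
  (piI n)⁻¹ / ((2 * (Real.pi : ℂ)) ^ n * (n.factorial : ℂ) * (vdm x : ℂ))

/-- The inversion formula
`v = (π i)^{-n(n-1)/2} / ((2π)ⁿ n! Δₙ(x)) ∫ F(s) det[exp(i s_j x_k)] Δₙ(s) ds`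
holds at `x`. The integral over `ℝⁿ` is the usual Lebesgue integral if it converges absolutely;
in any case it is the limit as `ε ↓ 0` of the absolutely convergent integrals with the additional
factor `exp(-ε |s|²)`, as is usual in Fourier inversion. -/
def InversionHoldsAt {n : ℕ} (F : (Fin n → ℝ) → ℂ) (v : ℝ) (x : Fin n → ℝ) : Prop :=
  (Integrable (inversionIntegrand F x) →
    (v : ℂ) = inversionFactor x * ∫ s : Fin n → ℝ, inversionIntegrand F x s) ∧
  (∀ ε : ℝ, 0 < ε → Integrable fun s : Fin n → ℝ =>
    (Real.exp (-ε * ∑ j, s j ^ 2) : ℂ) * inversionIntegrand F x s) ∧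
  Tendsto (fun ε : ℝ => inversionFactor x * ∫ s : Fin n → ℝ,
    (Real.exp (-ε * ∑ j, s j ^ 2) : ℂ) * inversionIntegrand F x s) (𝓝[>] 0) (𝓝 (v : ℂ))

end

/-!
Conjugation invariance collapses the integral over the unitary group: for a unitarily invariant
density `f`, Fubini gives `sphericalTransform f s = ∫ f(A) exp(-i Tr(diag(s) A)) dA`, the ordinary
Fourier transform of `f` at a diagonal matrix (`sphericalTransform_eq_hermFourier`). Continuity is
then dominated convergence, and the multiplicativity of the transform is the independence of `X` and
`Y`. The density of `X + Y` is the convolution of the two densities.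

The eigenvalue form needs the joint behaviour of the eigenvalues and of the diagonal of a Hermitian
matrix, since `Tr(diag(s) A)` depends only on the diagonal of `A`. The theorem
`lintegral_invariant_mul_diag` integrates an invariant function times a function of the diagonal as
an integral over the Weyl chamber against `Δ(l)` and the Gelfand–Tsetlin kernel `gtKernel`. It is
proved by induction on `n`: a Hermitian matrix of size `n + 1` is a leading block, which by
invariance may be taken to be diagonal with entries `μ`, together with a last column and a corner
entry. The squared moduli of the column and the corner entry are traded for the eigenvalues `l`,
which range over the sequences interlaced by `μ`, with Jacobian `Δ(l) / Δ(μ)`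
(`lintegral_borderedHerm_diag`). The Fourier transform of the kernel is computed by the same
induction, the integral of a determinant over a box being the determinant of the integrals
(`integral_cexp_gtKernel`, the Harish-Chandra–Itzykson–Zuber formula). Together these give the
eigenvalue form for every invariant integrable function (`integral_invariant_mul_cexp`).

For the inversion formula, `Herm(n)` is a Euclidean space under the trace pairing, where the
Fourier inversion integral with the factor `exp(-ε ‖B‖²)` is a Gaussian mean of `f`. By the layer
cake formula a Gaussian is a mixture of balls, so the means converge at every Lebesgue point, in
particular at points of continuity and almost everywhere
(`IsLebesguePoint.tendsto_fourier_inversion`). The function `B ↦ hermFourier f B * exp(-ε Tr B²)`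
is itself invariant and integrable, so applying `integral_invariant_mul_cexp` to it turns the
inversion integral over `Herm(n)` into the one over the eigenvalues. Convergence is a unitarily
invariant property of the matrix, so it passes from almost every matrix to almost every diagonal
matrix (`ae_diagHerm`).
-/

/-! ### The flat measure on Hermitian matrices -/

instance UGroup.instSecondCountableTopology (n : ℕ) : SecondCountableTopology (UGroup n) :=
  haveI : SecondCountableTopology (Matrix (Fin n) (Fin n) ℂ) :=
    inferInstanceAs (SecondCountableTopology (Fin n → Fin n → ℂ))
  TopologicalSpace.Subtype.secondCountableTopology _

instance Herm.instSecondCountableTopology (n : ℕ) : SecondCountableTopology (Herm n) :=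
  haveI : SecondCountableTopology (Matrix (Fin n) (Fin n) ℂ) :=
    inferInstanceAs (SecondCountableTopology (Fin n → Fin n → ℂ))
  TopologicalSpace.Subtype.secondCountableTopology _

instance haarU.instIsProbabilityMeasure (n : ℕ) : IsProbabilityMeasure (haarU n) :=
  ⟨Measure.haarMeasure_self (K₀ := (⊤ : TopologicalSpace.PositiveCompacts (UGroup n)))⟩

/-- The real coordinates of a Hermitian matrix: its diagonal and its strictly upper entries. -/
abbrev HermCoords (n : ℕ) : Type := (Fin n → ℝ) × ({q : Fin n × Fin n // q.1 < q.2} → ℂ)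

instance HermCoords.instIsAddHaarMeasure (n : ℕ) :
    (volume : Measure (HermCoords n)).IsAddHaarMeasure :=
  Measure.prod.instIsAddHaarMeasure _ _

lemma hermOfCoords_diag {n : ℕ} (p : HermCoords n) (j : Fin n) :
    (hermOfCoords n p : Matrix (Fin n) (Fin n) ℂ) j j = p.1 j := by
  simp [hermOfCoords]

lemma hermOfCoords_upper {n : ℕ} (p : HermCoords n) {j k : Fin n} (h : j < k) :
    (hermOfCoords n p : Matrix (Fin n) (Fin n) ℂ) j k = p.2 ⟨(j, k), h⟩ := by
  simp [hermOfCoords, h]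

lemma Herm.star_apply {n : ℕ} (A : Herm n) (j k : Fin n) :
    star ((A : Matrix (Fin n) (Fin n) ℂ) j k) = (A : Matrix (Fin n) (Fin n) ℂ) k j := by
  have h : star (A : Matrix (Fin n) (Fin n) ℂ) = A := selfAdjoint.mem_iff.1 A.2
  rw [← Matrix.star_apply, h]

lemma Herm.continuous_apply {n : ℕ} (j k : Fin n) :
    Continuous fun A : Herm n => (A : Matrix (Fin n) (Fin n) ℂ) j k :=
  (continuous_subtype_val (p := (· ∈ selfAdjoint (Matrix (Fin n) (Fin n) ℂ)))).matrix_elem j k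

lemma Herm.diag_re {n : ℕ} (A : Herm n) (j : Fin n) :
    ((((A : Matrix (Fin n) (Fin n) ℂ) j j).re : ℝ) : ℂ) = (A : Matrix (Fin n) (Fin n) ℂ) j j :=
  Complex.conj_eq_iff_re.1 (Herm.star_apply A j j)

/-- Two Hermitian matrices agree if they agree on and above the diagonal. -/
lemma Herm.ext_upper {n : ℕ} {A B : Herm n}
    (h : ∀ j k : Fin n, j ≤ k →
      (A : Matrix (Fin n) (Fin n) ℂ) j k = (B : Matrix (Fin n) (Fin n) ℂ) j k) : A = B := by
  ext j k
  rcases le_total j k with hjk | hjk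
  · exact h j k hjk
  · rw [← Herm.star_apply A, ← Herm.star_apply B, h k j hjk]

/-- The coordinates of a Hermitian matrix as a linear homeomorphism. -/
noncomputable def hermEquiv (n : ℕ) : HermCoords n ≃L[ℝ] Herm n where
  toFun := hermOfCoords n
  invFun A := (fun j => ((A : Matrix (Fin n) (Fin n) ℂ) j j).re,
    fun q => (A : Matrix (Fin n) (Fin n) ℂ) q.1.1 q.1.2)
  map_add' p q := by
    refine Herm.ext_upper fun j k hjk => ?_
    rcases hjk.eq_or_lt with rfl | h
    · simp [hermOfCoords_diag]
    · simp [hermOfCoords_upper _ h]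
  map_smul' c p := by
    refine Herm.ext_upper fun j k hjk => ?_
    rcases hjk.eq_or_lt with rfl | h
    · simp [hermOfCoords_diag]
    · simp [hermOfCoords_upper _ h]
  left_inv p := by
    refine Prod.ext (funext fun j => ?_) (funext fun q => ?_)
    · simp [hermOfCoords_diag]
    · simp [hermOfCoords_upper _ q.2]
  right_inv A := by
    refine Herm.ext_upper fun j k hjk => ?_
    rcases hjk.eq_or_lt with rfl | h
    · simp [hermOfCoords_diag, Herm.diag_re]
    · simp [hermOfCoords_upper _ h]
  continuous_toFun := by
    refine Continuous.subtype_mk (continuous_matrix fun j k => ?_) _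
    simp only [Matrix.of_apply]
    split_ifs <;> fun_prop
  continuous_invFun := by
    refine Continuous.prodMk (continuous_pi fun j => ?_) (continuous_pi fun q => ?_)
    · exact Complex.continuous_re.comp (Herm.continuous_apply j j)
    · exact Herm.continuous_apply q.1.1 q.1.2

lemma lebHerm_eq_map (n : ℕ) : lebHerm n = Measure.map (hermEquiv n) volume := rfl

instance lebHerm.instIsAddHaarMeasure (n : ℕ) : (lebHerm n).IsAddHaarMeasure :=
  (hermEquiv n).isAddHaarMeasure_map volume

instance Herm.instMeasurableAdd₂ (n : ℕ) : MeasurableAdd₂ (Herm n) := ⟨continuous_add.measurable⟩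
instance Herm.instMeasurableNeg (n : ℕ) : MeasurableNeg (Herm n) := ⟨continuous_neg.measurable⟩

lemma measurePreserving_hermEquiv (n : ℕ) :
    MeasurePreserving (hermEquiv n) volume (lebHerm n) :=
  ⟨(hermEquiv n).continuous.measurable, rfl⟩

lemma measurableEmbedding_hermEquiv (n : ℕ) : MeasurableEmbedding (hermEquiv n) :=
  (hermEquiv n).toHomeomorph.measurableEmbedding

instance lebHerm.instSigmaFinite (n : ℕ) : SigmaFinite (lebHerm n) :=
  (measurableEmbedding_hermEquiv n).sigmaFinite_map

/-- A linear map that fixes a set of finite positive measure preserves Haar measure. -/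
lemma measurePreserving_of_preimage_eq {E : Type*} [NormedAddCommGroup E] [NormedSpace ℝ E]
    [MeasurableSpace E] [BorelSpace E] [FiniteDimensional ℝ E] (μ : Measure E)
    [μ.IsAddHaarMeasure] (f : E ≃ₗ[ℝ] E) (K : Set E) (h0 : μ K ≠ 0) (htop : μ K ≠ ⊤)
    (hK : f ⁻¹' K = K) : MeasurePreserving f μ μ := by
  have hdet : LinearMap.det (f : E →ₗ[ℝ] E) ≠ 0 := (LinearEquiv.isUnit_det' f).ne_zero
  refine ⟨(f.toContinuousLinearEquiv.continuous).measurable, ?_⟩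
  have h1 := Measure.addHaar_preimage_linearMap μ hdet K
  have h2 : ((f : E →ₗ[ℝ] E) : E → E) ⁻¹' K = K := hK
  rw [h2] at h1
  have h3 : ENNReal.ofReal |(LinearMap.det (f : E →ₗ[ℝ] E))⁻¹| = 1 := by
    have := (ENNReal.mul_eq_right h0 htop).1 h1.symm
    exact this
  have h4 := Measure.map_linearMap_addHaar_eq_smul_addHaar μ hdet
  rw [h3, one_smul] at h4
  exact h4

lemma trace_mul_self_eq {n : ℕ} (A : Herm n) :
    Matrix.trace ((A : Matrix (Fin n) (Fin n) ℂ) * (A : Matrix (Fin n) (Fin n) ℂ)) =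
      ((∑ j, ∑ k, ‖(A : Matrix (Fin n) (Fin n) ℂ) j k‖ ^ 2 : ℝ) : ℂ) := by
  rw [Matrix.trace]
  push_cast
  refine Finset.sum_congr rfl fun j _ => ?_
  rw [Matrix.diag_apply, Matrix.mul_apply]
  refine Finset.sum_congr rfl fun k _ => ?_
  rw [← Herm.star_apply A j k, ← Complex.mul_conj']; rfl

lemma conjHerm_coe {n : ℕ} (U : UGroup n) (A : Herm n) :
    (conjHerm U A : Matrix (Fin n) (Fin n) ℂ) =
      (U : Matrix (Fin n) (Fin n) ℂ) * (A : Matrix (Fin n) (Fin n) ℂ) *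
        star (U : Matrix (Fin n) (Fin n) ℂ) := rfl

lemma UGroup.star_mul_self {n : ℕ} (U : UGroup n) :
    star (U : Matrix (Fin n) (Fin n) ℂ) * (U : Matrix (Fin n) (Fin n) ℂ) = 1 :=
  Matrix.UnitaryGroup.star_mul_self U

lemma UGroup.mul_star_self {n : ℕ} (U : UGroup n) :
    (U : Matrix (Fin n) (Fin n) ℂ) * star (U : Matrix (Fin n) (Fin n) ℂ) = 1 :=
  Unitary.mul_star_self_of_mem U.2

lemma conjHerm_mul {n : ℕ} (U V : UGroup n) (A : Herm n) :
    conjHerm (U * V) A = conjHerm U (conjHerm V A) := by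
  apply Subtype.ext
  simp only [conjHerm_coe, Submonoid.coe_mul, StarMul.star_mul, mul_assoc]

lemma conjHerm_one {n : ℕ} (A : Herm n) : conjHerm 1 A = A := by
  apply Subtype.ext
  simp [conjHerm_coe]

lemma trace_conj_mul_conj {n : ℕ} (U : UGroup n) (A B : Herm n) :
    Matrix.trace ((conjHerm U A : Matrix (Fin n) (Fin n) ℂ) *
      (conjHerm U B : Matrix (Fin n) (Fin n) ℂ)) =
      Matrix.trace ((A : Matrix (Fin n) (Fin n) ℂ) * (B : Matrix (Fin n) (Fin n) ℂ)) := by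
  have h : (conjHerm U A : Matrix (Fin n) (Fin n) ℂ) * (conjHerm U B : Matrix (Fin n) (Fin n) ℂ) =
      (U : Matrix (Fin n) (Fin n) ℂ) * ((A : Matrix (Fin n) (Fin n) ℂ) *
        (B : Matrix (Fin n) (Fin n) ℂ) * star (U : Matrix (Fin n) (Fin n) ℂ)) := by
    rw [conjHerm_coe, conjHerm_coe]
    calc _ = (U : Matrix (Fin n) (Fin n) ℂ) * (A : Matrix (Fin n) (Fin n) ℂ) *
        (star (U : Matrix (Fin n) (Fin n) ℂ) * (U : Matrix (Fin n) (Fin n) ℂ)) *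
          (B : Matrix (Fin n) (Fin n) ℂ) *
          star (U : Matrix (Fin n) (Fin n) ℂ) := by simp only [mul_assoc]
      _ = _ := by rw [UGroup.star_mul_self]; simp only [mul_assoc, one_mul]
  rw [h, Matrix.trace_mul_comm, mul_assoc, UGroup.star_mul_self, mul_one]

lemma continuous_conjHerm_uncurry (n : ℕ) :
    Continuous fun p : UGroup n × Herm n => conjHerm p.1 p.2 := by
  have h1 : Continuous fun p : UGroup n × Herm n => (p.1 : Matrix (Fin n) (Fin n) ℂ) :=
    continuous_subtype_val.comp continuous_fst
  have h2 : Continuous fun p : UGroup n × Herm n => (p.2 : Matrix (Fin n) (Fin n) ℂ) :=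
    continuous_subtype_val.comp continuous_snd
  exact Continuous.subtype_mk ((h1.matrix_mul h2).matrix_mul h1.star) _

lemma continuous_conjHerm {n : ℕ} (U : UGroup n) : Continuous (conjHerm U) :=
  show Continuous fun A => conjHerm (U, A).1 (U, A).2 from
    Continuous.comp (g := fun p : UGroup n × Herm n => conjHerm p.1 p.2)
      (continuous_conjHerm_uncurry n) (Continuous.prodMk_right U)

/-- Conjugation by a unitary matrix as a linear automorphism of `Herm n`. -/
noncomputable def conjEquiv {n : ℕ} (U : UGroup n) : Herm n ≃ₗ[ℝ] Herm n where
  toFun := conjHerm U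
  invFun := conjHerm U⁻¹
  map_add' A B := by apply Subtype.ext; simp [conjHerm_coe, mul_add, add_mul]
  map_smul' c A := by apply Subtype.ext; simp [conjHerm_coe]
  left_inv A := by rw [← conjHerm_mul, inv_mul_cancel, conjHerm_one]
  right_inv A := by rw [← conjHerm_mul, mul_inv_cancel, conjHerm_one]

lemma measurePreserving_conjHerm {n : ℕ} (U : UGroup n) :
    MeasurePreserving (conjHerm U) (lebHerm n) (lebHerm n) := by
  -- In coordinates, conjugation fixes the unit ball of the Hilbert–Schmidt norm.
  set q : Herm n → ℝ := fun A => ∑ j, ∑ k, ‖(A : Matrix (Fin n) (Fin n) ℂ) j k‖ ^ 2 with hq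
  have hqc : Continuous q := continuous_finsetSum _ fun j _ => continuous_finsetSum _ fun k _ =>
    (Herm.continuous_apply j k).norm.pow 2
  have hqU : ∀ A, q (conjHerm U A) = q A := fun A => by
    have h := trace_conj_mul_conj U A A
    rw [trace_mul_self_eq, trace_mul_self_eq] at h
    exact_mod_cast h
  set e := hermEquiv n
  set f : HermCoords n ≃ₗ[ℝ] HermCoords n :=
    (e.toLinearEquiv.trans (conjEquiv U)).trans e.symm.toLinearEquiv with hf
  have hef : ∀ p, e (f p) = conjHerm U (e p) := fun p => by
    simp only [hf, LinearEquiv.trans_apply]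
    exact e.apply_symm_apply _
  have hsub : {p | q (e p) ≤ 1} ⊆ Metric.closedBall (0 : HermCoords n) 1 := by
    intro p hp
    have hent : ∀ j k, ‖(e p : Matrix (Fin n) (Fin n) ℂ) j k‖ ≤ 1 := fun j k => by
      have h1 : ‖(e p : Matrix (Fin n) (Fin n) ℂ) j k‖ ^ 2 ≤ q (e p) :=
        (Finset.single_le_sum (f := fun k => ‖(e p : Matrix (Fin n) (Fin n) ℂ) j k‖ ^ 2)
          (fun _ _ => by positivity) (Finset.mem_univ k)).trans
        (Finset.single_le_sum (f := fun j => ∑ k, ‖(e p : Matrix (Fin n) (Fin n) ℂ) j k‖ ^ 2)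
          (fun _ _ => by positivity) (Finset.mem_univ j))
      have h2 : q (e p) ≤ 1 := hp
      exact (sq_le_one_iff₀ (norm_nonneg _)).1 (h1.trans h2)
    rw [mem_closedBall_zero_iff, Prod.norm_def, max_le_iff,
      pi_norm_le_iff_of_nonneg zero_le_one, pi_norm_le_iff_of_nonneg zero_le_one]
    refine ⟨fun j => ?_, fun r => ?_⟩
    · have := hent j j
      rw [show e p = hermOfCoords n p from rfl, hermOfCoords_diag] at this
      simpa using this
    · have := hent r.1.1 r.1.2
      rwa [show e p = hermOfCoords n p from rfl, hermOfCoords_upper _ r.2] at this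
  have hpos : (volume {p | q (e p) ≤ 1} : ENNReal) ≠ 0 := by
    have hopen : IsOpen {p | q (e p) < 1} :=
      isOpen_lt (hqc.comp e.continuous) continuous_const
    have hne : ({p | q (e p) < 1}).Nonempty := ⟨0, by simp [hq]⟩
    have h1 := hopen.measure_pos volume hne
    exact (h1.trans_le (measure_mono fun p (hp : q (e p) < 1) => hp.le)).ne'
  have hfin : (volume {p | q (e p) ≤ 1} : ENNReal) ≠ ⊤ :=
    ((measure_mono hsub).trans_lt measure_closedBall_lt_top).ne
  have hmp := measurePreserving_of_preimage_eq (volume : Measure (HermCoords n)) f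
    {p | q (e p) ≤ 1} hpos hfin (by
      ext p
      simp only [Set.mem_preimage, Set.mem_ofPred_eq, hef, hqU])
  refine ⟨(continuous_conjHerm U).measurable, ?_⟩
  rw [lebHerm_eq_map, Measure.map_map (continuous_conjHerm U).measurable e.continuous.measurable]
  have : conjHerm U ∘ e = e ∘ f := funext fun p => (hef p).symm
  rw [this, ← Measure.map_map e.continuous.measurable hmp.measurable, hmp.map_eq]

/-- A unitary matrix preserves Lebesgue measure on `ℂⁿ`. -/
lemma measurePreserving_unitary_mulVec {n : ℕ} (U : UGroup n) :
    MeasurePreserving (fun z : Fin n → ℂ => (U : Matrix (Fin n) (Fin n) ℂ).mulVec z) := by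
  set q : (Fin n → ℂ) → ℝ := fun z => ∑ j, ‖z j‖ ^ 2 with hq
  have hqc : Continuous q := by rw [hq]; fun_prop
  have hq' : ∀ z, ((q z : ℝ) : ℂ) = star z ⬝ᵥ z := fun z => by
    simp only [hq, dotProduct, Pi.star_apply]
    push_cast
    refine Finset.sum_congr rfl fun j _ => ?_
    rw [← Complex.conj_mul']; rfl
  have hqU : ∀ z, q ((U : Matrix (Fin n) (Fin n) ℂ).mulVec z) = q z := fun z => by
    have : ((q ((U : Matrix (Fin n) (Fin n) ℂ).mulVec z) : ℝ) : ℂ) = q z := by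
      rw [hq', hq', Matrix.star_mulVec, ← Matrix.dotProduct_mulVec, Matrix.mulVec_mulVec,
        ← Matrix.star_eq_conjTranspose, UGroup.star_mul_self, Matrix.one_mulVec]
    exact_mod_cast this
  let f : (Fin n → ℂ) ≃ₗ[ℝ] (Fin n → ℂ) :=
    { toFun := fun z => (U : Matrix (Fin n) (Fin n) ℂ).mulVec z
      invFun := fun z => (star (U : Matrix (Fin n) (Fin n) ℂ)).mulVec z
      map_add' := fun z w => Matrix.mulVec_add _ _ _
      map_smul' := fun c z => Matrix.mulVec_smul _ _ _
      left_inv := fun z => by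
        simp only [Matrix.mulVec_mulVec, UGroup.star_mul_self, Matrix.one_mulVec]
      right_inv := fun z => by
        simp only [Matrix.mulVec_mulVec, UGroup.mul_star_self, Matrix.one_mulVec] }
  have hsub : {z | q z ≤ 1} ⊆ Metric.closedBall (0 : Fin n → ℂ) 1 := by
    intro z hz
    rw [mem_closedBall_zero_iff, pi_norm_le_iff_of_nonneg zero_le_one]
    intro j
    have h1 : ‖z j‖ ^ 2 ≤ q z := Finset.single_le_sum (f := fun j => ‖z j‖ ^ 2)
      (fun _ _ => by positivity) (Finset.mem_univ j)
    exact (sq_le_one_iff₀ (norm_nonneg _)).1 (h1.trans hz)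
  refine measurePreserving_of_preimage_eq volume f {z | q z ≤ 1} ?_
    ((measure_mono hsub).trans_lt measure_closedBall_lt_top).ne ?_
  · have h1 := (isOpen_lt hqc continuous_const).measure_pos volume
      (⟨0, by simp [hq]⟩ : ({z | q z < 1}).Nonempty)
    exact (h1.trans_le (measure_mono fun p (hp : q p < 1) => hp.le)).ne'
  · ext z
    exact iff_of_eq (congrArg (· ≤ 1) (hqU z))

/-! ### Bordered Hermitian matrices -/

/-- The Hermitian matrix with leading principal block `B`, last column `(z, a)` and last row
`(z*, a)`. -/
noncomputable def borderedHerm {n : ℕ} (B : Herm n) (z : Fin n → ℂ) (a : ℝ) : Herm (n + 1) :=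
  ⟨Matrix.of (Fin.snoc (fun i => Fin.snoc ((B : Matrix (Fin n) (Fin n) ℂ) i) (z i))
      (Fin.snoc (fun j => star (z j)) (a : ℂ)) : Fin (n + 1) → Fin (n + 1) → ℂ), by
    rw [selfAdjoint.mem_iff]
    ext i j
    rw [Matrix.star_apply]
    refine Fin.lastCases ?_ (fun i => ?_) i <;> refine Fin.lastCases ?_ (fun j => ?_) j <;>
      simp [Herm.star_apply, -Complex.star_def]⟩

section
variable {n : ℕ} (B : Herm n) (z : Fin n → ℂ) (a : ℝ)

@[simp] lemma borderedHerm_castSucc_castSucc (i j : Fin n) :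
    (borderedHerm B z a : Matrix (Fin (n + 1)) (Fin (n + 1)) ℂ) i.castSucc j.castSucc =
      (B : Matrix (Fin n) (Fin n) ℂ) i j := by simp [borderedHerm]

@[simp] lemma borderedHerm_castSucc_last (i : Fin n) :
    (borderedHerm B z a : Matrix (Fin (n + 1)) (Fin (n + 1)) ℂ) i.castSucc (Fin.last n) =
      z i := by simp [borderedHerm]

@[simp] lemma borderedHerm_last_castSucc (j : Fin n) :
    (borderedHerm B z a : Matrix (Fin (n + 1)) (Fin (n + 1)) ℂ) (Fin.last n) j.castSucc =
      star (z j) := by simp [borderedHerm]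

@[simp] lemma borderedHerm_last_last :
    (borderedHerm B z a : Matrix (Fin (n + 1)) (Fin (n + 1)) ℂ) (Fin.last n) (Fin.last n) =
      a := by simp [borderedHerm]

end

/-- The block diagonal unitary matrix with blocks `U` and `1`. -/
noncomputable def extendUnitary {n : ℕ} (U : UGroup n) : UGroup (n + 1) :=
  ⟨Matrix.of (Fin.snoc (fun i => Fin.snoc ((U : Matrix (Fin n) (Fin n) ℂ) i) 0)
      (Fin.snoc (fun _ => 0) 1) : Fin (n + 1) → Fin (n + 1) → ℂ), by
    rw [Matrix.mem_unitaryGroup_iff]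
    have hU : ∀ i j, ∑ k, (U : Matrix (Fin n) (Fin n) ℂ) i k *
        star ((U : Matrix (Fin n) (Fin n) ℂ) j k) = (1 : Matrix (Fin n) (Fin n) ℂ) i j := by
      intro i j
      rw [← UGroup.mul_star_self U, Matrix.mul_apply]
      rfl
    ext i j
    rw [Matrix.mul_apply]
    simp only [Matrix.star_apply, Fin.sum_univ_castSucc]
    refine Fin.lastCases ?_ (fun i => ?_) i <;> refine Fin.lastCases ?_ (fun j => ?_) j
    · simp
    · simp [Fin.ext_iff, (Fin.is_lt _).ne']
    · simp [Fin.ext_iff, (Fin.is_lt _).ne]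
    · simpa [Matrix.one_apply] using hU i j⟩

lemma conjHerm_extendUnitary {n : ℕ} (U : UGroup n) (B : Herm n) (z : Fin n → ℂ) (a : ℝ) :
    conjHerm (extendUnitary U) (borderedHerm B z a) =
      borderedHerm (conjHerm U B) ((U : Matrix (Fin n) (Fin n) ℂ).mulVec z) a := by
  refine Herm.ext_upper fun i j hij => ?_
  rw [conjHerm_coe, Matrix.mul_apply]
  simp only [Matrix.mul_apply, Matrix.star_apply, Fin.sum_univ_castSucc]
  revert hij
  refine Fin.lastCases ?_ (fun i => ?_) i <;> refine Fin.lastCases ?_ (fun j => ?_) j <;> intro hij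
  · simp [extendUnitary]
  · exact absurd hij (by simp [Fin.le_def])
  · simp [extendUnitary, Matrix.mulVec, dotProduct]
  · simp [extendUnitary, conjHerm_coe, Matrix.mul_apply]

lemma continuous_borderedHerm (n : ℕ) :
    Continuous fun p : Herm n × (Fin n → ℂ) × ℝ => borderedHerm p.1 p.2.1 p.2.2 := by
  refine Continuous.subtype_mk (continuous_matrix fun i j => ?_) _
  refine Fin.lastCases ?_ (fun i => ?_) i <;> refine Fin.lastCases ?_ (fun j => ?_) j
  · simp; fun_prop
  · simp; fun_prop
  · simp; fun_prop
  · simp only [Matrix.of_apply, Fin.snoc_castSucc]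
    exact (Herm.continuous_apply i j).comp continuous_fst

/-- The index pairs above the diagonal of an `(n+1) × (n+1)` matrix: those in the last column and
those of the leading block. -/
noncomputable def upperPairsSucc (n : ℕ) : Fin n ⊕ {q : Fin n × Fin n // q.1 < q.2} ≃
    {q : Fin (n + 1) × Fin (n + 1) // q.1 < q.2} :=
  Equiv.ofBijective
    (Sum.elim (fun i => ⟨(i.castSucc, Fin.last n), Fin.castSucc_lt_last i⟩)
      (fun q => ⟨(q.1.1.castSucc, q.1.2.castSucc), by simpa using q.2⟩)) (by
    constructor
    · rintro (i | ⟨⟨i, j⟩, h⟩) (k | ⟨⟨k, l⟩, h'⟩) <;>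
        simp [Fin.ext_iff] <;> omega
    · rintro ⟨⟨i, j⟩, h⟩
      revert h
      refine Fin.lastCases ?_ (fun i => ?_) i <;>
        refine Fin.lastCases ?_ (fun j => ?_) j <;> intro h
      · exact absurd h (lt_irrefl _)
      · exact absurd h (by simp [Fin.lt_def, j.is_lt.le])
      · exact ⟨Sum.inl i, rfl⟩
      · exact ⟨Sum.inr ⟨(i, j), by simpa using h⟩, rfl⟩)

lemma hermEquiv_succ_eq_borderedHerm {n : ℕ} (a : ℝ) (d : Fin n → ℝ) (z : Fin n → ℂ)
    (o : {q : Fin n × Fin n // q.1 < q.2} → ℂ) :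
    hermEquiv (n + 1)
      ((MeasurableEquiv.piFinSuccAbove (fun _ : Fin (n + 1) => ℝ) (Fin.last n)).symm (a, d),
        (MeasurableEquiv.piCongrLeft (fun _ => ℂ) (upperPairsSucc n))
          ((MeasurableEquiv.sumPiEquivProdPi
            (fun _ : Fin n ⊕ {q : Fin n × Fin n // q.1 < q.2} => ℂ)).symm (z, o))) =
      borderedHerm (hermEquiv n (d, o)) z a := by
  refine Herm.ext_upper fun i j hij => ?_
  have hpair : ∀ s, (MeasurableEquiv.piCongrLeft (fun _ => ℂ) (upperPairsSucc n))
          ((MeasurableEquiv.sumPiEquivProdPi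
            (fun _ : Fin n ⊕ {q : Fin n × Fin n // q.1 < q.2} => ℂ)).symm (z, o))
            (upperPairsSucc n s) = Sum.elim z o s := by
    intro s
    rw [MeasurableEquiv.piCongrLeft_apply_apply]
    rcases s with s | s <;> rfl
  have hdiag : (MeasurableEquiv.piFinSuccAbove (fun _ : Fin (n + 1) => ℝ) (Fin.last n)).symm
      (a, d) = Fin.snoc d a := by
    exact Fin.insertNth_last' a d
  change (hermOfCoords (n + 1) _ : Matrix _ _ ℂ) i j = _
  rcases hij.eq_or_lt with rfl | h
  · rw [hermOfCoords_diag, hdiag]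
    refine Fin.lastCases ?_ (fun i => ?_) i
    · simp
    · simp only [Fin.snoc_castSucc, borderedHerm_castSucc_castSucc]
      exact (hermOfCoords_diag (d, o) i).symm
  · rw [hermOfCoords_upper _ h]
    revert h hij
    refine Fin.lastCases ?_ (fun i => ?_) i <;> refine Fin.lastCases ?_ (fun j => ?_) j <;>
      intro hij h
    · exact absurd h (lt_irrefl _)
    · exact absurd h (by simp [Fin.lt_def, j.is_lt.le])
    · rw [borderedHerm_castSucc_last]
      exact hpair (Sum.inl i)
    · rw [borderedHerm_castSucc_castSucc]
      have hlt : i < j := by simpa using h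
      refine (hpair (Sum.inr ⟨(i, j), hlt⟩)).trans ?_
      exact (hermOfCoords_upper (d, o) hlt).symm

/-- Integration over `Herm (n+1)` in terms of the leading block and the last column. -/
lemma lintegral_lebHerm_succ {n : ℕ} (F : Herm (n + 1) → ENNReal) (hF : Measurable F) :
    ∫⁻ A, F A ∂(lebHerm (n + 1)) =
      ∫⁻ a : ℝ, ∫⁻ B, (∫⁻ z : Fin n → ℂ, F (borderedHerm B z a)) ∂(lebHerm n) := by
  have h1 := (volume_preserving_piFinSuccAbove (fun _ : Fin (n + 1) => ℝ) (Fin.last n)).symm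
  have h2 := (volume_measurePreserving_sumPiEquivProdPi
    (fun _ : Fin n ⊕ {q : Fin n × Fin n // q.1 < q.2} => ℂ)).symm
  have h3 := volume_measurePreserving_piCongrLeft
    (fun _ : {q : Fin (n + 1) × Fin (n + 1) // q.1 < q.2} => ℂ) (upperPairsSucc n)
  have h4 := h1.prod (h3.comp h2)
  have hme : Measurable (hermEquiv (n + 1)) := (hermEquiv (n + 1)).continuous.measurable
  rw [← (measurePreserving_hermEquiv (n + 1)).lintegral_comp hF]
  change ∫⁻ p, F (hermEquiv (n + 1) p) ∂(Measure.prod volume volume) = _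
  refine (h4.lintegral_comp (hF.comp hme)).symm.trans ?_
  have hG : Measurable fun x : (ℝ × (Fin n → ℝ)) ×
      ((Fin n → ℂ) × ({q : Fin n × Fin n // q.1 < q.2} → ℂ)) =>
        F (borderedHerm (hermEquiv n (x.1.2, x.2.2)) x.2.1 x.1.1) := by
    refine hF.comp (Continuous.measurable ?_)
    refine (continuous_borderedHerm n).comp
      (f := fun x : (ℝ × (Fin n → ℝ)) ×
        ((Fin n → ℂ) × ({q : Fin n × Fin n // q.1 < q.2} → ℂ)) =>
          (hermEquiv n (x.1.2, x.2.2), x.2.1, x.1.1)) (Continuous.prodMk ?_ ?_)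
    · exact (hermEquiv n).continuous.comp
        ((continuous_snd.comp continuous_fst).prodMk (continuous_snd.comp continuous_snd))
    · exact (continuous_fst.comp continuous_snd).prodMk (continuous_fst.comp continuous_fst)
  have hL : ∀ x : (ℝ × (Fin n → ℝ)) × ((Fin n → ℂ) × ({q : Fin n × Fin n // q.1 < q.2} → ℂ)),
      F (hermEquiv (n + 1) (Prod.map
        (MeasurableEquiv.piFinSuccAbove (fun _ : Fin (n + 1) => ℝ) (Fin.last n)).symm
        ((MeasurableEquiv.piCongrLeft (fun _ => ℂ) (upperPairsSucc n)) ∘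
            (MeasurableEquiv.sumPiEquivProdPi
              (fun _ : Fin n ⊕ {q : Fin n × Fin n // q.1 < q.2} => ℂ)).symm) x)) =
        F (borderedHerm (hermEquiv n (x.1.2, x.2.2)) x.2.1 x.1.1) := fun x =>
    congrArg F (hermEquiv_succ_eq_borderedHerm x.1.1 x.1.2 x.2.1 x.2.2)
  refine (lintegral_congr hL).trans ?_
  rw [lintegral_prod _ hG.aemeasurable]
  change ∫⁻ y, _ ∂(Measure.prod volume volume) = _
  rw [lintegral_prod _ (Measurable.lintegral_prod_right' hG).aemeasurable]
  refine lintegral_congr fun a => ?_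
  have hH : Measurable fun p : Herm n × (Fin n → ℂ) => F (borderedHerm p.1 p.2 a) := by
    refine hF.comp (Continuous.measurable ?_)
    exact (continuous_borderedHerm n).comp (f := fun p : Herm n × (Fin n → ℂ) => (p.1, p.2, a))
      (by fun_prop)
  rw [← (measurePreserving_hermEquiv n).lintegral_comp (Measurable.lintegral_prod_right' hH)]
  change _ = ∫⁻ p, _ ∂(Measure.prod volume volume)
  refine Eq.trans ?_ (lintegral_prod _ ((Measurable.lintegral_prod_right' hH).comp
    (hermEquiv n).continuous.measurable).aemeasurable).symm
  refine lintegral_congr fun d => ?_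
  change ∫⁻ y, _ ∂(Measure.prod volume volume) = _
  have hGd : Measurable fun y : (Fin n → ℂ) × ({q : Fin n × Fin n // q.1 < q.2} → ℂ) =>
      F (borderedHerm (hermEquiv n (d, y.2)) y.1 a) := by
    refine hF.comp (Continuous.measurable ?_)
    refine (continuous_borderedHerm n).comp
      (f := fun y : (Fin n → ℂ) × ({q : Fin n × Fin n // q.1 < q.2} → ℂ) =>
          (hermEquiv n (d, y.2), y.1, a)) (Continuous.prodMk ?_ ?_)
    · exact (hermEquiv n).continuous.comp (continuous_const.prodMk continuous_snd)
    · exact continuous_fst.prodMk continuous_const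
  exact lintegral_prod_symm _ hGd.aemeasurable

/-! ### Interlacing sequences and the spectral data of bordered matrices -/

/-- `μ` interlaces `l`: `l₀ < μ₀ < l₁ < μ₁ < … < μₙ₋₁ < lₙ`. -/
def Interlaces {n : ℕ} (μ : Fin n → ℝ) (l : Fin (n + 1) → ℝ) : Prop :=
  ∀ k : Fin n, l k.castSucc < μ k ∧ μ k < l k.succ

lemma Interlaces.strictMono {n : ℕ} {μ : Fin n → ℝ} {l : Fin (n + 1) → ℝ}
    (h : Interlaces μ l) : StrictMono l :=
  Fin.strictMono_iff_lt_succ.2 fun k => (h k).1.trans (h k).2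

lemma Interlaces.strictMono_left {n : ℕ} {μ : Fin n → ℝ} {l : Fin (n + 1) → ℝ}
    (h : Interlaces μ l) : StrictMono μ := by
  cases n with
  | zero => exact fun i => i.elim0
  | succ n => exact Fin.strictMono_iff_lt_succ.2 fun k =>
      (h k.castSucc).2.trans_eq (by rw [Fin.succ_castSucc]) |>.trans (h k.succ).1

lemma Interlaces.lt_of_le {n : ℕ} {μ : Fin n → ℝ} {l : Fin (n + 1) → ℝ}
    (h : Interlaces μ l) {i : Fin (n + 1)} {j : Fin n} (hij : i ≤ j.castSucc) : l i < μ j :=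
  (h.strictMono.monotone hij).trans_lt (h j).1

lemma Interlaces.lt_of_lt {n : ℕ} {μ : Fin n → ℝ} {l : Fin (n + 1) → ℝ}
    (h : Interlaces μ l) {i : Fin (n + 1)} {j : Fin n} (hij : j.castSucc < i) : μ j < l i :=
  (h j).2.trans_le (h.strictMono.monotone (Fin.castSucc_lt_iff_succ_le.1 hij))

section Weights
variable {n : ℕ} (μ : Fin n → ℝ)

/-- For `l` interlaced by `μ`, the squared moduli of the last column of a matrix with leading block
`diag μ` and eigenvalues `l`: minus the residues at `μ j` of `∏ (t - l k) / ∏ (t - μ j)`. -/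
noncomputable def borderWeight (l : Fin (n + 1) → ℝ) (j : Fin n) : ℝ :=
  -(∏ k, (μ j - l k)) / ∏ k ∈ Finset.univ.erase j, (μ j - μ k)

/-- The characteristic polynomial of the matrix with leading block `diag μ`, corner entry `a`, and
last column with squared moduli `w`. -/
noncomputable def borderPoly (w : Fin n → ℝ) (a : ℝ) : Polynomial ℝ :=
  (Polynomial.X - Polynomial.C a) * Lagrange.nodal Finset.univ μ -
    ∑ j, Polynomial.C (w j) * Lagrange.nodal (Finset.univ.erase j) μ

variable {μ}

lemma prod_erase_sub_ne_zero {m : ℕ} {x : Fin m → ℝ} (hx : Function.Injective x) (j : Fin m) :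
    ∏ k ∈ Finset.univ.erase j, (x j - x k) ≠ 0 :=
  Finset.prod_ne_zero_iff.2 fun _ hk =>
    sub_ne_zero.2 fun h => (Finset.ne_of_mem_erase hk) (hx h).symm

lemma eval_borderPoly_node (w : Fin n → ℝ) (a : ℝ) (j : Fin n) :
    (borderPoly μ w a).eval (μ j) = -(w j * ∏ k ∈ Finset.univ.erase j, (μ j - μ k)) := by
  rw [borderPoly, Polynomial.eval_sub, Polynomial.eval_mul,
    Lagrange.eval_nodal_at_node (Finset.mem_univ j), mul_zero, zero_sub, Polynomial.eval_finsetSum,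
    Finset.sum_eq_single j]
  · rw [Polynomial.eval_mul, Polynomial.eval_C, Lagrange.eval_nodal]
  · intro k _ hk
    rw [Polynomial.eval_mul,
      Lagrange.eval_nodal_at_node (Finset.mem_erase.2 ⟨hk.symm, Finset.mem_univ j⟩),
      mul_zero]
  · simp

lemma degree_border_sum_lt (w : Fin n → ℝ) :
    (∑ j, Polynomial.C (w j) * Lagrange.nodal (Finset.univ.erase j) μ).degree <
      (n : WithBot ℕ) := by
  refine (Polynomial.degree_sum_le _ _).trans_lt ?_
  refine (Finset.sup_lt_iff (WithBot.bot_lt_coe n)).2 fun j _ => ?_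
  rw [← Polynomial.smul_eq_C_mul]
  refine (Polynomial.degree_smul_le _ _).trans_lt ?_
  rw [Lagrange.degree_nodal]
  have : (Finset.univ.erase j).card < n := by
    rw [Finset.card_erase_of_mem (Finset.mem_univ j), Finset.card_univ, Fintype.card_fin]
    have := j.pos
    omega
  exact WithBot.coe_lt_coe.2 this

lemma nodal_sub_degree_lt (l : Fin (n + 1) → ℝ) :
    (Lagrange.nodal Finset.univ l - (Polynomial.X - Polynomial.C (∑ k, l k - ∑ j, μ j)) *
      Lagrange.nodal Finset.univ μ).degree < (n : WithBot ℕ) := by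
  set a := ∑ k, l k - ∑ j, μ j with ha
  have h1 : Lagrange.nodal Finset.univ l = ∏ k, (Polynomial.X - Polynomial.C (l k)) := rfl
  have h2 : (Polynomial.X - Polynomial.C a) * Lagrange.nodal Finset.univ μ =
      ∏ k, (Polynomial.X - Polynomial.C ((Fin.snoc μ a : Fin (n + 1) → ℝ) k)) := by
    rw [Fin.prod_univ_castSucc, mul_comm]
    simp [Lagrange.nodal]
  rw [h2, h1, Polynomial.degree_lt_iff_coeff_zero]
  intro m hm
  have hcard : (Finset.univ : Finset (Fin (n + 1))).card = n + 1 := by simp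
  rw [Polynomial.coeff_sub]
  rcases hm.eq_or_lt with rfl | hm
  · have e1 := Polynomial.prod_X_sub_C_coeff_card_pred Finset.univ l (by simp)
    have e2 := Polynomial.prod_X_sub_C_coeff_card_pred Finset.univ
      (Fin.snoc μ a : Fin (n + 1) → ℝ) (by simp)
    rw [hcard, Nat.add_sub_cancel] at e1 e2
    rw [e1, e2, Fin.sum_univ_castSucc (fun i => (Fin.snoc μ a : Fin (n + 1) → ℝ) i)]
    simp [ha]
  · rcases (Nat.succ_le_of_lt hm).eq_or_lt with rfl | hm
    · have e : ∀ x : Fin (n + 1) → ℝ,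
          (∏ k, (Polynomial.X - Polynomial.C (x k))).coeff (n + 1) = 1 := fun x => by
        have h := (Lagrange.nodal_monic (s := Finset.univ) (v := x)).coeff_natDegree
        rwa [Lagrange.natDegree_nodal, hcard] at h
      change Polynomial.coeff _ (n + 1) - Polynomial.coeff _ (n + 1) = 0
      rw [e, e, sub_self]
    · have e : ∀ x : Fin (n + 1) → ℝ,
          (∏ k, (Polynomial.X - Polynomial.C (x k))).coeff m = 0 := fun x => by
        apply Polynomial.coeff_eq_zero_of_natDegree_lt
        have h := (Lagrange.natDegree_nodal (s := Finset.univ) (v := x))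
        rw [hcard] at h
        exact h.trans_lt hm
      rw [e, e, sub_self]

lemma nodal_eq_borderPoly (hμ : Function.Injective μ) (l : Fin (n + 1) → ℝ) :
    Lagrange.nodal Finset.univ l =
      borderPoly μ (borderWeight μ l) (∑ k, l k - ∑ j, μ j) := by
  refine Polynomial.eq_of_degree_sub_lt_of_eval_index_eq (v := μ) Finset.univ hμ.injOn ?_ ?_
  · rw [borderPoly, ← sub_add, Finset.card_univ, Fintype.card_fin]
    exact (Polynomial.degree_add_le _ _).trans_lt
      (max_lt (nodal_sub_degree_lt l) (degree_border_sum_lt _))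
  · intro j _
    rw [eval_borderPoly_node, Lagrange.eval_nodal, borderWeight,
      div_mul_cancel₀ _ (prod_erase_sub_ne_zero hμ j), neg_neg]

lemma borderPoly_eq_nodal (w : Fin n → ℝ) (a : ℝ) {l : Fin (n + 1) → ℝ}
    (hl : Function.Injective l) (hroot : ∀ k, (borderPoly μ w a).eval (l k) = 0) :
    borderPoly μ w a = Lagrange.nodal Finset.univ l := by
  refine Polynomial.eq_of_degree_sub_lt_of_eval_index_eq (v := l) Finset.univ hl.injOn ?_ ?_
  · rw [Finset.card_univ, Fintype.card_fin]
    set a' := ∑ k, l k - ∑ j, μ j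
    have h : borderPoly μ w a - Lagrange.nodal Finset.univ l =
        Polynomial.C (a' - a) * Lagrange.nodal Finset.univ μ -
        (∑ j, Polynomial.C (w j) * Lagrange.nodal (Finset.univ.erase j) μ) -
        (Lagrange.nodal Finset.univ l - (Polynomial.X - Polynomial.C a') *
          Lagrange.nodal Finset.univ μ) := by
      rw [borderPoly, Polynomial.C_sub]
      ring
    have hlt : (n : WithBot ℕ) < ((n + 1 : ℕ) : WithBot ℕ) := by exact_mod_cast n.lt_succ_self
    rw [h]
    refine (Polynomial.degree_sub_le _ _).trans_lt (max_lt ?_ ((nodal_sub_degree_lt l).trans hlt))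
    refine (Polynomial.degree_sub_le _ _).trans_lt (max_lt ?_ ((degree_border_sum_lt w).trans hlt))
    rw [← Polynomial.smul_eq_C_mul]
    refine (Polynomial.degree_smul_le _ _).trans_lt ?_
    rw [Lagrange.degree_nodal, Finset.card_univ, Fintype.card_fin]
    exact hlt
  · intro k hk
    rw [hroot, Lagrange.eval_nodal_at_node hk]

lemma borderWeight_eq_of_roots (hμ : Function.Injective μ) (w : Fin n → ℝ) (a : ℝ)
    {l : Fin (n + 1) → ℝ} (hl : Function.Injective l)
    (hroot : ∀ k, (borderPoly μ w a).eval (l k) = 0) :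
    borderWeight μ l = w ∧ ∑ k, l k - ∑ j, μ j = a := by
  have h1 := (borderPoly_eq_nodal w a hl hroot).symm
  have hw : borderWeight μ l = w := by
    funext j
    have h2 := congrArg (Polynomial.eval (μ j)) h1
    rw [eval_borderPoly_node, Lagrange.eval_nodal] at h2
    rw [borderWeight, h2, neg_neg, mul_div_cancel_right₀ _ (prod_erase_sub_ne_zero hμ j)]
  refine ⟨hw, ?_⟩
  rw [nodal_eq_borderPoly hμ l, hw, borderPoly, borderPoly] at h1
  have h3 := mul_right_cancel₀ Lagrange.nodal_ne_zero (sub_left_inj.1 h1)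
  exact Polynomial.C_injective (sub_right_inj.1 h3)

lemma eval_borderPoly (w : Fin n → ℝ) (a t : ℝ) (ht : ∀ j, t ≠ μ j) :
    (borderPoly μ w a).eval t =
      (t - a - ∑ j, w j / (t - μ j)) * ∏ j, (t - μ j) := by
  rw [borderPoly, Polynomial.eval_sub, Polynomial.eval_mul, Polynomial.eval_finsetSum, sub_mul,
    Finset.sum_mul, Lagrange.eval_nodal]
  simp only [Polynomial.eval_sub, Polynomial.eval_X, Polynomial.eval_C, Polynomial.eval_mul,
    Lagrange.eval_nodal]
  congr 1
  refine Finset.sum_congr rfl fun j _ => ?_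
  rw [← Finset.mul_prod_erase Finset.univ _ (Finset.mem_univ j), div_mul_eq_mul_div, mul_div_assoc,
    mul_div_cancel_left₀ _ (sub_ne_zero.2 (ht j))]

/-- The eigenvalue equation of a bordered matrix. -/
lemma Interlaces.secular_eq {l : Fin (n + 1) → ℝ} (h : Interlaces μ l) (k : Fin (n + 1)) :
    l k = (∑ i, l i - ∑ j, μ j) + ∑ j, borderWeight μ l j / (l k - μ j) := by
  have hne : ∀ j, l k ≠ μ j := fun j => by
    rcases le_or_gt k j.castSucc with hk | hk
    · exact (h.lt_of_le hk).ne
    · exact (h.lt_of_lt hk).ne'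
  have h1 := Lagrange.eval_nodal_at_node (v := l) (Finset.mem_univ k)
  rw [nodal_eq_borderPoly h.strictMono_left.injective, eval_borderPoly _ _ _ hne] at h1
  have h2 := (mul_eq_zero.1 h1).resolve_right
    (Finset.prod_ne_zero_iff.2 fun j _ => sub_ne_zero.2 (hne j))
  linarith

lemma Interlaces.borderWeight_pos {l : Fin (n + 1) → ℝ} (h : Interlaces μ l) (j : Fin n) :
    0 < borderWeight μ l j := by
  have hμ := h.strictMono_left
  have h1 : ∏ k, (μ j - l k) = (μ j - l j.succ) * ((μ j - l j.castSucc) *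
      ∏ i ∈ Finset.univ.erase j, (μ j - l (j.succ.succAbove i))) := by
    rw [Fin.prod_univ_succAbove _ j.succ, ← Finset.mul_prod_erase Finset.univ _ (Finset.mem_univ j),
      Fin.succAbove_succ_self]
  have h2 : 0 < (∏ i ∈ Finset.univ.erase j, (μ j - l (j.succ.succAbove i))) /
      ∏ i ∈ Finset.univ.erase j, (μ j - μ i) := by
    rw [← Finset.prod_div_distrib]
    refine Finset.prod_pos fun i hi => ?_
    rcases lt_or_gt_of_ne (Finset.ne_of_mem_erase hi) with hij | hij
    · rw [Fin.succAbove_of_castSucc_lt _ _ (by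
        rw [Fin.lt_def] at hij ⊢; simp; omega)]
      exact div_pos (sub_pos.2 (h.lt_of_le (by simpa using hij.le))) (sub_pos.2 (hμ hij))
    · rw [Fin.succAbove_of_le_castSucc _ _ (by
        rw [Fin.lt_def] at hij; rw [Fin.le_def]; simp; omega)]
      exact div_pos_of_neg_of_neg (sub_neg.2 (h.lt_of_lt (by
        rw [Fin.lt_def] at hij ⊢; simp; omega))) (sub_neg.2 (hμ hij))
  have h3 : borderWeight μ l j = (l j.succ - μ j) * (μ j - l j.castSucc) *
      ((∏ i ∈ Finset.univ.erase j, (μ j - l (j.succ.succAbove i))) /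
        ∏ i ∈ Finset.univ.erase j, (μ j - μ i)) := by
    rw [borderWeight, h1]; ring
  rw [h3]
  exact mul_pos (mul_pos (sub_pos.2 (h j).2) (sub_pos.2 (h j).1)) h2

/-- The secular function `t - a - ∑ wⱼ / (t - μⱼ)` runs from `-∞` to `∞` on each of the intervals
between consecutive `μⱼ`, so every positive weight vector and corner entry is attained. -/
lemma exists_interlaces (hμ : StrictMono μ) (w : Fin n → ℝ) (hw : ∀ j, 0 < w j) (a : ℝ) :
    ∃ l, Interlaces μ l ∧ borderWeight μ l = w ∧ ∑ k, l k - ∑ j, μ j = a := by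
  set r : ℝ → ℝ := fun t => t - a - ∑ j, w j / (t - μ j) with hr
  set I : Fin (n + 1) → Set ℝ := fun k =>
    {t | ∀ j : Fin n, (j.castSucc < k → μ j < t) ∧ (k ≤ j.castSucc → t < μ j)} with hI
  have hne : ∀ k, ∀ t ∈ I k, ∀ j, t ≠ μ j := fun k t ht j => by
    rcases le_or_gt k j.castSucc with hk | hk
    · exact ((ht j).2 hk).ne
    · exact ((ht j).1 hk).ne'
  have hpart : ∀ j, ∀ s : Set ℝ, Tendsto
      (fun t => t - a - ∑ i ∈ Finset.univ.erase j, w i / (t - μ i))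
      (𝓝[s] (μ j)) (𝓝 (μ j - a - ∑ i ∈ Finset.univ.erase j, w i / (μ j - μ i))) := by
    intro j s
    refine Tendsto.mono_left ?_ nhdsWithin_le_nhds
    refine Tendsto.sub (tendsto_id.sub tendsto_const_nhds) (tendsto_finsetSum _ fun i hi => ?_)
    refine tendsto_const_nhds.div (tendsto_id.sub tendsto_const_nhds) ?_
    exact sub_ne_zero.2 fun h => Finset.ne_of_mem_erase hi (hμ.injective h).symm
  have hsplit : ∀ j t, r t = -(w j / (t - μ j)) +
      (t - a - ∑ i ∈ Finset.univ.erase j, w i / (t - μ i)) := by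
    intro j t
    simp only [hr]
    rw [← Finset.add_sum_erase Finset.univ _ (Finset.mem_univ j)]
    ring
  have hright : ∀ j, Tendsto r (𝓝[>] (μ j)) atBot := by
    intro j
    rw [funext (hsplit j)]
    refine Tendsto.atBot_add (tendsto_neg_atTop_atBot.comp ?_) (hpart j _)
    simp_rw [div_eq_mul_inv]
    refine Tendsto.const_mul_atTop (hw j) (tendsto_inv_nhdsGT_zero.comp ?_)
    refine tendsto_nhdsWithin_iff.2 ⟨?_, ?_⟩
    · have : Tendsto (fun t => t - μ j) (𝓝 (μ j)) (𝓝 (μ j - μ j)) :=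
        tendsto_id.sub tendsto_const_nhds
      rw [sub_self] at this
      exact this.mono_left nhdsWithin_le_nhds
    · filter_upwards [self_mem_nhdsWithin] with t ht using sub_pos.2 (Set.mem_Ioi.1 ht)
  have hleft : ∀ j, Tendsto r (𝓝[<] (μ j)) atTop := by
    intro j
    rw [funext (hsplit j)]
    refine Tendsto.atTop_add (tendsto_neg_atBot_atTop.comp ?_) (hpart j _)
    simp_rw [div_eq_mul_inv]
    refine Tendsto.const_mul_atBot (hw j) (tendsto_inv_nhdsLT_zero.comp ?_)
    refine tendsto_nhdsWithin_iff.2 ⟨?_, ?_⟩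
    · have : Tendsto (fun t => t - μ j) (𝓝 (μ j)) (𝓝 (μ j - μ j)) :=
        tendsto_id.sub tendsto_const_nhds
      rw [sub_self] at this
      exact this.mono_left nhdsWithin_le_nhds
    · filter_upwards [self_mem_nhdsWithin] with t ht using sub_neg.2 (Set.mem_Iio.1 ht)
  have htop : Tendsto r atTop atTop := by
    have : r = fun t => t + (-a - ∑ j, w j / (t - μ j)) := by funext t; simp only [hr]; ring
    rw [this]
    refine tendsto_id.atTop_add (tendsto_const_nhds.sub (tendsto_finsetSum _ fun j _ => ?_))
      (C := -a - ∑ j : Fin n, (0 : ℝ))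
    exact tendsto_const_nhds.div_atTop (tendsto_atTop_add_const_right _ _ tendsto_id)
  have hbot : Tendsto r atBot atBot := by
    have : r = fun t => t + (-a - ∑ j, w j / (t - μ j)) := by funext t; simp only [hr]; ring
    rw [this]
    refine tendsto_id.atBot_add (tendsto_const_nhds.sub (tendsto_finsetSum _ fun j _ => ?_))
      (C := -a - ∑ j : Fin n, (0 : ℝ))
    exact tendsto_const_nhds.div_atBot (tendsto_atBot_add_const_right _ _ tendsto_id)
  have hlo : ∀ k, ∃ t ∈ I k, r t < 0 := by
    intro k
    refine Fin.cases ?_ (fun j => ?_) k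
    · have h1 : ∀ᶠ t in atBot, ∀ j : Fin n, t < μ j :=
        eventually_all.2 fun j => eventually_lt_atBot _
      obtain ⟨t, ht, ht'⟩ := (h1.and (hbot.eventually (eventually_lt_atBot 0))).exists
      exact ⟨t, fun j => ⟨fun h => absurd h (Fin.not_lt_zero _), fun _ => ht j⟩, ht'⟩
    · have h1 : ∀ᶠ t in 𝓝[>] (μ j), ∀ i : Fin n, j < i → t < μ i :=
        eventually_all.2 fun i => by
          by_cases hij : j < i
          · filter_upwards [mem_nhdsWithin_of_mem_nhds (Iio_mem_nhds (hμ hij))] with t ht _ using ht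
          · exact Eventually.of_forall fun t h => absurd h hij
      obtain ⟨t, ⟨ht, ht'⟩, ht''⟩ := ((h1.and self_mem_nhdsWithin).and
        ((hright j).eventually (eventually_lt_atBot 0))).exists
      refine ⟨t, fun i => ⟨fun h => ?_, fun h => ht i ?_⟩, ht''⟩
      · refine (hμ.monotone ?_).trans_lt ht'
        rw [Fin.lt_def] at h; rw [Fin.le_def]; simp at h; omega
      · rw [Fin.le_def] at h; rw [Fin.lt_def]; simp at h; omega
  have hhi : ∀ k, ∃ t ∈ I k, 0 < r t := by
    intro k
    refine Fin.lastCases ?_ (fun j => ?_) k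
    · have h1 : ∀ᶠ t in atTop, ∀ j : Fin n, μ j < t :=
        eventually_all.2 fun j => eventually_gt_atTop _
      obtain ⟨t, ht, ht'⟩ := (h1.and (htop.eventually (eventually_gt_atTop 0))).exists
      exact ⟨t, fun j => ⟨fun _ => ht j, fun h => absurd h (Fin.castSucc_lt_last j).not_ge⟩, ht'⟩
    · have h1 : ∀ᶠ t in 𝓝[<] (μ j), ∀ i : Fin n, i < j → μ i < t :=
        eventually_all.2 fun i => by
          by_cases hij : i < j
          · filter_upwards [mem_nhdsWithin_of_mem_nhds (Ioi_mem_nhds (hμ hij))] with t ht _ using ht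
          · exact Eventually.of_forall fun t h => absurd h hij
      obtain ⟨t, ⟨ht, ht'⟩, ht''⟩ := ((h1.and self_mem_nhdsWithin).and
        ((hleft j).eventually (eventually_gt_atTop 0))).exists
      refine ⟨t, fun i => ⟨fun h => ht i ?_, fun h => ?_⟩, ht''⟩
      · simpa using h
      · exact lt_of_lt_of_le ht' (hμ.monotone (by simpa using h))
  have hroot : ∀ k, ∃ t ∈ I k, r t = 0 := by
    intro k
    obtain ⟨p, hp, hp0⟩ := hlo k
    obtain ⟨q, hq, hq0⟩ := hhi k
    have hconn : (I k).OrdConnected := ⟨fun x hx y hy t ht j =>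
      ⟨fun h => ((hx j).1 h).trans_le ht.1, fun h => ht.2.trans_lt ((hy j).2 h)⟩⟩
    have hcont : ContinuousOn r (I k) := by
      refine (continuousOn_id.sub continuousOn_const).sub (continuousOn_finsetSum _ fun j _ => ?_)
      exact continuousOn_const.div (continuousOn_id.sub continuousOn_const)
        fun t ht => sub_ne_zero.2 (hne k t ht j)
    obtain ⟨t, ht, h0⟩ := hconn.isPreconnected.intermediate_value hp hq hcont ⟨hp0.le, hq0.le⟩
    exact ⟨t, ht, h0⟩
  choose l hl hl0 using hroot
  have hint : Interlaces μ l := fun k =>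
    ⟨(hl k.castSucc k).2 le_rfl, (hl k.succ k).1 (Fin.castSucc_lt_succ)⟩
  refine ⟨l, hint, borderWeight_eq_of_roots hμ.injective w a hint.strictMono.injective fun k => ?_⟩
  rw [eval_borderPoly _ _ _ (hne k _ (hl k))]
  exact mul_eq_zero_of_left (hl0 k) _

lemma Interlaces.eq_of_borderWeight_eq {l l' : Fin (n + 1) → ℝ} (h : Interlaces μ l)
    (h' : Interlaces μ l') (hw : borderWeight μ l = borderWeight μ l')
    (ha : ∑ k, l k - ∑ j, μ j = ∑ k, l' k - ∑ j, μ j) : l = l' := by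
  have h1 : Lagrange.nodal Finset.univ l = Lagrange.nodal Finset.univ l' := by
    rw [nodal_eq_borderPoly h.strictMono_left.injective, hw, ha,
      ← nodal_eq_borderPoly h.strictMono_left.injective]
  have hsub : ∀ {x y : Fin (n + 1) → ℝ},
      Lagrange.nodal Finset.univ x = Lagrange.nodal Finset.univ y → Set.range x ⊆ Set.range y := by
    rintro x y hxy _ ⟨k, rfl⟩
    have := Lagrange.eval_nodal_at_node (v := x) (Finset.mem_univ k)
    rw [hxy, Lagrange.eval_nodal] at this
    obtain ⟨i, _, hi⟩ := Finset.prod_eq_zero_iff.1 this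
    exact ⟨i, (sub_eq_zero.1 hi).symm⟩
  exact (StrictMono.range_inj h.strictMono h'.strictMono).1
    (Set.Subset.antisymm (hsub h1) (hsub h1.symm))

end Weights

/-! ### The Jacobian of the spectral coordinates of a bordered matrix -/

lemma det_vandermonde_eq_vdm {n : ℕ} (x : Fin n → ℝ) : (Matrix.vandermonde x).det = vdm x :=
  Matrix.det_vandermonde x

lemma vdm_pos {n : ℕ} {x : Fin n → ℝ} (hx : StrictMono x) : 0 < vdm x :=
  Finset.prod_pos fun _ _ => Finset.prod_pos fun _ hk => sub_pos.2 (hx (Finset.mem_Ioi.1 hk))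

lemma vdm_ne_zero {n : ℕ} {x : Fin n → ℝ} (hx : Function.Injective x) : vdm x ≠ 0 :=
  Finset.prod_ne_zero_iff.2 fun _ _ => Finset.prod_ne_zero_iff.2 fun _ hk =>
    sub_ne_zero.2 fun h => (Finset.mem_Ioi.1 hk).ne' (hx h)

lemma continuous_vdm (n : ℕ) : Continuous (vdm : (Fin n → ℝ) → ℝ) := by
  unfold vdm; fun_prop

lemma abs_prod_prod_erase_sub {n : ℕ} (x : Fin n → ℝ) :
    |∏ k, ∏ m ∈ Finset.univ.erase k, (x k - x m)| = vdm x ^ 2 := by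
  have h := Finset.prod_prod_Ioi_mul_eq_prod_prod_off_diag fun i j : Fin n => |x j - x i|
  rw [Finset.abs_prod]
  simp_rw [Finset.abs_prod]
  have hc : ∀ k : Fin n, Finset.univ.erase k = {k}ᶜ := fun k => by
    ext; simp
  simp_rw [hc]
  rw [← h, ← sq_abs, vdm, Finset.abs_prod, ← Finset.prod_pow]
  refine Finset.prod_congr rfl fun i _ => ?_
  rw [Finset.abs_prod, ← Finset.prod_pow]
  refine Finset.prod_congr rfl fun j _ => ?_
  rw [abs_sub_comm (x i), sq]

section
variable {n : ℕ} (μ : Fin n → ℝ)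

/-- The coordinates `(w, a)` of the matrix with leading block `diag μ` and eigenvalues `l`: the
squared moduli of its last column, followed by its corner entry. -/
noncomputable def borderCoords (l : Fin (n + 1) → ℝ) : Fin (n + 1) → ℝ :=
  Fin.snoc (borderWeight μ l) (∑ k, l k - ∑ j, μ j)

/-- The Jacobian matrix of `borderCoords`. -/
noncomputable def borderJacobian (l : Fin (n + 1) → ℝ) : Matrix (Fin (n + 1)) (Fin (n + 1)) ℝ :=
  Matrix.of (Fin.snoc (fun j k => (∏ m ∈ Finset.univ.erase k, (μ j - l m)) /
    ∏ i ∈ Finset.univ.erase j, (μ j - μ i)) (fun _ => 1) : Fin (n + 1) → Fin (n + 1) → ℝ)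

lemma hasFDerivAt_borderCoords (l : Fin (n + 1) → ℝ) :
    HasFDerivAt (borderCoords μ)
      (LinearMap.toContinuousLinearMap (Matrix.toLin' (borderJacobian μ l))) l := by
  rw [hasFDerivAt_pi']
  intro i
  refine Fin.lastCases ?_ (fun j => ?_) i
  · have h : HasFDerivAt (fun l : Fin (n + 1) → ℝ => ∑ k, l k - ∑ j, μ j)
        (∑ k, ContinuousLinearMap.proj (R := ℝ) (φ := fun _ : Fin (n + 1) => ℝ) k) l :=
      (HasFDerivAt.fun_sum fun k _ => hasFDerivAt_apply k l).sub_const _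
    simp only [borderCoords, Fin.snoc_last]
    refine h.congr_fderiv ?_
    ext v
    simp [borderJacobian, Matrix.mulVec, dotProduct]
  · have h1 : ∀ k : Fin (n + 1), HasFDerivAt (fun l : Fin (n + 1) → ℝ => μ j - l k)
        (-ContinuousLinearMap.proj (R := ℝ) (φ := fun _ : Fin (n + 1) => ℝ) k) l := fun k =>
      (hasFDerivAt_apply k l).const_sub _
    have h2 := ((HasFDerivAt.finsetProd (u := Finset.univ) fun k _ => h1 k).neg).mul_const
      (∏ i ∈ Finset.univ.erase j, (μ j - μ i))⁻¹
    simp only [borderCoords, Fin.snoc_castSucc, borderWeight, div_eq_mul_inv]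
    refine h2.congr_fderiv ?_
    ext v
    simp [borderJacobian, Matrix.mulVec, dotProduct, Finset.mul_sum, div_eq_mul_inv, mul_comm,
      mul_left_comm]

variable {μ}

lemma borderJacobian_mul_vandermonde {l : Fin (n + 1) → ℝ} (hl : Function.Injective l) :
    borderJacobian μ l * (Matrix.of fun k m =>
      (∏ i ∈ Finset.univ.erase k, (l k - l i))⁻¹ * Matrix.vandermonde l k m) =
    Matrix.of (Fin.snoc (fun j m => (∏ i ∈ Finset.univ.erase j, (μ j - μ i))⁻¹ * μ j ^ (m : ℕ))
      (fun m => if m = Fin.last n then 1 else 0) : Fin (n + 1) → Fin (n + 1) → ℝ) := by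
  -- Both blocks of rows express Lagrange interpolation of `X ^ m` at the nodes `l`.
  ext i m
  have hdeg : ((Polynomial.X : Polynomial ℝ) ^ (m : ℕ)).degree <
      ((Finset.univ : Finset (Fin (n + 1))).card : WithBot ℕ) := by
    rw [Polynomial.degree_X_pow, Finset.card_univ, Fintype.card_fin]
    exact WithBot.coe_lt_coe.2 m.is_lt
  rw [Matrix.mul_apply]
  refine Fin.lastCases ?_ (fun j => ?_) i
  · have h := Lagrange.coeff_eq_sum (s := Finset.univ) hl.injOn hdeg
    rw [Finset.card_univ, Fintype.card_fin, Nat.add_sub_cancel, Polynomial.coeff_X_pow] at h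
    simp only [borderJacobian, Matrix.of_apply, Fin.snoc_last, Matrix.vandermonde_apply, one_mul]
    rw [show (if m = Fin.last n then (1 : ℝ) else 0) = if n = (m : ℕ) then 1 else 0 by
      simp [Fin.ext_iff, eq_comm], h]
    refine Finset.sum_congr rfl fun k _ => ?_
    rw [Polynomial.eval_pow, Polynomial.eval_X, div_eq_mul_inv, mul_comm]
  · have h := congrArg (Polynomial.eval (μ j))
      (Lagrange.eq_interpolate (s := Finset.univ) (v := l) hl.injOn hdeg)
    rw [Lagrange.interpolate_eq_sum, Polynomial.eval_finsetSum] at h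
    simp only [Polynomial.eval_pow, Polynomial.eval_X, Polynomial.eval_mul, Polynomial.eval_C,
      Polynomial.eval_prod, Polynomial.eval_sub] at h
    simp only [borderJacobian, Matrix.of_apply, Fin.snoc_castSucc, Matrix.vandermonde_apply]
    rw [h, Finset.mul_sum]
    refine Finset.sum_congr rfl fun k _ => ?_
    ring

lemma det_snoc_vandermonde (c : Fin n → ℝ) :
    (Matrix.of (Fin.snoc (fun j m => c j * μ j ^ (m : ℕ))
      (fun m => if m = Fin.last n then 1 else 0) :
        Fin (n + 1) → Fin (n + 1) → ℝ)).det = (∏ j, c j) * vdm μ := by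
  rw [Matrix.det_succ_row _ (Fin.last n), Finset.sum_eq_single (Fin.last n)]
  · rw [← det_vandermonde_eq_vdm, ← Matrix.det_mul_column]
    simp only [Fin.val_last, Matrix.of_apply, Fin.snoc_last, if_true, mul_one,
      Even.neg_one_pow (Even.add_self n), one_mul]
    congr 1
    ext j m
    simp [Matrix.vandermonde_apply]
  · intro k _ hk
    simp [hk]
  · simp

lemma abs_det_borderJacobian {l : Fin (n + 1) → ℝ} (hl : StrictMono l) (hμ : StrictMono μ) :
    |(borderJacobian μ l).det| = vdm l / vdm μ := by
  have h1 := congrArg Matrix.det (borderJacobian_mul_vandermonde (μ := μ) hl.injective)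
  rw [Matrix.det_mul, Matrix.det_mul_column, det_vandermonde_eq_vdm, det_snoc_vandermonde] at h1
  have h3 := congrArg abs h1
  rw [abs_mul, abs_mul, abs_mul, Finset.prod_inv_distrib, Finset.prod_inv_distrib, abs_inv, abs_inv,
    abs_prod_prod_erase_sub, abs_prod_prod_erase_sub, abs_of_pos (vdm_pos hl),
    abs_of_pos (vdm_pos hμ)] at h3
  have hl0 := (vdm_pos hl).ne'
  have hμ0 := (vdm_pos hμ).ne'
  field_simp at h3 ⊢
  exact h3

end

/-! ### Diagonalization of bordered matrices -/

/-- A Hermitian matrix with distinct prescribed eigenvalues is unitarily equivalent to the diagonal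
matrix of these. -/
lemma exists_conjHerm_diagHerm_eq {m : ℕ} (A : Herm m) {l : Fin m → ℝ}
    (hl : Function.Injective l) (v : Fin m → Fin m → ℂ) (hv : ∀ k, v k ≠ 0)
    (hA : ∀ k, (A : Matrix (Fin m) (Fin m) ℂ).mulVec (v k) = (l k : ℂ) • v k) :
    ∃ U : UGroup m, conjHerm U (diagHerm l) = A := by
  have hAs : (A : Matrix (Fin m) (Fin m) ℂ).conjTranspose = A := selfAdjoint.mem_iff.1 A.2
  have horth : ∀ j k, j ≠ k → star (v j) ⬝ᵥ v k = 0 := by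
    intro j k hjk
    have h1 : star (v j) ⬝ᵥ (A : Matrix (Fin m) (Fin m) ℂ).mulVec (v k) =
        (l k : ℂ) * (star (v j) ⬝ᵥ v k) := by
      rw [hA, dotProduct_smul, smul_eq_mul]
    have h2 : star (v j) ⬝ᵥ (A : Matrix (Fin m) (Fin m) ℂ).mulVec (v k) =
        (l j : ℂ) * (star (v j) ⬝ᵥ v k) := by
      rw [Matrix.dotProduct_mulVec, ← hAs, ← Matrix.star_mulVec, hA, star_smul, smul_dotProduct,
        smul_eq_mul, Complex.star_def, Complex.conj_ofReal]
    have h3 : ((l k : ℂ) - l j) * (star (v j) ⬝ᵥ v k) = 0 := by rw [sub_mul, ← h1, h2, sub_self]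
    refine (mul_eq_zero.1 h3).resolve_left (sub_ne_zero.2 fun h => hjk (hl ?_).symm)
    exact_mod_cast h
  set q : Fin m → ℝ := fun k => ∑ i, ‖v k i‖ ^ 2 with hq
  have hq0 : ∀ k, 0 < q k := fun k => by
    obtain ⟨i, hi⟩ := Function.ne_iff.1 (hv k)
    exact Finset.sum_pos' (fun _ _ => by positivity)
      ⟨i, Finset.mem_univ i, by have := norm_pos_iff.2 hi; positivity⟩
  have hself : ∀ k, star (v k) ⬝ᵥ v k = (q k : ℂ) := fun k => by
    simp only [hq, dotProduct, Pi.star_apply]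
    push_cast
    refine Finset.sum_congr rfl fun j _ => ?_
    rw [← Complex.conj_mul']; rfl
  set c : Fin m → ℂ := fun k => ((Real.sqrt (q k))⁻¹ : ℝ) with hc
  have hcc : ∀ k, c k * c k * q k = 1 := fun k => by
    simp only [hc]
    norm_cast
    rw [← mul_inv, Real.mul_self_sqrt (hq0 k).le, inv_mul_cancel₀ (hq0 k).ne']
  set W : Matrix (Fin m) (Fin m) ℂ := Matrix.of fun i k => c k * v k i with hW
  have hWW : star W * W = 1 := by
    ext j k
    rw [Matrix.mul_apply]
    have h1 : ∑ i, star W j i * W i k = c j * c k * (star (v j) ⬝ᵥ v k) := by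
      rw [dotProduct, Finset.mul_sum]
      refine Finset.sum_congr rfl fun i _ => ?_
      have hcj : (starRingEnd ℂ) (c j) = c j := Complex.conj_ofReal _
      simp only [Matrix.star_apply, hW, Matrix.of_apply, Pi.star_apply, Complex.star_def, map_mul,
        hcj]
      ring
    rw [h1]
    rcases eq_or_ne j k with rfl | hjk
    · rw [hself, hcc, Matrix.one_apply_eq]
    · rw [horth j k hjk, mul_zero, Matrix.one_apply_ne hjk]
  refine ⟨⟨W, Matrix.mem_unitaryGroup_iff'.2 hWW⟩, Subtype.ext ?_⟩
  rw [conjHerm_coe]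
  change W * Matrix.diagonal (fun j => (l j : ℂ)) * star W = _
  have hAW : (A : Matrix (Fin m) (Fin m) ℂ) * W = W * Matrix.diagonal (fun j => (l j : ℂ)) := by
    ext i k
    rw [Matrix.mul_diagonal, Matrix.mul_apply]
    have h1 := congrFun (hA k) i
    simp only [Matrix.mulVec, dotProduct, Pi.smul_apply, smul_eq_mul] at h1
    simp only [hW, Matrix.of_apply]
    rw [mul_assoc, mul_comm (v k i), ← h1, Finset.mul_sum]
    exact Finset.sum_congr rfl fun j _ => by ring
  rw [← hAW, mul_assoc, Matrix.mem_unitaryGroup_iff.1 (Matrix.mem_unitaryGroup_iff'.2 hWW), mul_one]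

lemma diagHerm_coe {n : ℕ} (x : Fin n → ℝ) :
    (diagHerm x : Matrix (Fin n) (Fin n) ℂ) = Matrix.diagonal fun j => (x j : ℂ) := rfl

lemma continuous_diagHerm (n : ℕ) : Continuous (diagHerm : (Fin n → ℝ) → Herm n) := by
  refine Continuous.subtype_mk ?_ _
  exact Continuous.matrix_diagonal (by fun_prop)

lemma Interlaces.exists_conjHerm_eq {n : ℕ} {μ : Fin n → ℝ} {l : Fin (n + 1) → ℝ}
    (h : Interlaces μ l) :
    ∃ U : UGroup (n + 1), conjHerm U (diagHerm l) = borderedHerm (diagHerm μ)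
      (fun j => (Real.sqrt (borderWeight μ l j) : ℂ)) (∑ k, l k - ∑ j, μ j) := by
  have hne : ∀ k j, (l k : ℂ) - μ j ≠ 0 := fun k j => by
    rw [sub_ne_zero]
    rcases le_or_gt k j.castSucc with hk | hk
    · exact_mod_cast (h.lt_of_le hk).ne
    · exact_mod_cast (h.lt_of_lt hk).ne'
  refine exists_conjHerm_diagHerm_eq _ h.strictMono.injective
    (fun k => (Fin.snoc (fun j => (Real.sqrt (borderWeight μ l j) : ℂ) / (l k - μ j)) 1 :
      Fin (n + 1) → ℂ)) ?_ ?_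
  · intro k h0
    simpa using congrFun h0 (Fin.last n)
  · intro k
    ext i
    simp only [Matrix.mulVec, dotProduct, Fin.sum_univ_castSucc, Pi.smul_apply, smul_eq_mul]
    refine Fin.lastCases ?_ (fun i => ?_) i
    · simp only [borderedHerm_last_castSucc, borderedHerm_last_last, Fin.snoc_castSucc,
        Fin.snoc_last, mul_one, Complex.star_def, Complex.conj_ofReal]
      have h1 := h.secular_eq k
      have h2 : (l k : ℂ) = ((∑ i, l i - ∑ j, μ j : ℝ) : ℂ) +
          ∑ j, (borderWeight μ l j : ℂ) / (l k - μ j) := by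
        exact_mod_cast congrArg Complex.ofReal h1
      refine Eq.trans ?_ h2.symm
      rw [add_comm]
      refine congrArg₂ (· + ·) (by rw [Fin.sum_univ_castSucc]) (Finset.sum_congr rfl fun j _ => ?_)
      rw [← mul_div_assoc, ← Complex.ofReal_mul, Real.mul_self_sqrt (h.borderWeight_pos j).le]
    · simp only [borderedHerm_castSucc_castSucc, borderedHerm_castSucc_last, Fin.snoc_castSucc,
        Fin.snoc_last, mul_one, diagHerm_coe]
      rw [Finset.sum_eq_single i]
      · rw [Matrix.diagonal_apply_eq]
        have := hne k i
        field_simp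
        ring
      · intro j _ hj
        rw [Matrix.diagonal_apply_ne _ hj.symm, zero_mul]
      · simp

/-- Only the moduli of the last column matter for unitarily invariant functions of a matrix with
diagonal leading block. -/
lemma exists_conjHerm_borderedHerm_diag {n : ℕ} (μ : Fin n → ℝ) (z : Fin n → ℂ) (a : ℝ) :
    ∃ U : UGroup (n + 1), conjHerm U (borderedHerm (diagHerm μ)
      (fun j => (Real.sqrt (‖z j‖ ^ 2) : ℂ)) a) = borderedHerm (diagHerm μ) z a := by
  set u : Fin n → ℂ := fun j => if z j = 0 then 1 else z j / ‖z j‖ with hu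
  have hus : ∀ j, u j * star (u j) = 1 := fun j => by
    rw [Complex.star_def, Complex.mul_conj']
    simp only [hu]
    split_ifs with h
    · simp
    · simp [h]
  have huz : ∀ j, u j * (Real.sqrt (‖z j‖ ^ 2) : ℂ) = z j := fun j => by
    rw [Real.sqrt_sq (norm_nonneg _)]
    simp only [hu]
    split_ifs with h
    · simp [h]
    · rw [div_mul_cancel₀]
      exact_mod_cast (norm_ne_zero_iff.2 h)
  let U : UGroup n := ⟨Matrix.diagonal u, by
    rw [Matrix.mem_unitaryGroup_iff, Matrix.star_eq_conjTranspose, Matrix.diagonal_conjTranspose,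
      Matrix.diagonal_mul_diagonal, ← Matrix.diagonal_one]
    exact congrArg _ (funext hus)⟩
  have hU : (U : Matrix (Fin n) (Fin n) ℂ) = Matrix.diagonal u := rfl
  refine ⟨extendUnitary U, ?_⟩
  rw [conjHerm_extendUnitary]
  congr 1
  · apply Subtype.ext
    rw [conjHerm_coe, diagHerm_coe, hU, Matrix.star_eq_conjTranspose,
      Matrix.diagonal_conjTranspose, Matrix.diagonal_mul_diagonal, Matrix.diagonal_mul_diagonal]
    refine congrArg _ (funext fun j => ?_)
    rw [mul_right_comm, Pi.star_apply, hus, one_mul]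
  · funext j
    rw [hU, Matrix.mulVec_diagonal, huz]

/-! ### Integration over the last row and column -/

/-- The squared modulus maps area on `ℂ` to `π` times length on the half line. -/
lemma measurePreserving_norm_sq :
    MeasurePreserving (fun z : ℂ => ‖z‖ ^ 2) volume
      (ENNReal.ofReal Real.pi • (volume.restrict (Set.Ioi (0 : ℝ)))) := by
  refine ⟨by fun_prop, Measure.ext_of_lintegral _ fun g hg => ?_⟩
  rw [lintegral_map hg (by fun_prop), lintegral_smul_measure,
    ← Complex.lintegral_comp_polarCoord_symm]
  have himg : (fun r : ℝ => r ^ 2) '' Set.Ioi 0 = Set.Ioi 0 := by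
    ext t
    constructor
    · rintro ⟨r, hr, rfl⟩
      exact pow_pos (Set.mem_Ioi.1 hr) 2
    · intro ht
      exact ⟨Real.sqrt t, Real.sqrt_pos.2 ht, Real.sq_sqrt (Set.mem_Ioi.1 ht).le⟩
  have hcv := lintegral_image_eq_lintegral_abs_deriv_mul (s := Set.Ioi (0 : ℝ))
    (f := fun r => r ^ 2) (f' := fun r => 2 * r) measurableSet_Ioi
    (fun r _ => by simpa using (hasDerivAt_pow 2 r).hasDerivWithinAt)
    (fun x hx y hy h => by
      simpa [abs_of_pos (Set.mem_Ioi.1 hx), abs_of_pos (Set.mem_Ioi.1 hy)] using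
        (sq_eq_sq_iff_abs_eq_abs x y).1 h) g
  rw [himg] at hcv
  rw [hcv, polarCoord_target, Measure.volume_eq_prod, ← Measure.prod_restrict, lintegral_prod,
    smul_eq_mul, ← lintegral_const_mul]
  · refine setLIntegral_congr_fun measurableSet_Ioi fun r hr => ?_
    have hr0 : 0 < r := hr
    simp only [Complex.norm_polarCoord_symm, sq_abs, smul_eq_mul, lintegral_const,
      Measure.restrict_apply_univ, Real.volume_Ioo]
    rw [abs_of_pos (by positivity), ENNReal.ofReal_mul (by norm_num : (0 : ℝ) ≤ 2),
      show Real.pi - -Real.pi = 2 * Real.pi by ring, ENNReal.ofReal_mul (by norm_num : (0 : ℝ) ≤ 2)]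
    ring
  · fun_prop
  · simp only [Complex.norm_polarCoord_symm]
    fun_prop

lemma lintegral_comp_norm_sq {n : ℕ} (g : (Fin n → ℝ) → ENNReal) (hg : Measurable g) :
    ∫⁻ z : Fin n → ℂ, g (fun j => ‖z j‖ ^ 2) = ENNReal.ofReal Real.pi ^ n *
      ∫⁻ w in Set.univ.pi fun _ : Fin n => Set.Ioi (0 : ℝ), g w := by
  have : SigmaFinite (ENNReal.ofReal Real.pi • (volume.restrict (Set.Ioi (0 : ℝ)))) :=
    inferInstanceAs (SigmaFinite (Real.pi.toNNReal • (volume.restrict (Set.Ioi (0 : ℝ)))))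
  have h1 := measurePreserving_pi (fun _ : Fin n => (volume : Measure ℂ))
    (fun _ : Fin n => ENNReal.ofReal Real.pi • (volume.restrict (Set.Ioi (0 : ℝ))))
    (fun _ => measurePreserving_norm_sq)
  have h2 : Measure.pi (fun _ : Fin n =>
      ENNReal.ofReal Real.pi • (volume.restrict (Set.Ioi (0 : ℝ)))) =
      ENNReal.ofReal Real.pi ^ n •
        Measure.pi (fun _ : Fin n => (volume.restrict (Set.Ioi (0 : ℝ)))) := by
    refine Measure.pi_eq fun s _ => ?_
    simp [Measure.pi_pi, Finset.prod_mul_distrib]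
  rw [h2, ← Measure.restrict_pi_pi] at h1
  have h3 := h1.lintegral_comp hg
  rw [lintegral_smul_measure] at h3
  exact h3

/-- Coordinates of a matrix with leading block `diag μ`, traded for its eigenvalues. -/
lemma lintegral_borderedHerm_diag {n : ℕ} {f : Herm (n + 1) → ENNReal} (hf : Measurable f)
    (hinv : ∀ U A, f (conjHerm U A) = f A) {g : ℝ → ENNReal} (hg : Measurable g)
    {μ : Fin n → ℝ} (hμ : StrictMono μ) :
    ∫⁻ a : ℝ, (∫⁻ z : Fin n → ℂ, f (borderedHerm (diagHerm μ) z a)) * g a =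
      ENNReal.ofReal Real.pi ^ n * ∫⁻ l in {l | Interlaces μ l},
        ENNReal.ofReal (vdm l / vdm μ) * (f (diagHerm l) * g (∑ k, l k - ∑ j, μ j)) := by
  set H : ℝ × (Fin n → ℝ) → ENNReal := fun y =>
    f (borderedHerm (diagHerm μ) (fun j => (Real.sqrt (y.2 j) : ℂ)) y.1) * g y.1 with hH
  have hHm : Measurable H := by
    refine (hf.comp (Continuous.measurable ?_)).mul (hg.comp measurable_fst)
    exact (continuous_borderedHerm n).comp (f := fun y : ℝ × (Fin n → ℝ) =>
      (diagHerm μ, fun j => (Real.sqrt (y.2 j) : ℂ), y.1)) (by fun_prop)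
  have h1 : ∀ a, (∫⁻ z : Fin n → ℂ, f (borderedHerm (diagHerm μ) z a)) * g a =
      ENNReal.ofReal Real.pi ^ n *
        ∫⁻ w in Set.univ.pi fun _ : Fin n => Set.Ioi (0 : ℝ), H (a, w) := by
    intro a
    have hm : Measurable fun z : Fin n → ℂ => f (borderedHerm (diagHerm μ) z a) := by
      refine hf.comp (Continuous.measurable ?_)
      exact (continuous_borderedHerm n).comp (f := fun z : Fin n → ℂ => (diagHerm μ, z, a))
        (by fun_prop)
    rw [← lintegral_mul_const _ hm, ← lintegral_comp_norm_sq (fun w => H (a, w))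
      (hHm.comp measurable_prodMk_left)]
    refine lintegral_congr fun z => ?_
    obtain ⟨U, hU⟩ := exists_conjHerm_borderedHerm_diag μ z a
    rw [← hU, hinv]
  set S : Set (Fin (n + 1) → ℝ) := {y | ∀ j : Fin n, 0 < y j.castSucc} with hS
  have hSm : MeasurableSet S := by
    rw [hS, Set.ofPred_forall]
    exact MeasurableSet.iInter fun j => measurableSet_lt measurable_const (measurable_pi_apply _)
  have hIm : MeasurableSet {l | Interlaces μ l} := by
    simp only [Interlaces, Set.ofPred_forall, Set.ofPred_and]
    exact MeasurableSet.iInter fun j =>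
      (measurableSet_lt (measurable_pi_apply _) measurable_const).inter
        (measurableSet_lt measurable_const (measurable_pi_apply _))
  set e := MeasurableEquiv.piFinSuccAbove (fun _ : Fin (n + 1) => ℝ) (Fin.last n) with he
  have hecoe : ∀ y, e y = (y (Fin.last n), fun j => y j.castSucc) := fun y =>
    Prod.ext rfl (funext fun j => congrArg y (Fin.succAbove_last_apply j))
  have himg : borderCoords μ '' {l | Interlaces μ l} = S := by
    ext y
    constructor
    · rintro ⟨l, hl, rfl⟩ j
      simpa [borderCoords] using Interlaces.borderWeight_pos hl j
    · intro hy
      obtain ⟨l, hl, hw, ha⟩ := exists_interlaces hμ (fun j => y j.castSucc) hy (y (Fin.last n))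
      refine ⟨l, hl, ?_⟩
      rw [borderCoords, hw, ha]
      exact Fin.snoc_init_self y
  have hinj : Set.InjOn (borderCoords μ) {l | Interlaces μ l} := by
    intro l hl l' hl' h
    refine Interlaces.eq_of_borderWeight_eq hl hl' (funext fun j => ?_) ?_
    · simpa [borderCoords] using congrFun h j.castSucc
    · simpa [borderCoords] using congrFun h (Fin.last n)
  have h2 : ∫⁻ a : ℝ, ∫⁻ w in Set.univ.pi fun _ : Fin n => Set.Ioi (0 : ℝ), H (a, w) =
      ∫⁻ y in S, H (e y) := by
    have hpre : S = e ⁻¹' (Set.univ ×ˢ Set.univ.pi fun _ : Fin n => Set.Ioi (0 : ℝ)) := by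
      ext y
      simp [hS, hecoe]
    rw [hpre, (volume_preserving_piFinSuccAbove (fun _ : Fin (n + 1) => ℝ)
      (Fin.last n)).setLIntegral_comp_preimage (MeasurableSet.univ.prod
        (MeasurableSet.univ_pi fun _ => measurableSet_Ioi)) hHm]
    rw [Measure.volume_eq_prod, ← Measure.prod_restrict, Measure.restrict_univ,
      lintegral_prod _ hHm.aemeasurable]
  have h3 := lintegral_image_eq_lintegral_abs_det_fderiv_mul volume hIm
    (fun l _ => (hasFDerivAt_borderCoords μ l).hasFDerivWithinAt) hinj (fun y => H (e y))
  rw [lintegral_congr h1, lintegral_const_mul _ (by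
    exact Measurable.lintegral_prod_right' hHm), h2, ← himg, h3]
  congr 1
  refine setLIntegral_congr_fun hIm fun l hl => ?_
  have hl' : Interlaces μ l := hl
  obtain ⟨U, hU⟩ := hl'.exists_conjHerm_eq
  rw [ContinuousLinearMap.det, LinearMap.coe_toContinuousLinearMap, LinearMap.det_toLin',
    abs_det_borderJacobian hl'.strictMono hμ, hecoe]
  simp only [hH, borderCoords, Fin.snoc_castSucc, Fin.snoc_last]
  rw [← hU, hinv]

/-! ### The Gelfand–Tsetlin kernel and integration of invariant functions -/

/-- The open Weyl chamber `x₀ < x₁ < … < xₙ₋₁`. -/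
def weylChamber (n : ℕ) : Set (Fin n → ℝ) := {x | StrictMono x}

lemma isOpen_weylChamber (n : ℕ) : IsOpen (weylChamber n) := by
  have : weylChamber n = ⋂ i, ⋂ j, {x : Fin n → ℝ | i < j → x i < x j} := by
    ext x
    simp [weylChamber, StrictMono]
  rw [this]
  refine isOpen_iInter_of_finite fun i => isOpen_iInter_of_finite fun j => ?_
  by_cases hij : i < j
  · simp only [hij, true_imp_iff]
    exact isOpen_lt (continuous_apply i) (continuous_apply j)
  · simp [hij]

lemma measurableSet_weylChamber (n : ℕ) : MeasurableSet (weylChamber n) :=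
  (isOpen_weylChamber n).measurableSet

lemma measurableSet_interlaces_prod (n : ℕ) :
    MeasurableSet {p : (Fin n → ℝ) × (Fin (n + 1) → ℝ) | Interlaces p.1 p.2} := by
  simp only [Interlaces, Set.ofPred_forall, Set.ofPred_and]
  exact MeasurableSet.iInter fun j =>
    (measurableSet_lt (by fun_prop) (by fun_prop)).inter
      (measurableSet_lt (by fun_prop) (by fun_prop))

lemma measurableSet_interlaces_left {n : ℕ} (l : Fin (n + 1) → ℝ) :
    MeasurableSet {μ : Fin n → ℝ | Interlaces μ l} :=
  measurable_prodMk_right (measurableSet_interlaces_prod n)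

lemma measurableSet_interlaces_right {n : ℕ} (μ : Fin n → ℝ) :
    MeasurableSet {l : Fin (n + 1) → ℝ | Interlaces μ l} :=
  measurable_prodMk_left (measurableSet_interlaces_prod n)

/-- `πⁿ` times Lebesgue measure on the sequences interlacing a given one. -/
noncomputable def interlacingKernel (n : ℕ) : Kernel (Fin (n + 1) → ℝ) (Fin n → ℝ) :=
  (Kernel.const _ volume).withDensity fun l μ =>
    {p : (Fin n → ℝ) × (Fin (n + 1) → ℝ) | Interlaces p.1 p.2}.indicator
      (fun _ => ENNReal.ofReal Real.pi ^ n) (μ, l)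

instance (n : ℕ) : IsSFiniteKernel (interlacingKernel n) := by
  refine Kernel.IsSFiniteKernel.withDensity _ fun l μ => ?_
  exact ne_top_of_le_ne_top (ENNReal.pow_ne_top ENNReal.ofReal_ne_top)
    (Set.indicator_le_self _ _ _)

lemma lintegral_interlacingKernel {n : ℕ} (l : Fin (n + 1) → ℝ) {g : (Fin n → ℝ) → ENNReal}
    (hg : Measurable g) :
    ∫⁻ μ, g μ ∂(interlacingKernel n l) =
      ENNReal.ofReal Real.pi ^ n * ∫⁻ μ in {μ | Interlaces μ l}, g μ := by
  have hm : Measurable (Function.uncurry fun (l : Fin (n + 1) → ℝ) (μ : Fin n → ℝ) =>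
      {p : (Fin n → ℝ) × (Fin (n + 1) → ℝ) | Interlaces p.1 p.2}.indicator
        (fun _ => ENNReal.ofReal Real.pi ^ n) (μ, l)) :=
    (measurable_const.indicator (measurableSet_interlaces_prod n)).comp measurable_swap
  rw [interlacingKernel, Kernel.lintegral_withDensity _ hm _ hg, Kernel.const_apply,
    ← lintegral_const_mul _ hg, ← lintegral_indicator (measurableSet_interlaces_left l)]
  refine lintegral_congr fun μ => ?_
  by_cases h : Interlaces μ l <;> simp [Set.indicator, h]

/-- The Gelfand–Tsetlin kernel. Up to its mass, `gtKernel n l` is the law of the diagonal of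
`U diag(l) U*` for a Haar distributed unitary `U`, obtained by summing over the eigenvalues of the
leading principal blocks. -/
noncomputable def gtKernel : (n : ℕ) → Kernel (Fin n → ℝ) (Fin n → ℝ)
  | 0 => Kernel.id
  | n + 1 => (Kernel.id ×ₖ (interlacingKernel n ⊗ₖ Kernel.prodMkLeft _ (gtKernel n))).map
      fun p => Fin.snoc p.2.2 (∑ k, p.1 k - ∑ j, p.2.1 j)

instance gtKernel.instIsSFiniteKernel (n : ℕ) : IsSFiniteKernel (gtKernel n) := by
  induction n with
  | zero => rw [gtKernel]; infer_instance
  | succ n ih => rw [gtKernel]; infer_instance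

lemma measurable_fin_snoc (n : ℕ) :
    Measurable fun p : (Fin n → ℝ) × ℝ => (Fin.snoc p.1 p.2 : Fin (n + 1) → ℝ) := by
  refine measurable_pi_lambda _ fun i => ?_
  refine Fin.lastCases ?_ (fun j => ?_) i
  · simpa using measurable_snd
  · simp only [Fin.snoc_castSucc]
    fun_prop

lemma lintegral_gtKernel_succ {n : ℕ} (l : Fin (n + 1) → ℝ) {h : (Fin (n + 1) → ℝ) → ENNReal}
    (hh : Measurable h) :
    ∫⁻ d, h d ∂(gtKernel (n + 1) l) = ENNReal.ofReal Real.pi ^ n *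
      ∫⁻ μ in {μ | Interlaces μ l},
        ∫⁻ d, h (Fin.snoc d (∑ k, l k - ∑ j, μ j)) ∂(gtKernel n μ) := by
  have hm : Measurable fun p : (Fin (n + 1) → ℝ) × (Fin n → ℝ) × (Fin n → ℝ) =>
      (Fin.snoc p.2.2 (∑ k, p.1 k - ∑ j, p.2.1 j) : Fin (n + 1) → ℝ) :=
    (measurable_fin_snoc n).comp (by fun_prop : Measurable
      fun p : (Fin (n + 1) → ℝ) × (Fin n → ℝ) × (Fin n → ℝ) =>
        (p.2.2, ∑ k, p.1 k - ∑ j, p.2.1 j))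
  have hm' : Measurable fun p : (Fin n → ℝ) × (Fin n → ℝ) =>
      h (Fin.snoc p.2 (∑ k, l k - ∑ j, p.1 j)) :=
    hh.comp (hm.comp measurable_prodMk_left)
  have hhm : Measurable fun p : (Fin (n + 1) → ℝ) × (Fin n → ℝ) × (Fin n → ℝ) =>
      h (Fin.snoc p.2.2 (∑ k, p.1 k - ∑ j, p.2.1 j)) := hh.comp hm
  rw [gtKernel, Kernel.lintegral_map _ hm _ hh, Kernel.lintegral_prod _ _ _ hhm,
    Kernel.id_apply, lintegral_dirac' _ (Measurable.lintegral_prod_right' hhm),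
    Kernel.lintegral_compProd _ _ _ hm']
  simp only [Kernel.prodMkLeft_apply]
  exact lintegral_interlacingKernel l (Measurable.lintegral_kernel_prod_right' hm')

/-- The diagonal of a Hermitian matrix. -/
noncomputable def Herm.diag {n : ℕ} (A : Herm n) (j : Fin n) : ℝ :=
  ((A : Matrix (Fin n) (Fin n) ℂ) j j).re

lemma Herm.continuous_diag (n : ℕ) : Continuous (Herm.diag : Herm n → Fin n → ℝ) :=
  continuous_pi fun j => Complex.continuous_re.comp (Herm.continuous_apply j j)

lemma diag_borderedHerm {n : ℕ} (B : Herm n) (z : Fin n → ℂ) (a : ℝ) :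
    (borderedHerm B z a).diag = Fin.snoc B.diag a := by
  funext i
  refine Fin.lastCases ?_ (fun i => ?_) i <;> simp [Herm.diag]

/-- Weyl's integration formula, refined by the law of the diagonal: unitarily invariant functions
of a Hermitian matrix times functions of its diagonal. -/
theorem lintegral_invariant_mul_diag (n : ℕ) {f : Herm n → ENNReal} (hf : Measurable f)
    (hinv : ∀ U A, f (conjHerm U A) = f A) {h : (Fin n → ℝ) → ENNReal} (hh : Measurable h) :
    ∫⁻ A, f A * h A.diag ∂(lebHerm n) =
      ∫⁻ l in weylChamber n, ENNReal.ofReal (vdm l) * f (diagHerm l) *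
        ∫⁻ d, h d ∂(gtKernel n l) := by
  induction n with
  | zero =>
    have hm : Measurable fun A : Herm 0 => f A * h A.diag :=
      hf.mul (hh.comp (Herm.continuous_diag 0).measurable)
    have hU : weylChamber 0 = Set.univ := Set.eq_univ_of_forall fun x i => i.elim0
    rw [← (measurePreserving_hermEquiv 0).lintegral_comp hm, hU, Measure.restrict_univ]
    change ∫⁻ p, _ ∂(Measure.prod volume volume) = _
    have hm' : Measurable fun p => f (hermEquiv 0 p) * h (hermEquiv 0 p).diag :=
      hm.comp (hermEquiv 0).continuous.measurable
    rw [lintegral_prod _ hm'.aemeasurable]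
    refine lintegral_congr fun d => ?_
    rw [gtKernel, Kernel.id_apply, lintegral_dirac' _ hh]
    have : IsEmpty {q : Fin 0 × Fin 0 // q.1 < q.2} := ⟨fun q => q.1.1.elim0⟩
    rw [lintegral_unique, volume_pi, Measure.pi_of_empty _ isEmptyElim,
      Measure.dirac_apply_of_mem (Set.mem_univ _),
      mul_one]
    have h1 : ∀ o, hermEquiv 0 (d, o) = diagHerm d := fun o => Subtype.ext (Subsingleton.elim _ _)
    rw [h1, Subsingleton.elim (diagHerm d).diag d, show vdm d = 1 by simp [vdm],
      ENNReal.ofReal_one, one_mul]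
  | succ n ih =>
    set C := ENNReal.ofReal Real.pi ^ n with hC
    have hm : Measurable fun A : Herm (n + 1) => f A * h A.diag :=
      hf.mul (hh.comp (Herm.continuous_diag _).measurable)
    have hfb : Measurable fun p : (Herm n × ℝ) × (Fin n → ℂ) =>
        f (borderedHerm p.1.1 p.2 p.1.2) := by
      refine hf.comp (Continuous.measurable ?_)
      exact (continuous_borderedHerm n).comp (f := fun p : (Herm n × ℝ) × (Fin n → ℂ) =>
        (p.1.1, p.2, p.1.2)) (by fun_prop)
    have hfz : ∀ B a, Measurable fun z : Fin n → ℂ => f (borderedHerm B z a) := fun B a =>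
      hfb.comp (measurable_prodMk_left (x := (B, a)))
    have hF : Measurable fun p : Herm n × ℝ => ∫⁻ z : Fin n → ℂ, f (borderedHerm p.1 z p.2) :=
      Measurable.lintegral_prod_right' hfb
    have hhs : Measurable fun p : ((Fin n → ℝ) × ℝ) × (Fin n → ℝ) =>
        h (Fin.snoc p.2 p.1.2) :=
      hh.comp ((measurable_fin_snoc n).comp (by fun_prop : Measurable
        fun p : ((Fin n → ℝ) × ℝ) × (Fin n → ℝ) => (p.2, p.1.2)))
    have hg : Measurable fun p : (Fin n → ℝ) × ℝ =>
        ∫⁻ d, h (Fin.snoc d p.2) ∂(gtKernel n p.1) :=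
      Measurable.lintegral_kernel_prod_right' (κ := (gtKernel n).comap Prod.fst measurable_fst) hhs
    rw [lintegral_lebHerm_succ _ hm]
    have step1 : ∀ a : ℝ, ∫⁻ B, (∫⁻ z : Fin n → ℂ, f (borderedHerm B z a) *
        h (borderedHerm B z a).diag) ∂(lebHerm n) =
        ∫⁻ μ in weylChamber n, ENNReal.ofReal (vdm μ) *
          (∫⁻ z : Fin n → ℂ, f (borderedHerm (diagHerm μ) z a)) *
            ∫⁻ d, h (Fin.snoc d a) ∂(gtKernel n μ) := by
      intro a
      rw [← ih (f := fun B => ∫⁻ z : Fin n → ℂ, f (borderedHerm B z a))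
        (hF.comp measurable_prodMk_right) ?_ (h := fun d => h (Fin.snoc d a))
        (hh.comp ((measurable_fin_snoc n).comp measurable_prodMk_right))]
      · refine lintegral_congr fun B => ?_
        rw [← diag_borderedHerm B 0 a, ← lintegral_mul_const _ (hfz B a)]
        refine lintegral_congr fun z => ?_
        rw [diag_borderedHerm, diag_borderedHerm]
      · intro U B
        rw [← (measurePreserving_unitary_mulVec U).lintegral_comp
          (hfz (conjHerm U B) a)]
        refine lintegral_congr fun z => ?_
        rw [← conjHerm_extendUnitary, hinv]
    rw [lintegral_congr step1]
    have hdm : Measurable (diagHerm : (Fin n → ℝ) → Herm n) := (continuous_diagHerm n).measurable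
    have hdm' : Measurable (diagHerm : (Fin (n + 1) → ℝ) → Herm (n + 1)) :=
      (continuous_diagHerm _).measurable
    have hFd : Measurable fun p : ℝ × (Fin n → ℝ) =>
        ∫⁻ z : Fin n → ℂ, f (borderedHerm (diagHerm p.2) z p.1) :=
      hF.comp ((hdm.comp measurable_snd).prodMk measurable_fst)
    have hvm : ∀ m, Measurable fun x : Fin m → ℝ => ENNReal.ofReal (vdm x) := fun m =>
      (continuous_vdm m).measurable.ennreal_ofReal
    rw [lintegral_lintegral_swap (by
      exact ((((hvm n).comp measurable_snd).mul hFd).mul (hg.comp measurable_swap)).aemeasurable)]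
    have step2 : ∀ μ ∈ weylChamber n, ∫⁻ a : ℝ, ENNReal.ofReal (vdm μ) *
          (∫⁻ z : Fin n → ℂ, f (borderedHerm (diagHerm μ) z a)) *
            ∫⁻ d, h (Fin.snoc d a) ∂(gtKernel n μ) =
        ∫⁻ l, {p : (Fin n → ℝ) × (Fin (n + 1) → ℝ) | Interlaces p.1 p.2}.indicator
          (fun p => ENNReal.ofReal (vdm p.2) * f (diagHerm p.2) *
            (C * ∫⁻ d, h (Fin.snoc d (∑ k, p.2 k - ∑ j, p.1 j)) ∂(gtKernel n p.1))) (μ, l) := by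
      intro μ hμ
      have hgμ : Measurable fun a : ℝ => ∫⁻ d, h (Fin.snoc d a) ∂(gtKernel n μ) :=
        hg.comp measurable_prodMk_left
      have hFμ : Measurable fun a : ℝ => ∫⁻ z : Fin n → ℂ, f (borderedHerm (diagHerm μ) z a) :=
        hFd.comp measurable_prodMk_right
      have hFgμ : Measurable fun a : ℝ =>
          (∫⁻ z : Fin n → ℂ, f (borderedHerm (diagHerm μ) z a)) *
            ∫⁻ d, h (Fin.snoc d a) ∂(gtKernel n μ) := hFμ.mul hgμ
      rw [lintegral_congr fun a => mul_assoc _ _ _, lintegral_const_mul _ hFgμ,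
        lintegral_borderedHerm_diag hf hinv hgμ hμ, ← hC, ← mul_assoc]
      have hmm : Measurable fun l : Fin (n + 1) → ℝ => ENNReal.ofReal (vdm l / vdm μ) *
          (f (diagHerm l) * ∫⁻ d, h (Fin.snoc d (∑ k, l k - ∑ j, μ j)) ∂(gtKernel n μ)) := by
        refine (((continuous_vdm _).measurable.div_const _).ennreal_ofReal).mul
          ((hf.comp hdm').mul (hgμ.comp ?_))
        fun_prop
      rw [← lintegral_const_mul _ hmm, ← lintegral_indicator (measurableSet_interlaces_right μ)]
      refine lintegral_congr fun l => ?_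
      by_cases hI : Interlaces μ l
      · simp only [Set.indicator, Set.mem_ofPred_eq, hI, if_true]
        rw [show ENNReal.ofReal (vdm l) = ENNReal.ofReal (vdm μ) * ENNReal.ofReal (vdm l / vdm μ) by
          rw [← ENNReal.ofReal_mul (vdm_pos hμ).le, mul_div_cancel₀ _ (vdm_pos hμ).ne']]
        ring
      · simp [Set.indicator, hI]
    rw [setLIntegral_congr_fun (measurableSet_weylChamber n) step2]
    have hbig : Measurable fun p : (Fin n → ℝ) × (Fin (n + 1) → ℝ) =>
        {p : (Fin n → ℝ) × (Fin (n + 1) → ℝ) | Interlaces p.1 p.2}.indicator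
          (fun p => ENNReal.ofReal (vdm p.2) * f (diagHerm p.2) *
            (C * ∫⁻ d, h (Fin.snoc d (∑ k, p.2 k - ∑ j, p.1 j)) ∂(gtKernel n p.1))) p := by
      refine Measurable.indicator ?_ (measurableSet_interlaces_prod n)
      refine (((hvm _).comp measurable_snd).mul (hf.comp (hdm'.comp measurable_snd))).mul ?_
      refine measurable_const.mul (hg.comp (g := fun p : (Fin n → ℝ) × ℝ =>
        ∫⁻ d, h (Fin.snoc d p.2) ∂(gtKernel n p.1))
        (f := fun p : (Fin n → ℝ) × (Fin (n + 1) → ℝ) => (p.1, ∑ k, p.2 k - ∑ j, p.1 j)) ?_)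
      fun_prop
    rw [lintegral_lintegral_swap (by exact hbig.aemeasurable),
      ← lintegral_indicator (measurableSet_weylChamber (n + 1))]
    refine lintegral_congr fun l => ?_
    by_cases hl : l ∈ weylChamber (n + 1)
    · rw [Set.indicator_of_mem hl, lintegral_gtKernel_succ l hh, ← hC]
      have hgl : Measurable fun μ : Fin n → ℝ =>
          ∫⁻ d, h (Fin.snoc d (∑ k, l k - ∑ j, μ j)) ∂(gtKernel n μ) :=
        hg.comp (by fun_prop : Measurable fun μ : Fin n → ℝ => (μ, ∑ k, l k - ∑ j, μ j))
      rw [← lintegral_const_mul _ hgl, ← lintegral_const_mul _ (hgl.const_mul _),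
        ← lintegral_indicator (measurableSet_weylChamber n),
        ← lintegral_indicator (measurableSet_interlaces_left l)]
      refine lintegral_congr fun μ => ?_
      by_cases hI : Interlaces μ l
      · have hμ : μ ∈ weylChamber n := hI.strictMono_left
        simp [Set.indicator, hI, hμ]
      · simp [Set.indicator, hI]
    · rw [Set.indicator_of_notMem hl]
      rw [← lintegral_zero (μ := volume.restrict (weylChamber n))]
      refine lintegral_congr fun μ => ?_
      have hI : ¬ Interlaces μ l := fun hI => hl hI.strictMono
      simp [Set.indicator, hI]

/-! ### Mass and Fourier transform of the Gelfand–Tsetlin kernel -/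

lemma interlaces_eq_pi {n : ℕ} (l : Fin (n + 1) → ℝ) :
    {μ : Fin n → ℝ | Interlaces μ l} =
      Set.univ.pi fun k : Fin n => Set.Ioo (l k.castSucc) (l k.succ) := by
  ext μ
  simp [Interlaces]

lemma gtKernel_succ_univ {n : ℕ} (l : Fin (n + 1) → ℝ) :
    gtKernel (n + 1) l Set.univ = ENNReal.ofReal Real.pi ^ n *
      ∫⁻ μ in {μ | Interlaces μ l}, gtKernel n μ Set.univ := by
  have h := lintegral_gtKernel_succ l (h := fun _ => 1) measurable_const
  simpa using h

lemma exists_gtKernel_univ_le (n : ℕ) (R : ℝ) :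
    ∃ M : ENNReal, M ≠ ⊤ ∧ ∀ l : Fin n → ℝ, (∀ j, |l j| ≤ R) → gtKernel n l Set.univ ≤ M := by
  induction n with
  | zero =>
    refine ⟨1, ENNReal.one_ne_top, fun l _ => ?_⟩
    rw [gtKernel, Kernel.id_apply, measure_univ]
  | succ n ih =>
    obtain ⟨M, hM, h⟩ := ih
    refine ⟨ENNReal.ofReal Real.pi ^ n * (M * ENNReal.ofReal (2 * R) ^ n), by finiteness,
      fun l hl => ?_⟩
    rw [gtKernel_succ_univ]
    gcongr
    have hb : ∀ μ : Fin n → ℝ, Interlaces μ l → ∀ j, |μ j| ≤ R := fun μ hI j =>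
      abs_le.2 ⟨(abs_le.1 (hl _)).1.trans (hI j).1.le, (hI j).2.le.trans (abs_le.1 (hl _)).2⟩
    calc ∫⁻ μ in {μ | Interlaces μ l}, gtKernel n μ Set.univ
        ≤ ∫⁻ μ in {μ | Interlaces μ l}, M :=
          setLIntegral_mono measurable_const fun μ hI => h μ (hb μ hI)
      _ = M * volume {μ : Fin n → ℝ | Interlaces μ l} := by rw [setLIntegral_const]
      _ ≤ M * ENNReal.ofReal (2 * R) ^ n := by
          gcongr
          rw [interlaces_eq_pi, volume_pi_pi]
          calc ∏ k : Fin n, volume (Set.Ioo (l k.castSucc) (l k.succ))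
              ≤ ∏ _k : Fin n, ENNReal.ofReal (2 * R) := by
                refine Finset.prod_le_prod' fun k _ => ?_
                rw [Real.volume_Ioo]
                refine ENNReal.ofReal_le_ofReal ?_
                linarith [(abs_le.1 (hl k.succ)).2, (abs_le.1 (hl k.castSucc)).1]
            _ = ENNReal.ofReal (2 * R) ^ n := by simp

instance gtKernel.instIsFiniteMeasure (n : ℕ) (l : Fin n → ℝ) : IsFiniteMeasure (gtKernel n l) := by
  obtain ⟨M, hM, h⟩ := exists_gtKernel_univ_le n (∑ j, |l j|)
  exact ⟨(h l fun j => Finset.single_le_sum (f := fun j => |l j|) (fun _ _ => abs_nonneg _)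
    (Finset.mem_univ j)).trans_lt hM.lt_top⟩

lemma gtKernel_univ_ne_zero {n : ℕ} {l : Fin n → ℝ} (hl : StrictMono l) :
    gtKernel n l Set.univ ≠ 0 := by
  induction n with
  | zero => rw [gtKernel, Kernel.id_apply, measure_univ]; exact one_ne_zero
  | succ n ih =>
    rw [gtKernel_succ_univ]
    refine mul_ne_zero (pow_ne_zero _ (by simpa using Real.pi_pos)) fun h0 => ?_
    rw [lintegral_eq_zero_iff ((gtKernel n).measurable_coe MeasurableSet.univ),
      Filter.EventuallyEq, ae_restrict_iff' (measurableSet_interlaces_left l)] at h0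
    have hnull : volume {μ : Fin n → ℝ | Interlaces μ l} = 0 := by
      have h0' := ae_iff.1 h0
      refine measure_mono_null (fun μ hI => ?_) h0'
      exact fun hμ => ih (Interlaces.strictMono_left hI) (hμ hI)
    rw [interlaces_eq_pi, volume_pi_pi] at hnull
    obtain ⟨k, -, hk⟩ := Finset.prod_eq_zero_iff.1 hnull
    rw [Real.volume_Ioo, ENNReal.ofReal_eq_zero, sub_nonpos] at hk
    exact hk.not_gt (hl (Fin.castSucc_lt_succ))

lemma gtKernel_succ_eq_map {n : ℕ} (l : Fin (n + 1) → ℝ) :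
    gtKernel (n + 1) l = Measure.map
      (fun p : (Fin n → ℝ) × (Fin n → ℝ) =>
        (Fin.snoc p.2 (∑ k, l k - ∑ j, p.1 j) : Fin (n + 1) → ℝ))
      ((ENNReal.ofReal Real.pi ^ n • volume.restrict {μ | Interlaces μ l}) ⊗ₘ gtKernel n) := by
  have hm : Measurable fun p : (Fin n → ℝ) × (Fin n → ℝ) =>
      (Fin.snoc p.2 (∑ k, l k - ∑ j, p.1 j) : Fin (n + 1) → ℝ) :=
    (measurable_fin_snoc n).comp (by fun_prop : Measurable
      fun p : (Fin n → ℝ) × (Fin n → ℝ) => (p.2, ∑ k, l k - ∑ j, p.1 j))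
  have : SFinite (ENNReal.ofReal Real.pi ^ n • volume.restrict {μ : Fin n → ℝ | Interlaces μ l}) :=
    inferInstance
  refine Measure.ext_of_lintegral _ fun g hg => ?_
  have hgm : Measurable fun p : (Fin n → ℝ) × (Fin n → ℝ) =>
      g (Fin.snoc p.2 (∑ k, l k - ∑ j, p.1 j)) := hg.comp hm
  rw [lintegral_map hg hm, Measure.lintegral_compProd hgm, lintegral_smul_measure,
    lintegral_gtKernel_succ l hg]
  rfl

lemma integral_det_pi {n : ℕ} (ν : Fin n → Measure ℝ) [∀ k, SigmaFinite (ν k)]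
    (F : Fin n → ℝ → ℂ) (hF : ∀ j k, Integrable (F j) (ν k)) :
    ∫ x : Fin n → ℝ, Matrix.det (Matrix.of fun j k => F j (x k)) ∂(Measure.pi ν) =
      Matrix.det (Matrix.of fun j k => ∫ t, F j t ∂(ν k)) := by
  simp only [Matrix.det_apply', Matrix.of_apply]
  rw [integral_finsetSum]
  · refine Finset.sum_congr rfl fun σ _ => ?_
    rw [← integral_fintype_prod_eq_prod (fun i => F (σ i)), ← integral_const_mul]
  · intro σ _
    exact (Integrable.fintype_prod (f := fun i => F (σ i)) fun i => hF (σ i) i).const_mul _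

/-- A determinant with a row of ones as a determinant of differences of columns. -/
lemma det_snoc_one {n : ℕ} (a : Fin n → Fin (n + 1) → ℂ) :
    Matrix.det (Matrix.of (Fin.snoc a (fun _ => 1) : Fin (n + 1) → Fin (n + 1) → ℂ)) =
      (-1) ^ n * Matrix.det (Matrix.of fun j k => a j (Fin.succ k) - a j (Fin.castSucc k)) := by
  set A : Matrix (Fin (n + 1)) (Fin (n + 1)) ℂ :=
    Matrix.of (Fin.snoc a (fun _ => 1) : Fin (n + 1) → Fin (n + 1) → ℂ) with hA
  set B : Matrix (Fin (n + 1)) (Fin (n + 1)) ℂ :=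
    Matrix.of fun i => Fin.cons (A i 0) fun k => A i k.succ - A i k.castSucc with hB
  have h1 : A.det = B.det :=
    Matrix.det_eq_of_forall_col_eq_smul_add_pred (fun _ => 1) (by simp [hB]) (by simp [hB])
  rw [h1, Matrix.det_succ_row _ (Fin.last n), Finset.sum_eq_single 0]
  · have h2 : B (Fin.last n) 0 = 1 := by simp [hB, hA]
    rw [h2, Fin.val_last, Fin.val_zero, add_zero, mul_one]
    congr 2
    ext j k
    simp [hB, hA]
  · intro k _ hk
    obtain ⟨k, rfl⟩ := Fin.exists_succ_eq.2 hk
    simp [hB, hA]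
  · simp

lemma vdm_succ {n : ℕ} (s : Fin (n + 1) → ℝ) :
    vdm s = vdm (fun j : Fin n => s j.castSucc) * ∏ j : Fin n, (s (Fin.last n) - s j.castSucc) := by
  have h : ∀ {m : ℕ} (x : Fin m → ℝ), vdm x = ∏ j, ∏ k, if j < k then x k - x j else 1 := by
    intro m x
    refine Finset.prod_congr rfl fun j _ => ?_
    rw [← Finset.prod_filter]
    congr 1
    ext k
    simp
  rw [h, h, Fin.prod_univ_castSucc]
  simp only [Fin.prod_univ_castSucc (n := n), Fin.castSucc_lt_castSucc_iff, Fin.castSucc_lt_last,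
    if_true, lt_irrefl, if_false, mul_one, Finset.prod_mul_distrib]
  rw [Finset.prod_eq_one (s := Finset.univ) (f := fun i : Fin n =>
    if Fin.last n < i.castSucc then s i.castSucc - s (Fin.last n) else 1), mul_one]
  intro i _
  rw [if_neg (Fin.castSucc_lt_last i).not_gt]

lemma piI_succ (n : ℕ) : piI (n + 1) = piI n * ((Real.pi : ℂ) * Complex.I) ^ n := by
  rw [piI, piI, Nat.triangle_succ, pow_add]

lemma integral_Ioo_cexp {c : ℝ} (hc : c ≠ 0) {a b : ℝ} (hab : a ≤ b) :
    ∫ x in Set.Ioo a b, Complex.exp (-Complex.I * c * x) =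
      (Complex.I * -c)⁻¹ *
        (Complex.exp (-Complex.I * c * b) - Complex.exp (-Complex.I * c * a)) := by
  have hc' : -Complex.I * c ≠ 0 := by simp [hc]
  rw [← integral_Ioc_eq_integral_Ioo, ← intervalIntegral.integral_of_le hab,
    integral_exp_mul_complex hc', div_eq_inv_mul]
  congr 2
  ring

lemma expDet_neg_eq {n : ℕ} (s x : Fin n → ℝ) :
    expDet (-s) x = Matrix.det (Matrix.of fun j k => Complex.exp (-Complex.I * s j * x k)) := by
  rw [expDet]
  congr 2
  ext j k
  simp

/-- The Harish-Chandra–Itzykson–Zuber formula, as a Fourier transform of the Gelfand–Tsetlin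
kernel. -/
theorem integral_cexp_gtKernel {n : ℕ} {s : Fin n → ℝ} (hs : Function.Injective s)
    {l : Fin n → ℝ} (hl : StrictMono l) :
    ∫ d, Complex.exp (-Complex.I * ∑ j, (s j : ℂ) * d j) ∂(gtKernel n l) =
      piI n / vdm s * expDet (-s) l := by
  induction n with
  | zero =>
    rw [gtKernel, Kernel.id_apply, integral_dirac]
    simp [piI, vdm, expDet]
  | succ n ih =>
    set c : Fin n → ℝ := fun j => s j.castSucc - s (Fin.last n) with hc
    have hc0 : ∀ j, c j ≠ 0 := fun j => sub_ne_zero.2 fun h =>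
      (Fin.castSucc_lt_last j).ne (hs h)
    set ν : Measure (Fin n → ℝ) :=
      ENNReal.ofReal Real.pi ^ n • volume.restrict {μ | Interlaces μ l} with hν
    have hm : Measurable fun p : (Fin n → ℝ) × (Fin n → ℝ) =>
        (Fin.snoc p.2 (∑ k, l k - ∑ j, p.1 j) : Fin (n + 1) → ℝ) :=
      (measurable_fin_snoc n).comp (by fun_prop : Measurable
        fun p : (Fin n → ℝ) × (Fin n → ℝ) => (p.2, ∑ k, l k - ∑ j, p.1 j))
    have hfin : IsFiniteMeasure (ν ⊗ₘ gtKernel n) := by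
      constructor
      have h1 := measure_lt_top (gtKernel (n + 1) l) Set.univ
      rwa [gtKernel_succ_eq_map, Measure.map_apply hm MeasurableSet.univ, Set.preimage_univ] at h1
    have hcm : Continuous fun d : Fin (n + 1) → ℝ =>
        Complex.exp (-Complex.I * ∑ j, (s j : ℂ) * d j) := by fun_prop
    have hbd : ∀ {m : ℕ} (x d : Fin m → ℝ), ‖Complex.exp (-Complex.I * ∑ j, (x j : ℂ) * d j)‖ ≤ 1 :=
      fun x d => by
        rw [show -Complex.I * ∑ j, (x j : ℂ) * d j = ((-∑ j, x j * d j : ℝ) : ℂ) * Complex.I by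
          push_cast; ring, Complex.norm_exp_ofReal_mul_I]
    rw [gtKernel_succ_eq_map, integral_map hm.aemeasurable hcm.aestronglyMeasurable,
      Measure.integral_compProd]
    swap
    · exact Integrable.of_bound (hcm.measurable.comp hm).aestronglyMeasurable 1
        (Eventually.of_forall fun p => hbd _ _)
    have hinner : ∀ μ ∈ {μ : Fin n → ℝ | Interlaces μ l},
        ∫ d, Complex.exp (-Complex.I * ∑ j, (s j : ℂ) *
          (Fin.snoc d (∑ k, l k - ∑ j, μ j) : Fin (n + 1) → ℝ) j) ∂(gtKernel n μ) =
        Complex.exp (-Complex.I * s (Fin.last n) * ∑ k, (l k : ℂ)) *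
          (piI n / vdm (fun j : Fin n => s j.castSucc)) *
            Matrix.det (Matrix.of fun j k => Complex.exp (-Complex.I * c j * μ k)) := by
      intro μ hμ
      have h1 : ∀ d : Fin n → ℝ, Complex.exp (-Complex.I * ∑ j, (s j : ℂ) *
          (Fin.snoc d (∑ k, l k - ∑ j, μ j) : Fin (n + 1) → ℝ) j) =
          Complex.exp (-Complex.I * s (Fin.last n) * ∑ k, (l k : ℂ)) *
            Complex.exp (Complex.I * s (Fin.last n) * ∑ k, (μ k : ℂ)) *
              Complex.exp (-Complex.I * ∑ j : Fin n, (s j.castSucc : ℂ) * d j) := by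
        intro d
        rw [← Complex.exp_add, ← Complex.exp_add, Fin.sum_univ_castSucc]
        simp only [Fin.snoc_castSucc, Fin.snoc_last]
        push_cast
        ring_nf
      simp_rw [h1]
      rw [integral_const_mul, ih (s := fun j : Fin n => s j.castSucc)
        (hs.comp (Fin.castSucc_injective n)) hμ.strictMono_left, expDet_neg_eq]
      have h2 : Matrix.det (Matrix.of fun j k => Complex.exp (-Complex.I * c j * μ k)) =
          Complex.exp (Complex.I * s (Fin.last n) * ∑ k, (μ k : ℂ)) *
            Matrix.det (Matrix.of fun j k : Fin n =>
              Complex.exp (-Complex.I * (s j.castSucc : ℂ) * μ k)) := by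
        rw [Finset.mul_sum, Complex.exp_sum, ← Matrix.det_mul_row]
        congr 1
        ext j k
        simp only [Matrix.of_apply, hc]
        rw [← Complex.exp_add]
        push_cast
        ring_nf
      rw [h2]
      ring
    rw [integral_smul_measure, setIntegral_congr_fun (measurableSet_interlaces_left l) hinner,
      integral_const_mul, interlaces_eq_pi, volume_pi, Measure.restrict_pi_pi,
      integral_det_pi _ fun j t => Complex.exp (-Complex.I * c j * t)]
    · have h3 : (Matrix.of fun j k : Fin n => ∫ t in Set.Ioo (l k.castSucc) (l k.succ),
          Complex.exp (-Complex.I * c j * t)) = Matrix.of fun j k => (Complex.I * -c j)⁻¹ *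
            (Matrix.of fun j k : Fin n => Complex.exp (-Complex.I * c j * l k.succ) -
              Complex.exp (-Complex.I * c j * l k.castSucc)) j k := by
        ext j k
        exact integral_Ioo_cexp (hc0 j) (hl Fin.castSucc_lt_succ).le
      have h4 := det_snoc_one fun j k => Complex.exp (-Complex.I * c j * l k)
      have h5 : expDet (-s) l = Complex.exp (-Complex.I * s (Fin.last n) * ∑ k, (l k : ℂ)) *
          Matrix.det (Matrix.of (Fin.snoc (fun j k => Complex.exp (-Complex.I * c j * l k))
            (fun _ => 1) : Fin (n + 1) → Fin (n + 1) → ℂ)) := by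
        rw [expDet_neg_eq, Finset.mul_sum, Complex.exp_sum, ← Matrix.det_mul_row]
        congr 1
        ext j k
        simp only [Matrix.of_apply]
        refine Fin.lastCases ?_ (fun j => ?_) j
        · simp
        · simp only [Fin.snoc_castSucc, hc]
          rw [← Complex.exp_add]
          push_cast
          ring_nf
      rw [h3, Matrix.det_mul_column, h5, h4, piI_succ, vdm_succ, Finset.prod_inv_distrib,
        Finset.prod_mul_distrib, Finset.prod_const, Finset.card_univ, Fintype.card_fin]
      have h6 : ((∏ j : Fin n, (s (Fin.last n) - s j.castSucc) : ℝ) : ℂ) = ∏ j, -(c j : ℂ) := by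
        push_cast
        exact Finset.prod_congr rfl fun j _ => by simp [hc]
      have h7 : (Complex.I ^ n)⁻¹ = Complex.I ^ n * (-1) ^ n := by
        rw [← inv_pow, Complex.inv_I, ← mul_pow, mul_neg_one]
      rw [Complex.ofReal_mul, h6, ENNReal.toReal_pow, ENNReal.toReal_ofReal Real.pi_pos.le,
        Complex.real_smul, mul_inv, h7, mul_pow]
      push_cast
      field_simp
    · intro j k
      have : IsFiniteMeasure (volume.restrict (Set.Ioo (l k.castSucc) (l k.succ))) := inferInstance
      refine Integrable.of_bound (by fun_prop) 1 (Eventually.of_forall fun t => ?_)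
      rw [show -Complex.I * c j * t = ((-(c j * t) : ℝ) : ℂ) * Complex.I by
          push_cast; ring, Complex.norm_exp_ofReal_mul_I]

/-! ### Symmetric functions and the Weyl chamber -/

lemma ae_injective (n : ℕ) : ∀ᵐ x : Fin n → ℝ, Function.Injective x := by
  have h : ∀ i j : Fin n, i ≠ j → ∀ᵐ x : Fin n → ℝ, x i ≠ x j := by
    intro i j hij
    have h1 := Measure.addHaar_submodule (volume : Measure (Fin n → ℝ))
      (LinearMap.ker (LinearMap.proj (R := ℝ) (φ := fun _ : Fin n => ℝ) i - LinearMap.proj j)) ?_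
    · refine measure_mono_null (fun x hx => ?_) h1
      have hx' : x i = x j := not_not.1 hx
      simp [hx']
    · intro htop
      have h2 : (Pi.single i 1 : Fin n → ℝ) ∈ LinearMap.ker
          (LinearMap.proj (R := ℝ) (φ := fun _ : Fin n => ℝ) i - LinearMap.proj j) :=
        htop ▸ Submodule.mem_top
      simp [Pi.single_eq_of_ne hij.symm] at h2
  have h' : ∀ᵐ x : Fin n → ℝ, ∀ i j, i ≠ j → x i ≠ x j := by
    simp only [eventually_all]
    exact h
  filter_upwards [h'] with x hx i j hij
  by_contra hne
  exact hx i j hne hij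

lemma comp_perm_eq_piCongrLeft {n : ℕ} (σ : Equiv.Perm (Fin n)) :
    (fun x : Fin n → ℝ => x ∘ σ) = MeasurableEquiv.piCongrLeft (fun _ : Fin n => ℝ) σ.symm := by
  funext x i
  obtain ⟨j, rfl⟩ := σ.symm.surjective i
  rw [MeasurableEquiv.piCongrLeft_apply_apply]
  simp

lemma measurePreserving_comp_perm {n : ℕ} (σ : Equiv.Perm (Fin n)) :
    MeasurePreserving (fun x : Fin n → ℝ => x ∘ σ) := by
  rw [comp_perm_eq_piCongrLeft]
  exact volume_measurePreserving_piCongrLeft (fun _ : Fin n => ℝ) σ.symm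

lemma measurableEmbedding_comp_perm {n : ℕ} (σ : Equiv.Perm (Fin n)) :
    MeasurableEmbedding (fun x : Fin n → ℝ => x ∘ σ) := by
  rw [comp_perm_eq_piCongrLeft]
  exact MeasurableEquiv.measurableEmbedding _

lemma exists_perm_mem_weylChamber {n : ℕ} {x : Fin n → ℝ} (hx : Function.Injective x) :
    ∃ σ : Equiv.Perm (Fin n), x ∘ σ ∈ weylChamber n :=
  ⟨Tuple.sort x, (Tuple.monotone_sort x).strictMono_of_injective
    (hx.comp (Tuple.sort x).injective)⟩

lemma perm_eq_of_mem_weylChamber {n : ℕ} {x : Fin n → ℝ} {σ τ : Equiv.Perm (Fin n)}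
    (hσ : x ∘ σ ∈ weylChamber n) (hτ : x ∘ τ ∈ weylChamber n) : σ = τ := by
  have h : x ∘ σ = x ∘ τ := (StrictMono.range_inj hσ hτ).1 (by
    rw [Set.range_comp, Set.range_comp, σ.surjective.range_eq, τ.surjective.range_eq])
  have hx : Function.Injective x := by
    have : x = (x ∘ σ) ∘ σ.symm := by ext i; simp
    rw [this]
    exact (StrictMono.injective hσ).comp σ.symm.injective
  exact Equiv.ext fun i => hx (congrFun h i)

/-- The integral of a symmetric function is `n!` times its integral over the Weyl chamber. -/
lemma integral_eq_factorial_mul {n : ℕ} {g : (Fin n → ℝ) → ℂ}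
    (hg : ∀ (σ : Equiv.Perm (Fin n)) x, g (x ∘ σ) = g x) (hi : IntegrableOn g (weylChamber n)) :
    Integrable g ∧ ∫ x, g x = n.factorial * ∫ x in weylChamber n, g x := by
  set S : Equiv.Perm (Fin n) → Set (Fin n → ℝ) := fun σ => (fun x => x ∘ σ) ⁻¹' weylChamber n
    with hS
  have hSm : ∀ σ, MeasurableSet (S σ) := fun σ =>
    (measurePreserving_comp_perm σ).measurable (measurableSet_weylChamber n)
  have hgσ : ∀ σ : Equiv.Perm (Fin n), g ∘ (fun x => x ∘ σ) = g := fun σ => funext (hg σ)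
  have hSi : ∀ σ, IntegrableOn g (S σ) := fun σ => by
    have h := ((measurePreserving_comp_perm σ).integrableOn_comp_preimage
      (measurableEmbedding_comp_perm σ)).2 hi
    rwa [hgσ] at h
  have hdisj : Pairwise (Function.onFun Disjoint S) := fun σ τ hst =>
    Set.disjoint_left.2 fun x h1 h2 => hst (perm_eq_of_mem_weylChamber h1 h2)
  have hae : ∀ᵐ x : Fin n → ℝ, x ∈ ⋃ σ, S σ := by
    filter_upwards [ae_injective n] with x hx
    obtain ⟨σ, hσ⟩ := exists_perm_mem_weylChamber hx
    exact Set.mem_iUnion.2 ⟨σ, hσ⟩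
  have hres := Measure.restrict_eq_self_of_ae_mem hae
  constructor
  · rw [← hres]
    exact integrableOn_finite_iUnion.2 hSi
  · have h1 : ∫ x in ⋃ σ, S σ, g x = ∑ σ, ∫ x in S σ, g x :=
      integral_iUnion_fintype hSm hdisj hSi
    rw [hres] at h1
    rw [h1]
    have h2 : ∀ σ, ∫ x in S σ, g x = ∫ x in weylChamber n, g x := fun σ => by
      have h := (measurePreserving_comp_perm σ).setIntegral_preimage_emb
        (measurableEmbedding_comp_perm σ) g (weylChamber n)
      simpa only [hg] using h
    simp [h2, Fintype.card_perm]

lemma expDet_comp_perm {n : ℕ} (s x : Fin n → ℝ) (σ : Equiv.Perm (Fin n)) :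
    expDet s (x ∘ σ) = ((Equiv.Perm.sign σ : ℤ) : ℂ) * expDet s x :=
  Matrix.det_permute' σ (Matrix.of fun j k : Fin n =>
    Complex.exp (Complex.I * (s j : ℂ) * (x k : ℂ)))

lemma vdm_comp_perm {n : ℕ} (x : Fin n → ℝ) (σ : Equiv.Perm (Fin n)) :
    vdm (x ∘ σ) = ((Equiv.Perm.sign σ : ℤ) : ℝ) * vdm x := by
  rw [← det_vandermonde_eq_vdm, ← det_vandermonde_eq_vdm]
  exact Matrix.det_permute σ (Matrix.vandermonde x)

lemma exists_conjHerm_diagHerm_comp {n : ℕ} (x : Fin n → ℝ) (σ : Equiv.Perm (Fin n)) :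
    ∃ U : UGroup n, conjHerm U (diagHerm x) = diagHerm (x ∘ σ) := by
  set W : Matrix (Fin n) (Fin n) ℂ := Matrix.of fun i k => if k = σ i then 1 else 0 with hW
  refine ⟨⟨W, ?_⟩, ?_⟩
  · rw [Matrix.mem_unitaryGroup_iff]
    ext i j
    simp [Matrix.mul_apply, hW, Matrix.one_apply, eq_comm]
  · apply Subtype.ext
    rw [conjHerm_coe]
    change W * Matrix.diagonal (fun j => (x j : ℂ)) * star W =
      Matrix.diagonal (fun j => (x (σ j) : ℂ))
    ext i j
    by_cases hij : i = j
    · subst hij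
      simp [Matrix.mul_apply, Matrix.diagonal_apply, hW]
    · simp [Matrix.mul_apply, Matrix.diagonal_apply, hW, hij, Ne.symm hij]

lemma invariant_diagHerm_comp {n : ℕ} {α : Type*} {f : Herm n → α}
    (hinv : ∀ U A, f (conjHerm U A) = f A) (x : Fin n → ℝ) (σ : Equiv.Perm (Fin n)) :
    f (diagHerm (x ∘ σ)) = f (diagHerm x) := by
  obtain ⟨U, hU⟩ := exists_conjHerm_diagHerm_comp x σ
  rw [← hU, hinv]

/-! ### The spherical transform of invariant functions in terms of eigenvalues -/

lemma integral_invariant_mul_diag_of_nonneg {n : ℕ} {f : Herm n → ℝ} (hf : Measurable f)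
    (hf0 : ∀ A, 0 ≤ f A) (hinv : ∀ U A, f (conjHerm U A) = f A) (hfi : Integrable f (lebHerm n))
    {φ : (Fin n → ℝ) → ℂ} (hφ : Measurable φ) (hφ1 : ∀ d, ‖φ d‖ ≤ 1) :
    IntegrableOn (fun l => ((vdm l * f (diagHerm l) : ℝ) : ℂ) * ∫ d, φ d ∂(gtKernel n l))
      (weylChamber n) ∧
    ∫ A, (f A : ℂ) * φ A.diag ∂(lebHerm n) =
      ∫ l in weylChamber n, ((vdm l * f (diagHerm l) : ℝ) : ℂ) * ∫ d, φ d ∂(gtKernel n l) := by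
  have hdm : Measurable (diagHerm : (Fin n → ℝ) → Herm n) := (continuous_diagHerm n).measurable
  have hfd : Measurable fun l : Fin n → ℝ => vdm l * f (diagHerm l) :=
    (continuous_vdm n).measurable.mul (hf.comp hdm)
  set κ : Measure (Herm n) := (lebHerm n).withDensity fun A => ENNReal.ofReal (f A) with hκ
  set ρ : Measure (Fin n → ℝ) := (volume.restrict (weylChamber n)).withDensity
    fun l => ENNReal.ofReal (vdm l * f (diagHerm l)) with hρ
  have hdiag : Measurable (Herm.diag : Herm n → Fin n → ℝ) := (Herm.continuous_diag n).measurable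
  have hmap : Measure.map Herm.diag κ = Measure.map Prod.snd (ρ ⊗ₘ gtKernel n) := by
    refine Measure.ext_of_lintegral _ fun h hh => ?_
    have hhd : Measurable fun A : Herm n => h A.diag := hh.comp hdiag
    have hhs : Measurable fun p : (Fin n → ℝ) × (Fin n → ℝ) => h p.2 := hh.comp measurable_snd
    rw [lintegral_map hh hdiag, lintegral_map hh measurable_snd, Measure.lintegral_compProd hhs,
      lintegral_withDensity_eq_lintegral_mul _ hf.ennreal_ofReal hhd,
      lintegral_withDensity_eq_lintegral_mul _ hfd.ennreal_ofReal
        (Measurable.lintegral_kernel hh)]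
    refine (lintegral_invariant_mul_diag n hf.ennreal_ofReal (fun U A => by rw [hinv]) hh).trans ?_
    refine setLIntegral_congr_fun (measurableSet_weylChamber n) fun l hl => ?_
    rw [Pi.mul_apply, ENNReal.ofReal_mul (vdm_pos hl).le]
  have hκfin : IsFiniteMeasure κ := isFiniteMeasure_withDensity_ofReal hfi.2
  have hfin : IsFiniteMeasure (ρ ⊗ₘ gtKernel n) := by
    constructor
    have h1 := measure_lt_top (Measure.map Herm.diag κ) Set.univ
    rwa [hmap, Measure.map_apply measurable_snd MeasurableSet.univ, Set.preimage_univ] at h1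
  have hint : Integrable (fun p : (Fin n → ℝ) × (Fin n → ℝ) => φ p.2) (ρ ⊗ₘ gtKernel n) :=
    Integrable.of_bound (hφ.comp measurable_snd).aestronglyMeasurable 1
      (Eventually.of_forall fun p => hφ1 _)
  have e1 : ∫ A, (f A : ℂ) * φ A.diag ∂(lebHerm n) = ∫ d, φ d ∂(Measure.map Herm.diag κ) := by
    rw [integral_map hdiag.aemeasurable hφ.aestronglyMeasurable,
      integral_withDensity_eq_integral_toReal_smul hf.ennreal_ofReal
        (Eventually.of_forall fun x => ENNReal.ofReal_lt_top)]
    refine integral_congr_ae (Eventually.of_forall fun A => ?_)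
    simp only [ENNReal.toReal_ofReal (hf0 A), Complex.real_smul]
  have hpos : ∀ l ∈ weylChamber n, (ENNReal.ofReal (vdm l * f (diagHerm l))).toReal =
      vdm l * f (diagHerm l) := fun l hl =>
    ENNReal.toReal_ofReal (mul_nonneg (vdm_pos hl).le (hf0 _))
  have e2 : ∫ d, φ d ∂(Measure.map Prod.snd (ρ ⊗ₘ gtKernel n)) =
      ∫ l in weylChamber n, ((vdm l * f (diagHerm l) : ℝ) : ℂ) * ∫ d, φ d ∂(gtKernel n l) := by
    rw [integral_map measurable_snd.aemeasurable hφ.aestronglyMeasurable,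
      Measure.integral_compProd hint,
      integral_withDensity_eq_integral_toReal_smul hfd.ennreal_ofReal
        (Eventually.of_forall fun x => ENNReal.ofReal_lt_top)]
    refine setIntegral_congr_fun (measurableSet_weylChamber n) fun l hl => ?_
    simp only [hpos l hl, Complex.real_smul]
  refine ⟨?_, by rw [e1, hmap, e2]⟩
  have h1 : Integrable (fun l => ∫ d, φ d ∂(gtKernel n l)) ρ := hint.integral_compProd
  rw [hρ, integrable_withDensity_iff_integrable_smul' hfd.ennreal_ofReal
    (Eventually.of_forall fun x => ENNReal.ofReal_lt_top)] at h1
  refine (integrableOn_congr_fun (fun l hl => ?_) (measurableSet_weylChamber n)).1 h1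
  simp only [hpos l hl, Complex.real_smul]

/-- The integral of an invariant function times a bounded function of the diagonal, for complex
integrable functions: by linearity from the positive and negative parts. -/
lemma integral_invariant_mul_diag {n : ℕ} {f : Herm n → ℂ} (hf : Measurable f)
    (hinv : ∀ U A, f (conjHerm U A) = f A) (hfi : Integrable f (lebHerm n))
    {φ : (Fin n → ℝ) → ℂ} (hφ : Measurable φ) (hφ1 : ∀ d, ‖φ d‖ ≤ 1) :
    IntegrableOn (fun l => (vdm l : ℂ) * f (diagHerm l) * ∫ d, φ d ∂(gtKernel n l))
      (weylChamber n) ∧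
    ∫ A, f A * φ A.diag ∂(lebHerm n) =
      ∫ l in weylChamber n, (vdm l : ℂ) * f (diagHerm l) * ∫ d, φ d ∂(gtKernel n l) := by
  -- The statement is linear in `f`, which is a combination of four nonnegative functions.
  have hdiag : Measurable (Herm.diag : Herm n → Fin n → ℝ) := (Herm.continuous_diag n).measurable
  let Q : (Herm n → ℂ) → Prop := fun f => Integrable f (lebHerm n) ∧
    IntegrableOn (fun l => (vdm l : ℂ) * f (diagHerm l) * ∫ d, φ d ∂(gtKernel n l))
      (weylChamber n) ∧
    ∫ A, f A * φ A.diag ∂(lebHerm n) =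
      ∫ l in weylChamber n, (vdm l : ℂ) * f (diagHerm l) * ∫ d, φ d ∂(gtKernel n l)
  have hQadd : ∀ (c : ℂ) (p q : Herm n → ℂ), Q p → Q q → Q fun A => p A + c * q A := by
    rintro c p q ⟨hp1, hp2, hp3⟩ ⟨hq1, hq2, hq3⟩
    have hmulφ : ∀ g : Herm n → ℂ, Integrable g (lebHerm n) →
        Integrable (fun A => g A * φ A.diag) (lebHerm n) := fun g hg =>
      hg.mul_bdd (c := 1) (hφ.comp hdiag).aestronglyMeasurable
        (Eventually.of_forall fun A => hφ1 _)
    have e1 : ∀ A : Herm n, (p A + c * q A) * φ A.diag =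
        p A * φ A.diag + c * (q A * φ A.diag) := fun A => by ring
    have e2 : ∀ l : Fin n → ℝ, (vdm l : ℂ) * (p (diagHerm l) + c * q (diagHerm l)) *
        ∫ d, φ d ∂(gtKernel n l) = (vdm l : ℂ) * p (diagHerm l) * ∫ d, φ d ∂(gtKernel n l) +
          c * ((vdm l : ℂ) * q (diagHerm l) * ∫ d, φ d ∂(gtKernel n l)) := fun l => by ring
    refine ⟨hp1.add (hq1.const_mul c), ?_, ?_⟩
    · simp only [e2]
      exact hp2.add (hq2.const_mul c)
    · simp only [e1, e2]
      rw [integral_add (hmulφ p hp1) ((hmulφ q hq1).const_mul c), integral_const_mul, hp3, hq3,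
        integral_add hp2 (hq2.const_mul c), integral_const_mul]
  have hQpos : ∀ g : Herm n → ℝ, Measurable g → (∀ U A, g (conjHerm U A) = g A) →
      Integrable g (lebHerm n) → Q fun A => ((max (g A) 0 : ℝ) : ℂ) := by
    intro g hg hginv hgi
    have h := integral_invariant_mul_diag_of_nonneg (f := fun A => max (g A) 0)
      (hg.max measurable_const) (fun A => le_max_right _ _) (fun U A => by rw [hginv])
      hgi.pos_part hφ hφ1
    simp only [Complex.ofReal_mul] at h
    exact ⟨hgi.pos_part.ofReal, h⟩
  have hre : Measurable fun A => (f A).re := Complex.measurable_re.comp hf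
  have him : Measurable fun A => (f A).im := Complex.measurable_im.comp hf
  have h1 := hQadd (-1) _ _
    (hQpos (fun A => (f A).re) hre (fun U A => by rw [hinv]) hfi.re)
    (hQpos (fun A => -(f A).re) hre.neg (fun U A => by rw [hinv]) hfi.re.neg)
  have h2 := hQadd (-1) _ _
    (hQpos (fun A => (f A).im) him (fun U A => by rw [hinv]) hfi.im)
    (hQpos (fun A => -(f A).im) him.neg (fun U A => by rw [hinv]) hfi.im.neg)
  have h3 := hQadd Complex.I _ _ h1 h2
  have hparts : ∀ r : ℝ, ((max r 0 : ℝ) : ℂ) + -1 * ((max (-r) 0 : ℝ) : ℂ) = r := fun r => by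
    have : max r 0 + -1 * max (-r) 0 = r := by
      rcases le_total r 0 with h | h
      · rw [max_eq_right h, max_eq_left (neg_nonneg.2 h)]; ring
      · rw [max_eq_left h, max_eq_right (neg_nonpos.2 h)]; ring
    exact_mod_cast congrArg Complex.ofReal this
  simp only [hparts] at h3
  have hff : (fun A => ((f A).re : ℂ) + Complex.I * ((f A).im : ℂ)) = f := by
    funext A
    rw [mul_comm, Complex.re_add_im]
  rw [hff] at h3
  exact h3.2

lemma piI_ne_zero (n : ℕ) : piI n ≠ 0 :=
  pow_ne_zero _ (mul_ne_zero (by exact_mod_cast Real.pi_ne_zero) Complex.I_ne_zero)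

lemma norm_cexp_neg_I_mul_sum {n : ℕ} (s d : Fin n → ℝ) :
    ‖Complex.exp (-Complex.I * ∑ j, (s j : ℂ) * d j)‖ = 1 := by
  rw [show -Complex.I * ∑ j, (s j : ℂ) * d j = ((-∑ j, s j * d j : ℝ) : ℂ) * Complex.I by
    push_cast; ring, Complex.norm_exp_ofReal_mul_I]

/-- The Fourier transform of an invariant function at a diagonal matrix with distinct entries, as
an integral over eigenvalues. -/
theorem integral_invariant_mul_cexp {n : ℕ} {f : Herm n → ℂ} (hf : Measurable f)
    (hinv : ∀ U A, f (conjHerm U A) = f A) (hfi : Integrable f (lebHerm n))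
    {s : Fin n → ℝ} (hs : Function.Injective s) :
    Integrable (fun x : Fin n → ℝ => f (diagHerm x) * expDet (-s) x * (vdm x : ℂ)) ∧
    ∫ A, f A * Complex.exp (-Complex.I * ∑ j, (s j : ℂ) * A.diag j) ∂(lebHerm n) =
      piI n / ((n.factorial : ℂ) * (vdm s : ℂ)) *
        ∫ x : Fin n → ℝ, f (diagHerm x) * expDet (-s) x * (vdm x : ℂ) := by
  obtain ⟨h1, h2⟩ := integral_invariant_mul_diag hf hinv hfi
    (φ := fun d => Complex.exp (-Complex.I * ∑ j, (s j : ℂ) * d j)) (by fun_prop)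
    (fun d => (norm_cexp_neg_I_mul_sum s d).le)
  have hvs : (vdm s : ℂ) ≠ 0 := by exact_mod_cast vdm_ne_zero hs
  have hc : piI n / vdm s ≠ 0 := div_ne_zero (piI_ne_zero n) hvs
  have e1 : ∀ l ∈ weylChamber n, (vdm l : ℂ) * f (diagHerm l) *
      ∫ d, Complex.exp (-Complex.I * ∑ j, (s j : ℂ) * d j) ∂(gtKernel n l) =
      piI n / vdm s * (f (diagHerm l) * expDet (-s) l * (vdm l : ℂ)) := fun l hl => by
    rw [integral_cexp_gtKernel hs hl]
    ring
  have h3 : IntegrableOn (fun x : Fin n → ℝ => f (diagHerm x) * expDet (-s) x * (vdm x : ℂ))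
      (weylChamber n) := by
    have h := ((integrableOn_congr_fun e1 (measurableSet_weylChamber n)).1 h1).const_mul
      (piI n / vdm s)⁻¹
    simpa only [IntegrableOn, inv_mul_cancel_left₀ hc] using h
  obtain ⟨h4, h5⟩ := integral_eq_factorial_mul (fun σ x => by
    rw [invariant_diagHerm_comp hinv, expDet_comp_perm, vdm_comp_perm]
    have : ((Equiv.Perm.sign σ : ℤ) : ℂ) * ((Equiv.Perm.sign σ : ℤ) : ℂ) = 1 := by
      norm_cast
      simp
    push_cast
    linear_combination (f (diagHerm x) * expDet (-s) x * (vdm x : ℂ)) * this) h3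
  refine ⟨h4, ?_⟩
  have hfac : (n.factorial : ℂ) ≠ 0 := by exact_mod_cast n.factorial_ne_zero
  rw [h5, h2, setIntegral_congr_fun (measurableSet_weylChamber n) e1, integral_const_mul]
  field_simp

instance haarU.instIsMulLeftInvariant (n : ℕ) : (haarU n).IsMulLeftInvariant :=
  Measure.isMulLeftInvariant_haarMeasure _

/-- A unitarily invariant property of almost every Hermitian matrix holds at almost every real
diagonal matrix. -/
lemma ae_diagHerm {n : ℕ} {p : Herm n → Prop} (hinv : ∀ U A, p (conjHerm U A) → p A)
    (h : ∀ᵐ A ∂(lebHerm n), p A) : ∀ᵐ x : Fin n → ℝ, p (diagHerm x) := by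
  -- Averaging the indicator of a null set over the unitary group makes it invariant.
  obtain ⟨N, hsub, hNm, hN0⟩ := exists_measurable_superset_of_null (ae_iff.1 h)
  have hcm : Measurable fun q : UGroup n × Herm n => conjHerm q.1⁻¹ q.2 :=
    ((continuous_conjHerm_uncurry n).comp
      (f := fun q : UGroup n × Herm n => (q.1⁻¹, q.2)) (by fun_prop)).measurable
  have hind : Measurable fun q : UGroup n × Herm n =>
      N.indicator (fun _ => (1 : ENNReal)) (conjHerm q.1⁻¹ q.2) :=
    (measurable_const.indicator hNm).comp hcm
  set f : Herm n → ENNReal := fun A =>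
    ∫⁻ U, N.indicator (fun _ => (1 : ENNReal)) (conjHerm U⁻¹ A) ∂(haarU n) with hf
  have hfm : Measurable f := Measurable.lintegral_prod_left' hind
  have hfinv : ∀ V A, f (conjHerm V A) = f A := by
    intro V A
    have h1 := lintegral_mul_left_eq_self (μ := haarU n)
      (fun U => N.indicator (fun _ => (1 : ENNReal)) (conjHerm U⁻¹ A)) V⁻¹
    refine Eq.trans ?_ h1
    refine lintegral_congr fun U => ?_
    rw [mul_inv_rev, inv_inv, conjHerm_mul]
  have hf0 : ∫⁻ A, f A ∂(lebHerm n) = 0 := by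
    simp only [hf]
    rw [lintegral_lintegral_swap (by
      exact (hind.comp measurable_swap).aemeasurable)]
    refine (lintegral_congr fun U => ?_).trans lintegral_zero
    rw [(measurePreserving_conjHerm U⁻¹).lintegral_comp (measurable_const.indicator hNm),
      lintegral_indicator_const hNm, one_mul, hN0]
  have h2 := lintegral_invariant_mul_diag n hfm hfinv (h := fun _ => 1) measurable_const
  simp only [mul_one, lintegral_one] at h2
  have hgm : Measurable fun l : Fin n → ℝ =>
      ENNReal.ofReal (vdm l) * f (diagHerm l) * gtKernel n l Set.univ :=
    ((continuous_vdm n).measurable.ennreal_ofReal.mul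
      (hfm.comp (continuous_diagHerm n).measurable)).mul
        ((gtKernel n).measurable_coe MeasurableSet.univ)
  rw [hf0, eq_comm, lintegral_eq_zero_iff hgm, Filter.EventuallyEq,
    ae_restrict_iff' (measurableSet_weylChamber n)] at h2
  have h3 : ∀ᵐ l : Fin n → ℝ, l ∈ weylChamber n → f (diagHerm l) = 0 := by
    filter_upwards [h2] with l hl hlW
    have h4 := hl hlW
    simp only [Pi.zero_apply, mul_eq_zero, ENNReal.ofReal_eq_zero] at h4
    rcases h4 with (h4 | h4) | h4
    · exact absurd h4 (vdm_pos hlW).not_ge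
    · exact h4
    · exact absurd h4 (gtKernel_univ_ne_zero hlW)
  have h4 : ∀ᵐ x : Fin n → ℝ, ∀ σ : Equiv.Perm (Fin n),
      x ∘ σ ∈ weylChamber n → f (diagHerm (x ∘ σ)) = 0 :=
    eventually_all.2 fun σ => (measurePreserving_comp_perm σ).quasiMeasurePreserving.ae h3
  filter_upwards [h4, ae_injective n] with x hx hxi
  obtain ⟨σ, hσ⟩ := exists_perm_mem_weylChamber hxi
  have h5 := hx σ hσ
  rw [invariant_diagHerm_comp hfinv] at h5
  by_contra hpx
  have h6 : ∀ U : UGroup n,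
      N.indicator (fun _ => (1 : ENNReal)) (conjHerm U⁻¹ (diagHerm x)) = 1 := by
    intro U
    refine Set.indicator_of_mem (hsub ?_) _
    exact fun hp => hpx (hinv _ _ hp)
  simp only [hf, h6, lintegral_one, measure_univ] at h5
  exact one_ne_zero h5

/-! ### The spherical transform as a Fourier transform -/

/-- The trace pairing `Tr(BA)` of Hermitian matrices, which is a real number. -/
noncomputable def Herm.pair {n : ℕ} (B A : Herm n) : ℝ :=
  (Matrix.trace ((B : Matrix (Fin n) (Fin n) ℂ) * (A : Matrix (Fin n) (Fin n) ℂ))).re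

lemma Herm.pair_comm {n : ℕ} (B A : Herm n) : B.pair A = A.pair B := by
  rw [Herm.pair, Matrix.trace_mul_comm, Herm.pair]

lemma Herm.ofReal_pair {n : ℕ} (B A : Herm n) : (B.pair A : ℂ) =
    Matrix.trace ((B : Matrix (Fin n) (Fin n) ℂ) * (A : Matrix (Fin n) (Fin n) ℂ)) := by
  refine Complex.conj_eq_iff_re.1 ?_
  have hA : star (A : Matrix (Fin n) (Fin n) ℂ) = A := A.2
  have hB : star (B : Matrix (Fin n) (Fin n) ℂ) = B := B.2
  rw [starRingEnd_apply, ← Matrix.trace_conjTranspose, ← Matrix.star_eq_conjTranspose, star_mul,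
    hA, hB, Matrix.trace_mul_comm]

lemma Herm.pair_add_left {n : ℕ} (B C A : Herm n) : (B + C).pair A = B.pair A + C.pair A := by
  simp [Herm.pair, add_mul]

lemma Herm.pair_smul_left {n : ℕ} (c : ℝ) (B A : Herm n) : (c • B).pair A = c * B.pair A := by
  simp [Herm.pair]

lemma Herm.pair_add_right {n : ℕ} (B A C : Herm n) : B.pair (A + C) = B.pair A + B.pair C := by
  simp [Herm.pair, mul_add]

lemma Herm.pair_neg_right {n : ℕ} (B A : Herm n) : B.pair (-A) = -B.pair A := by
  simp [Herm.pair]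

lemma Herm.pair_conjHerm {n : ℕ} (U : UGroup n) (B A : Herm n) :
    (conjHerm U B).pair (conjHerm U A) = B.pair A := by
  rw [Herm.pair, trace_conj_mul_conj, Herm.pair]

lemma Herm.pair_diagHerm {n : ℕ} (s : Fin n → ℝ) (A : Herm n) :
    (diagHerm s).pair A = ∑ j, s j * A.diag j := by
  simp [Herm.pair, Herm.diag, diagHerm_coe, Matrix.trace, Matrix.diagonal_mul]

lemma Herm.continuous_pair (n : ℕ) : Continuous fun p : Herm n × Herm n => p.1.pair p.2 := by
  unfold Herm.pair
  have h1 : Continuous fun p : Herm n × Herm n => (p.1 : Matrix (Fin n) (Fin n) ℂ) :=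
    continuous_subtype_val.comp continuous_fst
  have h2 : Continuous fun p : Herm n × Herm n => (p.2 : Matrix (Fin n) (Fin n) ℂ) :=
    continuous_subtype_val.comp continuous_snd
  exact Complex.continuous_re.comp (h1.matrix_mul h2).matrix_trace

lemma norm_cexp_neg_I_mul_ofReal (t : ℝ) : ‖Complex.exp (-Complex.I * t)‖ = 1 := by
  rw [show -Complex.I * (t : ℂ) = ((-t : ℝ) : ℂ) * Complex.I by push_cast; ring,
    Complex.norm_exp_ofReal_mul_I]

/-- The Fourier transform `∫ f(A) exp(-i Tr(BA)) dA` on `Herm(n)`. -/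
noncomputable def hermFourier {n : ℕ} (f : Herm n → ℝ) (B : Herm n) : ℂ :=
  ∫ A : Herm n, (f A : ℂ) * Complex.exp (-Complex.I * B.pair A) ∂(lebHerm n)

lemma continuous_cexp_pair {n : ℕ} {α : Type*} [TopologicalSpace α] {g h : α → Herm n}
    (hg : Continuous g) (hh : Continuous h) :
    Continuous fun a => Complex.exp (-Complex.I * (g a).pair (h a)) := by
  have h1 : Continuous fun a => (g a).pair (h a) := 
    Continuous.comp (g := fun p : Herm n × Herm n => p.1.pair p.2) (f := fun a => (g a, h a))
      (Herm.continuous_pair n) (hg.prodMk hh)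
  fun_prop

lemma integrable_mul_cexp_pair {n : ℕ} {f : Herm n → ℝ} (hf : Integrable f (lebHerm n))
    (B : Herm n) :
    Integrable (fun A => (f A : ℂ) * Complex.exp (-Complex.I * B.pair A)) (lebHerm n) :=
  hf.ofReal.mul_bdd (c := 1)
    (continuous_cexp_pair continuous_const continuous_id).measurable.aestronglyMeasurable
    (Eventually.of_forall fun _ => (norm_cexp_neg_I_mul_ofReal _).le)

lemma continuous_hermFourier {n : ℕ} {f : Herm n → ℝ} (hf : Integrable f (lebHerm n)) :
    Continuous (hermFourier f) := by
  refine continuous_of_dominated (bound := fun A => ‖f A‖)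
    (fun B => (integrable_mul_cexp_pair hf B).aestronglyMeasurable)
    (fun B => Eventually.of_forall fun A => ?_) hf.norm (Eventually.of_forall fun A => ?_)
  · rw [norm_mul, norm_cexp_neg_I_mul_ofReal, mul_one, Complex.norm_real]
  · exact continuous_const.mul (continuous_cexp_pair continuous_id continuous_const)

lemma norm_hermFourier_le {n : ℕ} (f : Herm n → ℝ) (B : Herm n) :
    ‖hermFourier f B‖ ≤ ∫ A, ‖f A‖ ∂(lebHerm n) := by
  refine (norm_integral_le_integral_norm _).trans_eq (integral_congr_ae ?_)
  filter_upwards with A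
  rw [norm_mul, norm_cexp_neg_I_mul_ofReal, mul_one, Complex.norm_real]

lemma conjHerm_inv_conjHerm {n : ℕ} (U : UGroup n) (A : Herm n) :
    conjHerm U⁻¹ (conjHerm U A) = A := by
  rw [← conjHerm_mul, inv_mul_cancel, conjHerm_one]

lemma conjHerm_conjHerm_inv {n : ℕ} (U : UGroup n) (A : Herm n) :
    conjHerm U (conjHerm U⁻¹ A) = A := by
  rw [← conjHerm_mul, mul_inv_cancel, conjHerm_one]

/-- Conjugation by a unitary matrix as a homeomorphism of `Herm(n)`. -/
def conjHomeomorph {n : ℕ} (U : UGroup n) : Herm n ≃ₜ Herm n where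
  toFun := conjHerm U
  invFun := conjHerm U⁻¹
  left_inv := conjHerm_inv_conjHerm U
  right_inv := conjHerm_conjHerm_inv U
  continuous_toFun := continuous_conjHerm U
  continuous_invFun := continuous_conjHerm U⁻¹

lemma measurableEmbedding_conjHerm {n : ℕ} (U : UGroup n) :
    MeasurableEmbedding (conjHerm U) :=
  (conjHomeomorph U).measurableEmbedding

lemma integral_conjHerm {n : ℕ} (U : UGroup n) (g : Herm n → ℂ) :
    ∫ A, g (conjHerm U A) ∂(lebHerm n) = ∫ A, g A ∂(lebHerm n) :=
  (measurePreserving_conjHerm U).integral_comp (measurableEmbedding_conjHerm U) g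

lemma hermFourier_conjHerm {n : ℕ} {f : Herm n → ℝ} (hinv : ∀ U A, f (conjHerm U A) = f A)
    (U : UGroup n) (B : Herm n) : hermFourier f (conjHerm U B) = hermFourier f B := by
  rw [hermFourier, ← integral_conjHerm U, hermFourier]
  simp only [hinv, Herm.pair_conjHerm]

/-- On invariant functions the spherical transform is the Fourier transform at the diagonal
matrices. -/
lemma sphericalTransform_eq_hermFourier {n : ℕ} {f : Herm n → ℝ}
    (hinv : ∀ U A, f (conjHerm U A) = f A) (hf : Integrable f (lebHerm n)) (s : Fin n → ℝ) :
    sphericalTransform f s = hermFourier f (diagHerm s) := by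
  have e1 : ∀ (A : Herm n) (U : UGroup n), Complex.exp (Complex.I * Matrix.trace
      ((diagHerm s : Matrix (Fin n) (Fin n) ℂ) *
        (conjHerm U (-A) : Matrix (Fin n) (Fin n) ℂ))) =
      Complex.exp (-Complex.I * (diagHerm s).pair (conjHerm U A)) := by
    intro A U
    have : conjHerm U (-A) = -conjHerm U A := by
      ext1
      simp [conjHerm_coe]
    rw [this, ← Herm.ofReal_pair, Herm.pair_neg_right]
    push_cast
    congr 1
    ring
  have hc : Continuous fun p : Herm n × UGroup n =>
      Complex.exp (-Complex.I * (diagHerm s).pair (conjHerm p.2 p.1)) :=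
    continuous_cexp_pair continuous_const
      ((continuous_conjHerm_uncurry n).comp
        (f := fun p : Herm n × UGroup n => (p.2, p.1)) (by fun_prop))
  have hint : Integrable (Function.uncurry fun (A : Herm n) (U : UGroup n) =>
      (f A : ℂ) * Complex.exp (-Complex.I * (diagHerm s).pair (conjHerm U A)))
      ((lebHerm n).prod (haarU n)) :=
    ((hf.ofReal (𝕜 := ℂ)).comp_fst (haarU n)).mul_bdd (c := 1) hc.measurable.aestronglyMeasurable
      (Eventually.of_forall fun _ => (norm_cexp_neg_I_mul_ofReal _).le)
  simp only [sphericalTransform, sphericalFun, e1, ← integral_const_mul]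
  rw [integral_integral_swap hint]
  have h1 : ∀ U : UGroup n, ∫ A, (f A : ℂ) * Complex.exp
      (-Complex.I * (diagHerm s).pair (conjHerm U A)) ∂(lebHerm n) =
      hermFourier f (diagHerm s) := by
    intro U
    have h2 := integral_conjHerm U fun A =>
      (f A : ℂ) * Complex.exp (-Complex.I * (diagHerm s).pair A)
    simpa only [hinv, hermFourier] using h2
  simp only [h1, integral_const, probReal_univ, one_smul]

/-! ### Invariant densities -/

namespace IsInvariantDensity

variable {n : ℕ} {f : Herm n → ℝ} {ρ : Measure (Herm n)}

lemma integrable [IsFiniteMeasure ρ] (hf : IsInvariantDensity f ρ) :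
    Integrable f (lebHerm n) := by
  refine ⟨hf.measurable.aestronglyMeasurable, ?_⟩
  rw [hasFiniteIntegral_iff_ofReal (Eventually.of_forall hf.nonneg)]
  have h := measure_lt_top ρ Set.univ
  rwa [hf.law_eq, withDensity_apply _ MeasurableSet.univ, Measure.restrict_univ] at h

lemma integral_law (hf : IsInvariantDensity f ρ) (g : Herm n → ℂ) :
    ∫ A, g A ∂ρ = ∫ A, (f A : ℂ) * g A ∂(lebHerm n) := by
  rw [hf.law_eq, integral_withDensity_eq_integral_toReal_smul hf.measurable.ennreal_ofReal
    (Eventually.of_forall fun _ => ENNReal.ofReal_lt_top)]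
  simp only [ENNReal.toReal_ofReal (hf.nonneg _), Complex.real_smul]

lemma hasEigenvalueForm [IsFiniteMeasure ρ] (hf : IsInvariantDensity f ρ) :
    HasEigenvalueForm f := by
  have he : sphericalTransform f = fun s => hermFourier f (diagHerm s) :=
    funext (sphericalTransform_eq_hermFourier hf.invariant hf.integrable)
  refine ⟨?_, fun s hs => ?_⟩
  · rw [he]
    exact (continuous_hermFourier hf.integrable).comp (continuous_diagHerm n)
  · obtain ⟨h1, h2⟩ := integral_invariant_mul_cexp (f := fun A => (f A : ℂ))
      (Complex.measurable_ofReal.comp hf.measurable) (fun U A => by rw [hf.invariant])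
      hf.integrable.ofReal hs
    refine ⟨h1, ?_⟩
    rw [he]
    refine Eq.trans ?_ h2
    simp only [hermFourier, Herm.pair_diagHerm]
    push_cast
    rfl

end IsInvariantDensity

/-- The Fourier transform turns the law of a sum of independent matrices into a product. -/
lemma sphericalTransform_add {n : ℕ} {Ω : Type*} [MeasurableSpace Ω] {P : Measure Ω}
    [IsProbabilityMeasure P] {X Y : Ω → Herm n} (hX : AEMeasurable X P) (hY : AEMeasurable Y P)
    (hXY : IndepFun X Y P) {fX fY fZ : Herm n → ℝ}
    (hfX : IsInvariantDensity fX (P.map X)) (hfY : IsInvariantDensity fY (P.map Y))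
    (hfZ : IsInvariantDensity fZ (P.map (X + Y))) (s : Fin n → ℝ) :
    sphericalTransform fZ s = sphericalTransform fX s * sphericalTransform fY s := by
  have hm : Continuous fun A : Herm n => Complex.exp (-Complex.I * (diagHerm s).pair A) :=
    continuous_cexp_pair continuous_const continuous_id
  have key : ∀ {Z : Ω → Herm n} {f : Herm n → ℝ}, AEMeasurable Z P →
      IsInvariantDensity f (P.map Z) → sphericalTransform f s =
        ∫ ω, Complex.exp (-Complex.I * (diagHerm s).pair (Z ω)) ∂P := by
    intro Z f hZ hf
    have := Measure.isProbabilityMeasure_map hZ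
    rw [sphericalTransform_eq_hermFourier hf.invariant hf.integrable, hermFourier,
      ← hf.integral_law fun A => Complex.exp (-Complex.I * (diagHerm s).pair A),
      integral_map hZ hm.measurable.aestronglyMeasurable]
  rw [key hX hfX, key hY hfY, key (hX.add hY) hfZ]
  have h := hXY.integral_fun_comp_mul_comp hX hY
    (f := fun A => Complex.exp (-Complex.I * (diagHerm s).pair A))
    (g := fun A => Complex.exp (-Complex.I * (diagHerm s).pair A))
    hm.measurable.aestronglyMeasurable hm.measurable.aestronglyMeasurable
  refine Eq.trans ?_ h
  refine integral_congr_ae (Eventually.of_forall fun ω => ?_)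
  simp only [Pi.add_apply, Herm.pair_add_right, ← Complex.exp_add]
  push_cast
  ring_nf

lemma conjHerm_add {n : ℕ} (U : UGroup n) (A B : Herm n) :
    conjHerm U (A + B) = conjHerm U A + conjHerm U B := by
  ext1
  simp [conjHerm_coe, mul_add, add_mul]

lemma conjHerm_neg {n : ℕ} (U : UGroup n) (A : Herm n) :
    conjHerm U (-A) = -conjHerm U A := by
  ext1
  simp [conjHerm_coe]

/-- The convolution of two invariant densities is an invariant density of the sum. -/
lemma exists_isInvariantDensity_add {n : ℕ} {Ω : Type*} [MeasurableSpace Ω] {P : Measure Ω}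
    [IsProbabilityMeasure P] {X Y : Ω → Herm n} (hX : AEMeasurable X P) (hY : AEMeasurable Y P)
    (hXY : IndepFun X Y P) {fX fY : Herm n → ℝ}
    (hfX : IsInvariantDensity fX (P.map X)) (hfY : IsInvariantDensity fY (P.map Y)) :
    ∃ fZ : Herm n → ℝ, IsInvariantDensity fZ (P.map (X + Y)) := by
  have hmX := hfX.measurable.ennreal_ofReal
  have hmY := hfY.measurable.ennreal_ofReal
  set g : Herm n → ENNReal := lconvolution (fun A => ENNReal.ofReal (fX A))
    (fun A => ENNReal.ofReal (fY A)) (lebHerm n) with hg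
  have hgm : Measurable g := measurable_lconvolution _ hmX hmY
  have hlaw : P.map (X + Y) = (lebHerm n).withDensity g := by
    rw [hXY.map_add_eq_map_conv_map₀ hX hY, hfX.law_eq, hfY.law_eq,
      conv_withDensity_eq_lconvolution hmX hmY]
  have hprob := Measure.isProbabilityMeasure_map (μ := P) (hX.add hY)
  have hfin : ∀ᵐ A ∂(lebHerm n), g A < ⊤ := by
    refine ae_lt_top hgm ?_
    have h := measure_ne_top (P.map (X + Y)) Set.univ
    rwa [hlaw, withDensity_apply _ MeasurableSet.univ, Measure.restrict_univ] at h
  refine ⟨fun A => (g A).toReal, hgm.ennreal_toReal, fun A => ENNReal.toReal_nonneg,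
    fun U A => ?_, ?_⟩
  · have hcomp : Measurable fun B => ENNReal.ofReal (fX B) *
        ENNReal.ofReal (fY (-B + conjHerm U A)) :=
      hmX.mul (hmY.comp ((continuous_neg.add continuous_const).measurable))
    congr 1
    simp only [hg, lconvolution_def]
    rw [← (measurePreserving_conjHerm U).lintegral_comp hcomp]
    refine lintegral_congr fun B => ?_
    rw [hfX.invariant, ← conjHerm_neg, ← conjHerm_add, hfY.invariant]
  · rw [hlaw]
    refine withDensity_congr_ae ?_
    filter_upwards [hfin] with A hA
    rw [ENNReal.ofReal_toReal hA.ne]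

/-! ### Gaussian means at Lebesgue points -/

/-- The superlevel sets of a Gaussian are balls. -/
lemma le_exp_neg_sq_iff {t a u : ℝ} (ht : 0 < t) (ht1 : t < 1) (ha : 0 < a) (hu : 0 ≤ u) :
    t ≤ Real.exp (-(u / a) ^ 2) ↔ u ≤ a * √(-Real.log t) := by
  have hl : 0 ≤ -Real.log t := by linarith [Real.log_neg ht ht1]
  rw [← Real.log_le_iff_le_exp ht, le_neg, ← Real.le_sqrt (by positivity), div_le_iff₀' ha]
  exact hl

lemma setOf_le_exp_neg_sq {V : Type*} [NormedAddCommGroup V] {t a : ℝ} (x : V)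
    (ht : 0 < t) (ht1 : t < 1) (ha : 0 < a) :
    {y : V | t ≤ Real.exp (-(‖y - x‖ / a) ^ 2)} = Metric.closedBall x (a * √(-Real.log t)) := by
  ext y
  rw [Set.mem_ofPred_eq, le_exp_neg_sq_iff ht ht1 ha (norm_nonneg _), Metric.mem_closedBall,
    dist_eq_norm]

lemma setOf_le_exp_neg_sq_eq_empty {V : Type*} [NormedAddCommGroup V] {t a : ℝ} (x : V)
    (ht1 : 1 < t) :
    {y : V | t ≤ Real.exp (-(‖y - x‖ / a) ^ 2)} = ∅ := by
  refine Set.eq_empty_of_forall_notMem fun y hy => ?_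
  have h1 : Real.exp (-(‖y - x‖ / a) ^ 2) ≤ 1 := Real.exp_le_one_iff.2 (by
    have := sq_nonneg (‖y - x‖ / a)
    linarith)
  exact absurd (hy.trans h1) ht1.not_ge

lemma lintegral_exp_neg_sq_eq {V : Type*} [NormedAddCommGroup V] [MeasurableSpace V]
    [BorelSpace V] (x : V) (a : ℝ) (ν : Measure V) :
    ∫⁻ y, ENNReal.ofReal (Real.exp (-(‖y - x‖ / a) ^ 2)) ∂ν =
      ∫⁻ t in Set.Ioi (0 : ℝ), ν {y : V | t ≤ Real.exp (-(‖y - x‖ / a) ^ 2)} := by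
  refine lintegral_eq_lintegral_meas_le ν (Eventually.of_forall fun y => (Real.exp_pos _).le) ?_
  have : Continuous fun y : V => Real.exp (-(‖y - x‖ / a) ^ 2) := by fun_prop
  exact this.measurable.aemeasurable

section GaussianMeans

variable {V : Type*} [NormedAddCommGroup V] [InnerProductSpace ℝ V] [FiniteDimensional ℝ V]
  [MeasurableSpace V] [BorelSpace V]

/-- `x` is a Lebesgue point of `f`: the mean of `‖f y - f x‖` over the closed balls around `x`
tends to zero with the radius. -/
def IsLebesguePoint (f : V → ℝ) (x : V) : Prop :=
  Tendsto (fun r : ℝ => (∫⁻ y in Metric.closedBall x r, ‖f y - f x‖ₑ) /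
    volume (Metric.closedBall x r)) (𝓝[>] 0) (𝓝 0)

lemma volume_closedBall_ne_zero (x : V) {r : ℝ} (hr : 0 < r) :
    volume (Metric.closedBall x r) ≠ 0 :=
  (Metric.measure_closedBall_pos volume x hr).ne'

lemma volume_closedBall_ne_top (x : V) (r : ℝ) : volume (Metric.closedBall x r) ≠ ⊤ :=
  measure_closedBall_lt_top.ne

lemma ae_isLebesguePoint {f : V → ℝ} (hf : Integrable f) :
    ∀ᵐ x, IsLebesguePoint f x := by
  filter_upwards [IsUnifLocDoublingMeasure.ae_tendsto_average_norm_sub volume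
    hf.locallyIntegrable 1] with x hx
  have h := hx (fun _ : ℝ => x) (fun r => r) (l := 𝓝[>] 0) tendsto_id
    (eventually_mem_nhdsWithin.mono fun r (hr : 0 < r) =>
      Metric.mem_closedBall_self (by simpa using hr.le))
  have h2 := (ENNReal.continuous_ofReal.tendsto 0).comp h
  rw [ENNReal.ofReal_zero] at h2
  refine h2.congr' (eventually_mem_nhdsWithin.mono fun r (hr : 0 < r) => ?_)
  have hi : IntegrableOn (fun y => ‖f y - f x‖) (Metric.closedBall x r) :=
    (hf.integrableOn.sub (integrableOn_const (volume_closedBall_ne_top x r))).norm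
  rw [Function.comp_apply, ofReal_setAverage hi (Eventually.of_forall fun y => norm_nonneg _)]
  simp only [ofReal_norm]

lemma isLebesguePoint_of_continuousAt {f : V → ℝ} {x : V} (hf : ContinuousAt f x) :
    IsLebesguePoint f x := by
  refine ENNReal.tendsto_nhds_zero.2 fun η hη => ?_
  have h1 : ∀ᶠ y in 𝓝 x, ‖f y - f x‖ₑ ≤ η := by
    have h : Tendsto (fun y => ‖f y - f x‖ₑ) (𝓝 x) (𝓝 0) := by
      have h' : ContinuousAt (fun y => ‖f y - f x‖ₑ) x := (hf.sub continuousAt_const).enorm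
      have := h'.tendsto
      rwa [sub_self, enorm_zero] at this
    exact h.eventually_le_const hη
  obtain ⟨δ, hδ, hb⟩ := Metric.nhds_basis_closedBall.eventually_iff.1 h1
  filter_upwards [Ioc_mem_nhdsGT hδ] with r hr
  refine ENNReal.div_le_of_le_mul ?_
  rw [← setLIntegral_const]
  exact setLIntegral_mono measurable_const fun y hy =>
    hb (Metric.closedBall_subset_closedBall hr.2 hy)

/-- The ball means of `‖f y - f x‖` at a Lebesgue point are bounded over all radii. -/
lemma IsLebesguePoint.exists_bound {f : V → ℝ} {x : V} (h : IsLebesguePoint f x)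
    (hf : Integrable f) : ∃ D : ENNReal, D ≠ ⊤ ∧ ∀ r : ℝ, 0 < r →
      (∫⁻ y in Metric.closedBall x r, ‖f y - f x‖ₑ) / volume (Metric.closedBall x r) ≤ D := by
  obtain ⟨δ, hδ, hb⟩ := mem_nhdsGT_iff_exists_Ioc_subset.1
    (ENNReal.tendsto_nhds_zero.1 h 1 one_pos)
  have hδ' : 0 < δ := hδ
  refine ⟨1 + ((∫⁻ y, ‖f y‖ₑ) / volume (Metric.closedBall x δ) + ‖f x‖ₑ), ?_, fun r hr => ?_⟩
  · refine ENNReal.add_ne_top.2 ⟨ENNReal.one_ne_top, ENNReal.add_ne_top.2 ⟨?_, enorm_ne_top⟩⟩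
    exact ENNReal.div_ne_top hf.2.ne (volume_closedBall_ne_zero x hδ')
  rcases le_or_gt r δ with hrδ | hrδ
  · exact (hb ⟨hr, hrδ⟩ : _ ≤ _).trans le_self_add
  refine le_trans ?_ le_add_self
  have hv0 := volume_closedBall_ne_zero x hr
  have hvt := volume_closedBall_ne_top x r
  calc _ ≤ ((∫⁻ y, ‖f y‖ₑ) + ‖f x‖ₑ * volume (Metric.closedBall x r)) /
        volume (Metric.closedBall x r) := by
        gcongr
        calc _ ≤ ∫⁻ y in Metric.closedBall x r, (‖f y‖ₑ + ‖f x‖ₑ) :=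
              lintegral_mono fun y => enorm_sub_le
          _ = (∫⁻ y in Metric.closedBall x r, ‖f y‖ₑ) +
              ‖f x‖ₑ * volume (Metric.closedBall x r) := by
              rw [lintegral_add_right _ measurable_const, setLIntegral_const]
          _ ≤ _ := by gcongr; exact Measure.restrict_le_self
    _ = (∫⁻ y, ‖f y‖ₑ) / volume (Metric.closedBall x r) + ‖f x‖ₑ := by
        rw [ENNReal.add_div, ENNReal.mul_div_cancel_right hv0 hvt]
    _ ≤ _ := by gcongr

lemma integrable_exp_neg_mul_sq_norm {b : ℝ} (hb : 0 < b) :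
    Integrable fun v : V => Real.exp (-b * ‖v‖ ^ 2) := by
  have h := (GaussianFourier.integrable_cexp_neg_mul_sq_norm_add (V := V) (b := b)
    (by simpa using hb) 0 0).re
  refine h.congr (Eventually.of_forall fun v => ?_)
  have : (-(b : ℂ) * (‖v‖ : ℂ) ^ 2 + 0 * ((inner ℝ 0 v : ℝ) : ℂ)) = ((-b * ‖v‖ ^ 2 : ℝ) : ℂ) := by
    push_cast
    ring
  simp only [this, RCLike.re_to_complex, Complex.exp_ofReal_re]

/-- Gaussian means of `‖f y - f x‖` around a Lebesgue point `x` tend to zero: by the layer cake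
formula a Gaussian is a mixture of indicators of balls. -/
lemma IsLebesguePoint.tendsto_lintegral {f : V → ℝ} {x : V} (h : IsLebesguePoint f x)
    (hf : Integrable f) (hfm : Measurable f) :
    Tendsto (fun a : ℝ => ENNReal.ofReal ((a ^ Module.finrank ℝ V)⁻¹) *
      ∫⁻ y, ‖f y - f x‖ₑ * ENNReal.ofReal (Real.exp (-(‖y - x‖ / a) ^ 2))) (𝓝[>] 0) (𝓝 0) := by
  obtain ⟨D, hD, hDb⟩ := h.exists_bound hf
  have hm : Measurable fun y => ‖f y - f x‖ₑ := (hfm.sub_const _).enorm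
  set ν : Measure V := volume.withDensity fun y => ‖f y - f x‖ₑ with hν
  have hball : ∀ r, ν (Metric.closedBall x r) =
      ∫⁻ y in Metric.closedBall x r, ‖f y - f x‖ₑ := fun r =>
    withDensity_apply _ Metric.isClosed_closedBall.measurableSet
  set S : ℝ → ℝ → Set V := fun a t => {y : V | t ≤ Real.exp (-(‖y - x‖ / a) ^ 2)} with hS
  -- For `0 < t < 1` the scaled measure of a superlevel set is a ball mean times a fixed volume.
  have hscale : ∀ a t : ℝ, 0 < a → 0 < t → t < 1 →
      ENNReal.ofReal ((a ^ Module.finrank ℝ V)⁻¹) * ν (S a t) =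
        ν (Metric.closedBall x (a * √(-Real.log t))) /
          volume (Metric.closedBall x (a * √(-Real.log t))) * volume (S 1 t) := by
    intro a t ha ht ht1
    have hr : 0 < √(-Real.log t) := Real.sqrt_pos.2 (by linarith [Real.log_neg ht ht1])
    have hv0 := volume_closedBall_ne_zero x (mul_pos ha hr)
    have hvt := volume_closedBall_ne_top x (a * √(-Real.log t))
    have e1 : volume (S 1 t) = ENNReal.ofReal ((a ^ Module.finrank ℝ V)⁻¹) *
        volume (Metric.closedBall x (a * √(-Real.log t))) := by
      simp only [hS]
      rw [setOf_le_exp_neg_sq x ht ht1 one_pos, one_mul, Measure.addHaar_closedBall _ _ hr.le,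
        Measure.addHaar_closedBall _ _ (mul_pos ha hr).le, ← mul_assoc,
        ← ENNReal.ofReal_mul (by positivity), mul_pow, inv_mul_cancel_left₀ (by positivity)]
    rw [e1]
    simp only [hS]
    rw [setOf_le_exp_neg_sq x ht ht1 ha, mul_left_comm, ENNReal.div_mul_cancel hv0 hvt]
  have hanti : ∀ (a : ℝ) (μ : Measure V), Measurable fun t => μ (S a t) := fun a μ => by
    refine Antitone.measurable fun t t' htt' => measure_mono fun y hy => ?_
    exact htt'.trans hy
  have hne1 : ∀ᵐ t ∂(volume.restrict (Set.Ioi (0 : ℝ))), t ≠ 1 :=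
    ae_restrict_of_ae (compl_mem_ae_iff.2 (measure_singleton 1))
  have hpos : ∀ᵐ t ∂(volume.restrict (Set.Ioi (0 : ℝ))), 0 < t :=
    ae_restrict_mem measurableSet_Ioi
  have hfin : ∫⁻ t in Set.Ioi (0 : ℝ), D * volume (S 1 t) ≠ ⊤ := by
    rw [lintegral_const_mul _ (hanti 1 volume), ← lintegral_exp_neg_sq_eq x 1]
    refine ENNReal.mul_ne_top hD ?_
    have hi2 := ((integrable_exp_neg_mul_sq_norm (V := V) one_pos).comp_sub_right x).2
    rw [hasFiniteIntegral_iff_ofReal (Eventually.of_forall fun y => (Real.exp_pos _).le)] at hi2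
    simpa using hi2.ne
  have hlim := tendsto_lintegral_filter_of_dominated_convergence
    (μ := volume.restrict (Set.Ioi (0 : ℝ))) (l := 𝓝[>] (0 : ℝ)) (f := fun _ => 0)
    (F := fun a t => ENNReal.ofReal ((a ^ Module.finrank ℝ V)⁻¹) * ν (S a t))
    (fun t => D * volume (S 1 t)) (Eventually.of_forall fun a => (hanti a ν).const_mul _)
    (eventually_mem_nhdsWithin.mono fun a (ha : 0 < a) => ?_) hfin ?_
  · rw [lintegral_zero] at hlim
    refine hlim.congr fun a => ?_
    rw [lintegral_const_mul _ (hanti a ν), ← lintegral_exp_neg_sq_eq x a, hν,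
      lintegral_withDensity_eq_lintegral_mul _ hm]
    · rfl
    · have : Continuous fun y : V => Real.exp (-(‖y - x‖ / a) ^ 2) := by fun_prop
      exact this.measurable.ennreal_ofReal
  · filter_upwards [hne1, hpos] with t ht1 ht
    rcases lt_or_gt_of_ne ht1 with h1 | h1
    · rw [hscale a t ha ht h1, hball]
      have hr : 0 < √(-Real.log t) := Real.sqrt_pos.2 (by linarith [Real.log_neg ht h1])
      gcongr
      exact hDb _ (mul_pos ha hr)
    · simp [hS, setOf_le_exp_neg_sq_eq_empty x h1]
  · filter_upwards [hne1, hpos] with t ht1 ht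
    rcases lt_or_gt_of_ne ht1 with h1 | h1
    · have hr : 0 < √(-Real.log t) := Real.sqrt_pos.2 (by linarith [Real.log_neg ht h1])
      have hto : Tendsto (fun a : ℝ => a * √(-Real.log t)) (𝓝[>] 0) (𝓝[>] 0) := by
        refine tendsto_nhdsWithin_iff.2 ⟨?_, eventually_mem_nhdsWithin.mono
          fun a (ha : 0 < a) => mul_pos ha hr⟩
        have : Tendsto (fun a : ℝ => a * √(-Real.log t)) (𝓝 0) (𝓝 (0 * √(-Real.log t))) :=
          tendsto_id.mul_const _
        rw [zero_mul] at this
        exact this.mono_left nhdsWithin_le_nhds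
      have hfv : volume (S 1 t) ≠ ⊤ := by
        simp only [hS]
        rw [setOf_le_exp_neg_sq x ht h1 one_pos]
        exact volume_closedBall_ne_top _ _
      have := ENNReal.Tendsto.mul_const (h.comp hto) (b := volume (S 1 t)) (Or.inr hfv)
      rw [zero_mul] at this
      refine this.congr' (eventually_mem_nhdsWithin.mono fun a (ha : 0 < a) => ?_)
      refine Eq.trans ?_ (hscale a t ha ht h1).symm
      rw [hball]
      rfl
    · simp [hS, setOf_le_exp_neg_sq_eq_empty x h1]

/-- The Fourier transform of a Gaussian. -/
lemma integral_gaussian_mul_cexp {ε : ℝ} (hε : 0 < ε) (w : V) :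
    ∫ B : V, (Real.exp (-ε * ‖B‖ ^ 2) : ℂ) * Complex.exp (Complex.I * (inner ℝ B w : ℝ)) =
      (((Real.pi / ε) ^ (Module.finrank ℝ V / 2 : ℝ) * Real.exp (-‖w‖ ^ 2 / (4 * ε)) : ℝ) : ℂ) := by
  have h := GaussianFourier.integral_cexp_neg_mul_sq_norm_add (V := V) (b := ε)
    (by simpa using hε) Complex.I w
  have hε' : (ε : ℂ) ≠ 0 := by exact_mod_cast hε.ne'
  rw [Complex.ofReal_mul, Complex.ofReal_cpow (by positivity)]
  push_cast
  refine Eq.trans (integral_congr_ae (Eventually.of_forall fun B => ?_)) (h.trans ?_)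
  · simp only []
    rw [← Complex.exp_add, real_inner_comm]
  · rw [Complex.I_sq]
    congr 2
    ring

lemma integral_gaussian_kernel {ε : ℝ} (hε : 0 < ε) :
    ∫ w : V, (Real.pi / ε) ^ (Module.finrank ℝ V / 2 : ℝ) * Real.exp (-‖w‖ ^ 2 / (4 * ε)) =
      (2 * Real.pi) ^ Module.finrank ℝ V := by
  have h := GaussianFourier.integral_rexp_neg_mul_sq_norm (V := V) (b := 1 / (4 * ε))
    (by positivity)
  rw [integral_const_mul]
  have e : ∀ w : V, Real.exp (-‖w‖ ^ 2 / (4 * ε)) = Real.exp (-(1 / (4 * ε)) * ‖w‖ ^ 2) :=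
    fun w => by congr 1; ring
  simp only [e, h]
  rw [← Real.mul_rpow (by positivity) (by positivity),
    show Real.pi / ε * (Real.pi / (1 / (4 * ε))) = (2 * Real.pi) ^ 2 by field_simp; ring,
    ← Real.rpow_natCast, ← Real.rpow_mul (by positivity), ← Real.rpow_natCast]
  congr 1
  push_cast
  ring

/-- The Gaussian-regularized Fourier inversion integral is a Gaussian mean. -/
lemma integral_fourier_mul_gaussian {f : V → ℝ} (hf : Integrable f) (x : V) {ε : ℝ} (hε : 0 < ε) :
    ∫ B : V, (∫ A, (f A : ℂ) * Complex.exp (-Complex.I * (inner ℝ B A : ℝ))) *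
        (Real.exp (-ε * ‖B‖ ^ 2) : ℂ) * Complex.exp (Complex.I * (inner ℝ B x : ℝ)) =
      ((∫ A, f A * ((Real.pi / ε) ^ (Module.finrank ℝ V / 2 : ℝ) *
        Real.exp (-‖x - A‖ ^ 2 / (4 * ε))) : ℝ) : ℂ) := by
  have hc : Continuous fun p : V × V =>
      Complex.exp (Complex.I * (inner ℝ p.1 (x - p.2) : ℝ)) := by fun_prop
  have hint : Integrable (Function.uncurry fun B A : V =>
      (Real.exp (-ε * ‖B‖ ^ 2) : ℂ) * (f A : ℂ) *
      Complex.exp (Complex.I * (inner ℝ B (x - A) : ℝ))) (volume.prod volume) := by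
    refine Integrable.mul_bdd (c := 1) ?_ hc.measurable.aestronglyMeasurable
      (Eventually.of_forall fun p => ?_)
    · exact ((integrable_exp_neg_mul_sq_norm (V := V) hε).ofReal (𝕜 := ℂ)).mul_prod
        (hf.ofReal (𝕜 := ℂ))
    · rw [mul_comm, Complex.norm_exp_ofReal_mul_I]
  have e1 : ∀ B : V, (∫ A, (f A : ℂ) * Complex.exp (-Complex.I * (inner ℝ B A : ℝ))) *
        (Real.exp (-ε * ‖B‖ ^ 2) : ℂ) * Complex.exp (Complex.I * (inner ℝ B x : ℝ)) =
      ∫ A, (Real.exp (-ε * ‖B‖ ^ 2) : ℂ) * (f A : ℂ) *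
        Complex.exp (Complex.I * (inner ℝ B (x - A) : ℝ)) := by
    intro B
    rw [mul_assoc, ← integral_mul_const]
    refine integral_congr_ae (Eventually.of_forall fun A => ?_)
    simp only []
    rw [inner_sub_right, Complex.ofReal_sub, mul_sub, sub_eq_add_neg, Complex.exp_add,
      ← neg_mul]
    ring
  simp only [e1]
  rw [integral_integral_swap hint, ← integral_complex_ofReal]
  refine integral_congr_ae (Eventually.of_forall fun A => ?_)
  simp only []
  rw [Complex.ofReal_mul, ← integral_gaussian_mul_cexp hε, ← integral_const_mul]
  refine integral_congr_ae (Eventually.of_forall fun B => ?_)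
  simp only []
  ring

/-- Gaussian-regularized Fourier inversion at a Lebesgue point. -/
theorem IsLebesguePoint.tendsto_fourier_inversion {f : V → ℝ} {x : V} (h : IsLebesguePoint f x)
    (hf : Integrable f) (hfm : Measurable f) :
    Tendsto (fun ε : ℝ => ∫ B : V, (∫ A, (f A : ℂ) * Complex.exp (-Complex.I * (inner ℝ B A : ℝ))) *
        (Real.exp (-ε * ‖B‖ ^ 2) : ℂ) * Complex.exp (Complex.I * (inner ℝ B x : ℝ)))
      (𝓝[>] 0) (𝓝 (((2 * Real.pi) ^ Module.finrank ℝ V * f x : ℝ) : ℂ)) := by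
  set d := Module.finrank ℝ V with hd
  set K : ℝ → V → ℝ := fun ε A =>
    (Real.pi / ε) ^ (d / 2 : ℝ) * Real.exp (-‖x - A‖ ^ 2 / (4 * ε)) with hK
  have hKi : ∀ {ε : ℝ}, 0 < ε → Integrable (K ε) := fun {ε} hε => by
    have h1 := ((integrable_exp_neg_mul_sq_norm (V := V) (b := 1 / (4 * ε))
      (by positivity)).comp_sub_left x).const_mul ((Real.pi / ε) ^ (d / 2 : ℝ))
    refine h1.congr (Eventually.of_forall fun A => ?_)
    simp only [hK]
    congr 2
    ring
  have hK1 : ∀ {ε : ℝ}, 0 < ε → ∫ A, K ε A = (2 * Real.pi) ^ d := fun {ε} hε => by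
    rw [← integral_gaussian_kernel (V := V) hε]
    exact integral_sub_left_eq_self
      (fun w : V => (Real.pi / ε) ^ (d / 2 : ℝ) * Real.exp (-‖w‖ ^ 2 / (4 * ε))) volume x
  have hKb : ∀ {ε : ℝ}, 0 < ε → Integrable fun A => f A * K ε A := fun {ε} hε => by
    have hc : Continuous (K ε) := by
      simp only [hK]
      fun_prop
    refine hf.mul_bdd (c := (Real.pi / ε) ^ (d / 2 : ℝ)) hc.measurable.aestronglyMeasurable
      (Eventually.of_forall fun A => ?_)
    simp only [hK]
    rw [norm_mul, Real.norm_of_nonneg (by positivity), Real.norm_of_nonneg (by positivity)]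
    refine mul_le_of_le_one_right (by positivity) (Real.exp_le_one_iff.2 ?_)
    rw [neg_div]
    have : 0 ≤ ‖x - A‖ ^ 2 / (4 * ε) := by positivity
    linarith
  -- The substitution `a = 2 √ε` turns the kernel into the one of the Gaussian means.
  have hto : Tendsto (fun ε : ℝ => 2 * √ε) (𝓝[>] 0) (𝓝[>] 0) := by
    refine tendsto_nhdsWithin_iff.2 ⟨?_, eventually_mem_nhdsWithin.mono
      fun a (ha : 0 < a) => mul_pos two_pos (Real.sqrt_pos.2 ha)⟩
    have h1 : Tendsto (fun ε : ℝ => 2 * √ε) (𝓝 0) (𝓝 (2 * √0)) :=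
      (Real.continuous_sqrt.tendsto 0).const_mul 2
    rw [Real.sqrt_zero, mul_zero] at h1
    exact h1.mono_left nhdsWithin_le_nhds
  have hKa : ∀ {ε : ℝ}, 0 < ε → ∀ A, K ε A = (4 * Real.pi) ^ (d / 2 : ℝ) *
      (((2 * √ε) ^ d)⁻¹ * Real.exp (-(‖A - x‖ / (2 * √ε)) ^ 2)) := fun {ε} hε A => by
    have h1 : (2 * √ε) ^ 2 = 4 * ε := by rw [mul_pow, Real.sq_sqrt hε.le]; norm_num
    have h2 : (2 * √ε) ^ d = (4 * ε) ^ (d / 2 : ℝ) := by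
      rw [← h1, ← Real.rpow_natCast (2 * √ε) 2, ← Real.rpow_mul (by positivity),
        ← Real.rpow_natCast]
      congr 1
      push_cast
      ring
    simp only [hK]
    rw [h2, ← mul_assoc, ← div_eq_mul_inv, ← Real.div_rpow (by positivity) (by positivity),
      mul_div_mul_left _ _ four_ne_zero, div_pow, h1, norm_sub_rev, neg_div]
  have hlim := ENNReal.Tendsto.const_mul ((h.tendsto_lintegral hf hfm).comp hto)
    (a := ENNReal.ofReal ((4 * Real.pi) ^ (d / 2 : ℝ))) (Or.inr ENNReal.ofReal_ne_top)
  rw [mul_zero] at hlim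
  have hlim2 : Tendsto (fun ε : ℝ => ∫ A, (f A - f x) * K ε A) (𝓝[>] 0) (𝓝 0) := by
    refine tendsto_zero_iff_enorm_tendsto_zero.2 ?_
    refine tendsto_of_tendsto_of_tendsto_of_le_of_le' tendsto_const_nhds hlim
      (Eventually.of_forall fun _ => zero_le) (eventually_mem_nhdsWithin.mono
        fun ε (hε : 0 < ε) => ?_)
    refine (enorm_integral_le_lintegral_enorm _).trans_eq ?_
    have hm : Measurable fun A => ‖f A - f x‖ₑ *
        ENNReal.ofReal (Real.exp (-(‖A - x‖ / (2 * √ε)) ^ 2)) := by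
      have : Continuous fun y : V => Real.exp (-(‖y - x‖ / (2 * √ε)) ^ 2) := by fun_prop
      exact (hfm.sub_const _).enorm.mul this.measurable.ennreal_ofReal
    simp only [Function.comp_apply]
    rw [← mul_assoc, ← lintegral_const_mul _ hm]
    refine lintegral_congr fun A => ?_
    rw [enorm_mul, hKa hε,
      Real.enorm_of_nonneg (r := (4 * Real.pi) ^ (d / 2 : ℝ) * _) (by positivity),
      ENNReal.ofReal_mul (by positivity),
      ENNReal.ofReal_mul (by positivity)]
    ring
  have hlim3 : Tendsto (fun ε : ℝ => ∫ A, f A * K ε A) (𝓝[>] 0) (𝓝 ((2 * Real.pi) ^ d * f x)) := by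
    have h1 := hlim2.add_const ((2 * Real.pi) ^ d * f x)
    rw [zero_add] at h1
    refine h1.congr' (eventually_mem_nhdsWithin.mono fun ε (hε : 0 < ε) => ?_)
    simp only [sub_mul]
    rw [integral_sub (hKb hε) ((hKi hε).const_mul _), integral_const_mul, hK1 hε]
    ring
  refine ((Complex.continuous_ofReal.tendsto _).comp hlim3).congr'
    (eventually_mem_nhdsWithin.mono fun ε (hε : 0 < ε) => ?_)
  exact (integral_fourier_mul_gaussian hf x hε).symm

end GaussianMeans

/-! ### Fourier inversion on the space of Hermitian matrices -/

instance Herm.instContinuousConstSMul (n : ℕ) : ContinuousConstSMul ℝ (Herm n) :=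
  ⟨fun c => (continuous_subtype_val.const_smul c).subtype_mk _⟩

lemma Herm.pair_self {n : ℕ} (A : Herm n) :
    A.pair A = ∑ j, ∑ k, ‖(A : Matrix (Fin n) (Fin n) ℂ) j k‖ ^ 2 := by
  rw [Herm.pair, trace_mul_self_eq, Complex.ofReal_re]

lemma Herm.norm_apply_sq_le_pair {n : ℕ} (A : Herm n) (j k : Fin n) :
    ‖(A : Matrix (Fin n) (Fin n) ℂ) j k‖ ^ 2 ≤ A.pair A := by
  rw [Herm.pair_self]
  refine le_trans ?_ (Finset.single_le_sum
    (f := fun j => ∑ k, ‖(A : Matrix (Fin n) (Fin n) ℂ) j k‖ ^ 2)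
    (fun j _ => Finset.sum_nonneg fun k _ => sq_nonneg _) (Finset.mem_univ j))
  exact Finset.single_le_sum (f := fun k => ‖(A : Matrix (Fin n) (Fin n) ℂ) j k‖ ^ 2)
    (fun k _ => sq_nonneg _) (Finset.mem_univ k)

lemma Herm.pair_self_nonneg {n : ℕ} (A : Herm n) : 0 ≤ A.pair A := by
  rw [Herm.pair_self]
  positivity

/-- The trace pairing as an inner product on `Herm(n)`. -/
@[reducible] noncomputable def hermCore (n : ℕ) : InnerProductSpace.Core ℝ (Herm n) where
  inner B A := B.pair A
  conj_inner_symm B A := A.pair_comm B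
  re_inner_nonneg A := A.pair_self_nonneg
  add_left B C A := B.pair_add_left C A
  smul_left B A c := B.pair_smul_left c A
  definite A hA := by
    ext j k
    have h := A.norm_apply_sq_le_pair j k
    rw [show A.pair A = 0 from hA] at h
    simpa using (pow_eq_zero_iff two_ne_zero).1 (le_antisymm h (sq_nonneg _))

lemma continuousAt_pair_self (n : ℕ) : ContinuousAt (fun A : Herm n => A.pair A) 0 :=
  (Continuous.comp (g := fun p : Herm n × Herm n => p.1.pair p.2) (f := fun A => (A, A))
    (Herm.continuous_pair n)
      (continuous_id.prodMk continuous_id)).continuousAt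

lemma isVonNBounded_pair_lt_one (n : ℕ) :
    Bornology.IsVonNBounded ℝ {A : Herm n | A.pair A < 1} := by
  have h1 := (NormedSpace.isVonNBounded_closedBall ℝ (HermCoords n) 1).image
    (hermEquiv n : HermCoords n →L[ℝ] Herm n)
  refine h1.subset ?_
  intro A (hA : A.pair A < 1)
  refine ⟨(hermEquiv n).symm A, ?_, (hermEquiv n).apply_symm_apply A⟩
  have h2 : ∀ j k, ‖(A : Matrix (Fin n) (Fin n) ℂ) j k‖ ≤ 1 := fun j k => by
    have h3 := (A.norm_apply_sq_le_pair j k).trans (le_of_lt hA)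
    exact (sq_le_one_iff₀ (norm_nonneg _)).1 h3
  rw [mem_closedBall_zero_iff]
  refine max_le ((pi_norm_le_iff_of_nonneg zero_le_one).2 fun j => ?_)
    ((pi_norm_le_iff_of_nonneg zero_le_one).2 fun q => h2 _ _)
  exact (Complex.abs_re_le_norm _).trans (h2 j j)

lemma sum_sum_eq_diag_add_two_mul {n : ℕ} (g : Fin n → Fin n → ℝ) (hg : ∀ j k, g j k = g k j) :
    ∑ j, ∑ k, g j k =
      ∑ j, g j j + 2 * ∑ q : {q : Fin n × Fin n // q.1 < q.2}, g q.1.1 q.1.2 := by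
  have h1 : ∀ j k : Fin n, g j k = (if j = k then g j k else 0) +
      (if j < k then g j k else 0) + (if k < j then g j k else 0) := fun j k => by
    rcases lt_trichotomy j k with h | h | h
    · simp [h, h.ne, h.not_gt]
    · simp [h]
    · simp [h, h.ne', h.not_gt]
  have h2 : ∑ j, ∑ k, (if k < j then g j k else 0) = ∑ j, ∑ k, (if j < k then g j k else 0) := by
    rw [Finset.sum_comm]
    simp only [hg]
  have h3 : ∑ q : {q : Fin n × Fin n // q.1 < q.2}, g q.1.1 q.1.2 =
      ∑ j, ∑ k, (if j < k then g j k else 0) := by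
    rw [← Fintype.sum_prod_type' (f := fun j k => if j < k then g j k else 0),
      ← Finset.sum_filter]
    exact (Finset.sum_subtype (p := fun q : Fin n × Fin n => q.1 < q.2) _ (by simp)
      fun q => g q.1 q.2).symm
  calc ∑ j, ∑ k, g j k = ∑ j, ∑ k, ((if j = k then g j k else 0) +
      (if j < k then g j k else 0) + (if k < j then g j k else 0)) :=
        Finset.sum_congr rfl fun j _ => Finset.sum_congr rfl fun k _ => h1 j k
    _ = _ := by
        simp only [Finset.sum_add_distrib]
        rw [h2, h3]
        simp
        ring

lemma sq_eq_add_two_mul_card (n : ℕ) :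
    n ^ 2 = n + 2 * Fintype.card {q : Fin n × Fin n // q.1 < q.2} := by
  have h := sum_sum_eq_diag_add_two_mul (n := n) (fun _ _ => 1) (fun _ _ => rfl)
  simp only [Finset.sum_const, Finset.card_univ, Fintype.card_fin, nsmul_eq_mul, mul_one] at h
  rw [sq]
  exact_mod_cast h

lemma finrank_herm (n : ℕ) : Module.finrank ℝ (Herm n) = n ^ 2 := by
  rw [← (hermEquiv n).toLinearEquiv.finrank_eq, Module.finrank_prod, Module.finrank_pi,
    Module.finrank_pi_fintype, sq_eq_add_two_mul_card]
  simp [Complex.finrank_real_complex, mul_comm]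

lemma integral_exp_neg_two_mul_norm_sq_complex :
    ∫ z : ℂ, Real.exp (-2 * ‖z‖ ^ 2) = Real.pi / 2 := by
  have h := GaussianFourier.integral_rexp_neg_mul_sq_norm (V := ℂ) two_pos
  rw [Complex.finrank_real_complex] at h
  simpa using h

/-- The Gaussian integral over `Herm(n)`. -/
lemma integral_exp_neg_pair_self (n : ℕ) :
    ∫ A : Herm n, Real.exp (-A.pair A) ∂(lebHerm n) = √Real.pi ^ n *
      (Real.pi / 2) ^ Fintype.card {q : Fin n × Fin n // q.1 < q.2} := by
  rw [← (measurePreserving_hermEquiv n).integral_comp (measurableEmbedding_hermEquiv n)]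
  have h1 : ∀ p : HermCoords n, Real.exp (-(hermEquiv n p).pair (hermEquiv n p)) =
      (∏ j, Real.exp (-1 * p.1 j ^ 2)) * ∏ q, Real.exp (-2 * ‖p.2 q‖ ^ 2) := by
    intro p
    have h2 : (hermEquiv n p).pair (hermEquiv n p) =
        ∑ j, p.1 j ^ 2 + 2 * ∑ q, ‖p.2 q‖ ^ 2 := by
      rw [Herm.pair_self, sum_sum_eq_diag_add_two_mul _ fun j k => by
        rw [← Herm.star_apply _ j k, norm_star]]
      congr 1
      · refine Finset.sum_congr rfl fun j _ => ?_
        rw [show ((hermEquiv n p : Herm n) : Matrix (Fin n) (Fin n) ℂ) j j = _ from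
          hermOfCoords_diag p j, Complex.norm_real, Real.norm_eq_abs, sq_abs]
      · congr 1
        refine Finset.sum_congr rfl fun q _ => ?_
        rw [show ((hermEquiv n p : Herm n) : Matrix (Fin n) (Fin n) ℂ) q.1.1 q.1.2 = _ from
          hermOfCoords_upper p q.2]
    rw [h2, ← Real.exp_sum, ← Real.exp_sum, ← Real.exp_add, ← Finset.mul_sum, ← Finset.mul_sum]
    congr 1
    ring
  simp only [h1]
  rw [Measure.volume_eq_prod, integral_prod_mul
    (fun a : Fin n → ℝ => ∏ j, Real.exp (-1 * a j ^ 2))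
    (fun z : {q : Fin n × Fin n // q.1 < q.2} → ℂ => ∏ q, Real.exp (-2 * ‖z q‖ ^ 2)),
    integral_fintype_prod_volume_eq_pow (fun x : ℝ => Real.exp (-1 * x ^ 2)),
    integral_fintype_prod_volume_eq_pow (fun z : ℂ => Real.exp (-2 * ‖z‖ ^ 2)),
    integral_exp_neg_two_mul_norm_sq_complex, integral_gaussian, div_one, Fintype.card_fin]

/-- The Gaussian-regularized Fourier inversion on `Herm(n)` recovers `f` at `A`. -/
def GaussianInversionAt {n : ℕ} (f : Herm n → ℝ) (A : Herm n) : Prop :=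
  Tendsto (fun ε : ℝ => ∫ B, hermFourier f B * (Real.exp (-ε * B.pair B) : ℂ) *
      Complex.exp (Complex.I * B.pair A) ∂(lebHerm n)) (𝓝[>] 0)
    (𝓝 (((2 * Real.pi) ^ n * Real.pi ^ (n * (n - 1)) * f A : ℝ) : ℂ))

theorem gaussianInversionAt {n : ℕ} {f : Herm n → ℝ} (hfm : Measurable f)
    (hf : Integrable f (lebHerm n)) :
    (∀ᵐ A ∂(lebHerm n), GaussianInversionAt f A) ∧
      ∀ A, ContinuousAt f A → GaussianInversionAt f A := by
  have h0 := continuousAt_pair_self n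
  have h1 := isVonNBounded_pair_lt_one n
  let _ : NormedAddCommGroup (Herm n) := (hermCore n).toNormedAddCommGroupOfTopology h0 h1
  let _ : InnerProductSpace ℝ (Herm n) := InnerProductSpace.ofCoreOfTopology (hermCore n) h0 h1
  have hfd : FiniteDimensional ℝ (Herm n) := (hermEquiv n).toLinearEquiv.finiteDimensional
  have hinner : ∀ B A : Herm n, (inner ℝ B A : ℝ) = B.pair A := fun _ _ => rfl
  have hnorm : ∀ B : Herm n, ‖B‖ ^ 2 = B.pair B := fun B => by
    rw [← real_inner_self_eq_norm_sq, hinner]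
  set κ := (lebHerm n).addHaarScalarFactor (volume : Measure (Herm n)) with hκ
  have hleb : lebHerm n = κ • (volume : Measure (Herm n)) :=
    Measure.isAddLeftInvariant_eq_smul _ _
  have hκ0 : κ ≠ 0 := (Measure.addHaarScalarFactor_pos_of_isAddHaarMeasure _ _).ne'
  set N := Fintype.card {q : Fin n × Fin n // q.1 < q.2} with hN
  have hsq : n ^ 2 = n + 2 * N := sq_eq_add_two_mul_card n
  -- The Gaussian integral determines the normalization of `lebHerm` relative to the Euclidean
  -- volume.
  have hconst : (κ : ℝ) * ((κ : ℝ) * (2 * Real.pi) ^ Module.finrank ℝ (Herm n)) =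
      (2 * Real.pi) ^ n * Real.pi ^ (n * (n - 1)) := by
    have h2 := integral_exp_neg_pair_self n
    have h3 := GaussianFourier.integral_rexp_neg_mul_sq_norm (V := Herm n) one_pos
    rw [hleb, integral_smul_nnreal_measure] at h2
    simp only [hnorm, neg_mul, one_mul, div_one] at h3
    rw [h3, NNReal.smul_def, smul_eq_mul, finrank_herm] at h2
    have h4 : (Real.pi ^ ((n ^ 2 : ℕ) / 2 : ℝ)) ^ 2 = Real.pi ^ (n ^ 2) := by
      rw [← Real.rpow_natCast, ← Real.rpow_mul Real.pi_pos.le, ← Real.rpow_natCast]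
      congr 1
      push_cast
      ring
    have h5 := congrArg (· ^ 2) h2
    simp only [mul_pow, h4] at h5
    rw [← pow_mul, mul_comm n 2, pow_mul, Real.sq_sqrt Real.pi_pos.le] at h5
    have h6 : n * (n - 1) = 2 * N := by
      rw [Nat.mul_sub_one, ← sq, hsq]
      omega
    rw [finrank_herm, h6]
    calc (κ : ℝ) * (κ * (2 * Real.pi) ^ n ^ 2) = 2 ^ n ^ 2 * (κ ^ 2 * Real.pi ^ n ^ 2) := by
          rw [mul_pow]; ring
      _ = _ := by
          have h7 : (2 : ℝ) ^ (2 * N) * ((Real.pi / 2) ^ N) ^ 2 = Real.pi ^ (2 * N) := by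
            rw [← pow_mul, mul_comm N 2, ← mul_pow, mul_div_cancel₀ _ two_ne_zero]
          rw [h5, ← hN, hsq, pow_add, mul_pow, ← h7]
          ring
  have hfv : Integrable f := by
    rw [hleb] at hf
    exact (integrable_smul_measure (c := (κ : ENNReal)) (by simpa using hκ0)
      ENNReal.coe_ne_top).1 hf
  have key : ∀ A, IsLebesguePoint f A → GaussianInversionAt f A := by
    intro A hA
    have h2 := ((hA.tendsto_fourier_inversion hfv hfm).const_mul (((κ : ℝ) * κ : ℝ) : ℂ))
    have e1 : (((κ : ℝ) * κ : ℝ) : ℂ) *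
        (((2 * Real.pi) ^ Module.finrank ℝ (Herm n) * f A : ℝ) : ℂ) =
        (((2 * Real.pi) ^ n * Real.pi ^ (n * (n - 1)) * f A : ℝ) : ℂ) := by
      rw [← hconst]
      push_cast
      ring
    rw [e1] at h2
    refine h2.congr fun ε => ?_
    simp only [hermFourier, hinner, hnorm]
    rw [hleb]
    simp only [integral_smul_nnreal_measure, NNReal.smul_def, Complex.real_smul, mul_assoc,
      integral_const_mul]
    push_cast
    ring
  refine ⟨?_, fun A hA => key A (isLebesguePoint_of_continuousAt hA)⟩
  have h2 : ∀ᵐ A ∂(lebHerm n), IsLebesguePoint f A := by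
    rw [hleb]
    exact Measure.ae_smul_measure (ae_isLebesguePoint hfv) κ
  exact h2.mono key

/-! ### The inversion formula over the eigenvalues -/

lemma integrable_exp_neg_mul_pair_self (n : ℕ) {ε : ℝ} (hε : 0 < ε) :
    Integrable (fun A : Herm n => Real.exp (-ε * A.pair A)) (lebHerm n) := by
  have h0 := continuousAt_pair_self n
  have h1 := isVonNBounded_pair_lt_one n
  let _ : NormedAddCommGroup (Herm n) := (hermCore n).toNormedAddCommGroupOfTopology h0 h1
  let _ : InnerProductSpace ℝ (Herm n) := InnerProductSpace.ofCoreOfTopology (hermCore n) h0 h1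
  have hfd : FiniteDimensional ℝ (Herm n) := (hermEquiv n).toLinearEquiv.finiteDimensional
  have hnorm : ∀ B : Herm n, ‖B‖ ^ 2 = B.pair B := fun B => by
    rw [← real_inner_self_eq_norm_sq]
    rfl
  have h2 := integrable_exp_neg_mul_sq_norm (V := Herm n) hε
  simp only [hnorm] at h2
  rw [show lebHerm n = (lebHerm n).addHaarScalarFactor (volume : Measure (Herm n)) •
    (volume : Measure (Herm n)) from Measure.isAddLeftInvariant_eq_smul _ _]
  exact h2.smul_measure_nnreal

lemma diag_diagHerm {n : ℕ} (s : Fin n → ℝ) : (diagHerm s).diag = s := by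
  funext j
  simp [Herm.diag, diagHerm_coe]

lemma pair_diagHerm_self {n : ℕ} (s : Fin n → ℝ) :
    (diagHerm s).pair (diagHerm s) = ∑ j, s j ^ 2 := by
  rw [Herm.pair_diagHerm, diag_diagHerm]
  simp only [sq]

lemma expDet_comm {n : ℕ} (s x : Fin n → ℝ) : expDet s x = expDet x s := by
  rw [expDet, ← Matrix.det_transpose, expDet]
  congr 1
  ext j k
  simp only [Matrix.transpose_apply, Matrix.of_apply]
  ring_nf

lemma vdm_neg {n : ℕ} (x : Fin n → ℝ) : vdm (-x) = (-1) ^ (n * (n - 1) / 2) * vdm x := by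
  have h1 : ∀ j k : Fin n, (-x) k - (-x) j = (-1) * (x k - x j) := fun j k => by
    simp only [Pi.neg_apply]
    ring
  have h2 : ∑ j : Fin n, (Finset.Ioi j).card = n * (n - 1) / 2 := by
    simp only [Fin.card_Ioi]
    rw [Fin.sum_univ_eq_sum_range fun j => n - 1 - j, Finset.sum_range_reflect (fun j => j),
      Finset.sum_range_id]
  simp only [vdm, h1, Finset.prod_mul_distrib, Finset.prod_const]
  rw [Finset.prod_pow_eq_pow_sum, h2]

lemma piI_sq (n : ℕ) :
    piI n ^ 2 = (Real.pi : ℂ) ^ (n * (n - 1)) * (-1) ^ (n * (n - 1) / 2) := by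
  have h : n * (n - 1) = 2 * (n * (n - 1) / 2) :=
    (Nat.mul_div_cancel' (Nat.even_mul_pred_self n).two_dvd).symm
  rw [piI, ← pow_mul, mul_comm _ 2, pow_mul, mul_pow, Complex.I_sq, mul_pow, ← pow_mul, ← h]

/-- The inversion formula holds at every diagonal matrix with distinct entries at which the
Gaussian-regularized Fourier inversion recovers `f`. -/
theorem GaussianInversionAt.inversionHoldsAt {n : ℕ} {f : Herm n → ℝ} {x : Fin n → ℝ}
    (h : GaussianInversionAt f (diagHerm x)) (hinv : ∀ U A, f (conjHerm U A) = f A)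
    (hf : Integrable f (lebHerm n)) (hx : Function.Injective x) :
    InversionHoldsAt (fun s => hermFourier f (diagHerm s)) (f (diagHerm x)) x := by
  set F : (Fin n → ℝ) → ℂ := fun s => hermFourier f (diagHerm s) with hF
  have hpc : Continuous fun B : Herm n => B.pair B :=
    Continuous.comp (g := fun p : Herm n × Herm n => p.1.pair p.2) (f := fun A => (A, A))
      (Herm.continuous_pair n) (continuous_id.prodMk continuous_id)
  have hvx : (vdm x : ℂ) ≠ 0 := by exact_mod_cast vdm_ne_zero hx
  have hmain : ∀ ε : ℝ, 0 < ε →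
      Integrable (fun s : Fin n → ℝ =>
        (Real.exp (-ε * ∑ j, s j ^ 2) : ℂ) * inversionIntegrand F x s) ∧
      ∫ B, hermFourier f B * (Real.exp (-ε * B.pair B) : ℂ) *
        Complex.exp (Complex.I * B.pair (diagHerm x)) ∂(lebHerm n) =
        piI n / ((n.factorial : ℂ) * (vdm (-x) : ℂ)) * ∫ s : Fin n → ℝ,
          (Real.exp (-ε * ∑ j, s j ^ 2) : ℂ) * inversionIntegrand F x s := by
    intro ε hε
    have hgc : Continuous fun B : Herm n =>
        hermFourier f B * (Real.exp (-ε * B.pair B) : ℂ) := by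
      have := continuous_hermFourier hf
      fun_prop
    obtain ⟨h1, h2⟩ := integral_invariant_mul_cexp
      (f := fun B : Herm n => hermFourier f B * (Real.exp (-ε * B.pair B) : ℂ)) hgc.measurable
      (fun U A => by rw [hermFourier_conjHerm hinv, Herm.pair_conjHerm])
      ((integrable_exp_neg_mul_pair_self n hε).ofReal.bdd_mul
        (continuous_hermFourier hf).measurable.aestronglyMeasurable
        (Eventually.of_forall (norm_hermFourier_le f)))
      (s := -x) (neg_injective.comp hx)
    have e1 : ∀ s : Fin n → ℝ, hermFourier f (diagHerm s) *
        (Real.exp (-ε * (diagHerm s).pair (diagHerm s)) : ℂ) * expDet (- -x) s * (vdm s : ℂ) =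
        (Real.exp (-ε * ∑ j, s j ^ 2) : ℂ) * inversionIntegrand F x s := fun s => by
      rw [neg_neg, expDet_comm, pair_diagHerm_self, inversionIntegrand]
      ring
    simp only [e1] at h1 h2
    refine ⟨h1, ?_⟩
    rw [← h2]
    refine integral_congr_ae (Eventually.of_forall fun B => ?_)
    simp only [Herm.pair_comm B, Herm.pair_diagHerm, Pi.neg_apply]
    congr 2
    push_cast
    simp only [neg_mul, Finset.sum_neg_distrib, neg_neg, mul_neg]
  -- The constant of the Fourier inversion formula turns `(π i)^N / Δ(-x)` into the factor of the
  -- inversion formula, where `N = n (n - 1) / 2`.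
  have hfactor : inversionFactor x =
      (((2 * Real.pi) ^ n * Real.pi ^ (n * (n - 1)) : ℝ) : ℂ)⁻¹ *
        (piI n / ((n.factorial : ℂ) * (vdm (-x) : ℂ))) := by
    have hp := piI_ne_zero n
    have hfac : (n.factorial : ℂ) ≠ 0 := by exact_mod_cast n.factorial_ne_zero
    have hpi : (Real.pi : ℂ) ≠ 0 := by exact_mod_cast Real.pi_ne_zero
    have hsgn : ((-1 : ℂ) ^ (n * (n - 1) / 2)) ≠ 0 := pow_ne_zero _ (neg_ne_zero.2 one_ne_zero)
    have h2 := piI_sq n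
    rw [inversionFactor, vdm_neg]
    push_cast
    field_simp
    rw [h2]
  have hlim : Tendsto (fun ε : ℝ => inversionFactor x * ∫ s : Fin n → ℝ,
      (Real.exp (-ε * ∑ j, s j ^ 2) : ℂ) * inversionIntegrand F x s) (𝓝[>] 0)
      (𝓝 (f (diagHerm x) : ℂ)) := by
    have h1 := Tendsto.const_mul (((2 * Real.pi) ^ n * Real.pi ^ (n * (n - 1)) : ℝ) : ℂ)⁻¹ h
    have hne : (((2 * Real.pi) ^ n * Real.pi ^ (n * (n - 1)) : ℝ) : ℂ) ≠ 0 := by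
      have : (2 * Real.pi) ^ n * Real.pi ^ (n * (n - 1)) ≠ 0 := by positivity
      exact_mod_cast this
    rw [Complex.ofReal_mul _ (f (diagHerm x)), inv_mul_cancel_left₀ hne] at h1
    refine h1.congr' (eventually_mem_nhdsWithin.mono fun ε (hε : 0 < ε) => ?_)
    simp only []
    rw [(hmain ε hε).2, hfactor]
    ring
  refine ⟨fun hi => ?_, fun ε hε => (hmain ε hε).1, hlim⟩
  refine tendsto_nhds_unique hlim (Tendsto.const_mul _ ?_)
  refine tendsto_integral_filter_of_dominated_convergence (fun s => ‖inversionIntegrand F x s‖)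
    (eventually_mem_nhdsWithin.mono fun ε (hε : 0 < ε) => (hmain ε hε).1.aestronglyMeasurable)
    (eventually_mem_nhdsWithin.mono fun ε (hε : 0 < ε) => Eventually.of_forall fun s => ?_)
    hi.norm (Eventually.of_forall fun s => ?_)
  · rw [norm_mul, Complex.norm_real, Real.norm_of_nonneg (Real.exp_pos _).le]
    refine mul_le_of_le_one_left (norm_nonneg _) (Real.exp_le_one_iff.2 ?_)
    have : 0 ≤ ε * ∑ j, s j ^ 2 := by positivity
    linarith
  · have hc : Continuous fun ε : ℝ =>
        (Real.exp (-ε * ∑ j, s j ^ 2) : ℂ) * inversionIntegrand F x s := by fun_prop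
    have h1 := (hc.tendsto 0).mono_left (nhdsWithin_le_nhds (s := Set.Ioi 0))
    simpa using h1

theorem theorem1p1 (n : ℕ) {Ω : Type*} [MeasurableSpace Ω] (P : Measure Ω)
    [IsProbabilityMeasure P] (X Y : Ω → Herm n) (hX : AEMeasurable X P) (hY : AEMeasurable Y P)
    (hXY : IndepFun X Y P) (fX fY : Herm n → ℝ)
    (hfX : IsInvariantDensity fX (P.map X)) (hfY : IsInvariantDensity fY (P.map Y)) :
    HasEigenvalueForm fX ∧ HasEigenvalueForm fY ∧
    (∃ fZ : Herm n → ℝ, IsInvariantDensity fZ (P.map (X + Y))) ∧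
    ∀ fZ : Herm n → ℝ, IsInvariantDensity fZ (P.map (X + Y)) →
      HasEigenvalueForm fZ ∧
      (∀ s : Fin n → ℝ,
        sphericalTransform fZ s = sphericalTransform fX s * sphericalTransform fY s) ∧
      (∀ᵐ x : Fin n → ℝ,
        InversionHoldsAt (fun s => sphericalTransform fX s * sphericalTransform fY s)
          (fZ (diagHerm x)) x) ∧
      (∀ x : Fin n → ℝ, Function.Injective x → ContinuousAt fZ (diagHerm x) →
        InversionHoldsAt (fun s => sphericalTransform fX s * sphericalTransform fY s)
          (fZ (diagHerm x)) x) := by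
  refine ⟨hfX.hasEigenvalueForm, hfY.hasEigenvalueForm,
    exists_isInvariantDensity_add hX hY hXY hfX hfY, fun fZ hfZ => ?_⟩
  have hmul := sphericalTransform_add hX hY hXY hfX hfY hfZ
  have hF : (fun s => sphericalTransform fX s * sphericalTransform fY s) =
      fun s => hermFourier fZ (diagHerm s) := funext fun s => by
    rw [← hmul, sphericalTransform_eq_hermFourier hfZ.invariant hfZ.integrable]
  obtain ⟨hae, hcont⟩ := gaussianInversionAt hfZ.measurable hfZ.integrable
  refine ⟨hfZ.hasEigenvalueForm, hmul, ?_, fun x hx hc => ?_⟩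
  · have hinv : ∀ (U : UGroup n) (A : Herm n),
        GaussianInversionAt fZ (conjHerm U A) → GaussianInversionAt fZ A := by
      intro U A hA
      rw [GaussianInversionAt, hfZ.invariant] at hA
      refine hA.congr fun ε => ?_
      rw [← integral_conjHerm U fun B => hermFourier fZ B * (Real.exp (-ε * B.pair B) : ℂ) *
        Complex.exp (Complex.I * B.pair (conjHerm U A))]
      simp only [hermFourier_conjHerm hfZ.invariant, Herm.pair_conjHerm]
    filter_upwards [ae_diagHerm hinv hae, ae_injective n] with x hx hxi
    rw [hF]
    exact hx.inversionHoldsAt hfZ.invariant hfZ.integrable hxi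
  · rw [hF]
    exact (hcont _ hc).inversionHoldsAt hfZ.invariant hfZ.integrable hx
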